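/- Let $K$ be a field of characteristic zero, let $0\le g\le n$ be integers, $\mathcal O=K[[X_1,\dots,X_n]]$, $\mathfrak m=(X_1,\dots,X_n)$ and $P=(X_1,\dots,X_g)\subseteq\mathcal O$. Let $D$ be the ring of $K$-linear differential operators on $\mathcal O$, with the filtration $\Sigma_k$ = operators of order $\le k$; then $\operatorname{gr}D=\bigoplus_k\Sigma_k/\Sigma_{k-1}$ is a commutative ring, with graded maximal ideal $\mathcal M=\mathfrak m\oplus\bigoplus_{k\ge1}\Sigma_k/\Sigma_{k-1}$. A good filtration of a left $D$-module $M$ is an increasing exhaustive filtration $F_0\subseteq F_1\subseteq\cdots$ of $M$ by $K$-subspaces with $\Sigma_iF_j\subseteq F_{i+j}$ such that $\operatorname{gr}_FM=\bigoplus_jF_j/F_{j-1}$ (with $F_{-1}=0$) is a finitely generated $\operatorname{gr}D$-module. A nonzero finitely generated module $N$ of dimension $d$ over a Noetherian local ring $(R,\mathfrak n)$ has multiplicity $\lim_{t\to\infty}d!\,\ell(N/\mathfrak n^tN)/t^d$, and $e_{\mathcal M}(M)=e$ means that $M$ is finitely generated over $D$, has a good filtration, and for every good filtration $F$ of $M$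 the $(\operatorname{gr}D)_{\mathcal M}$-module $(\operatorname{gr}_FM)_{\mathcal M}$ has multiplicity $e$. For an ideal $I$ of $\mathcal O$ let $\Gamma_I(M)$ be the submodule of elements of $M$ killed by a power of $I$, and let $H^i_I$ be the $i$-th right derived functor of $\Gamma_I$. If $M$ is a left $D$-module then $\Gamma_I(M)$ is a $D$-submodule, and $H^i_I(M)$ is regarded as a left $D$-module by deriving $\Gamma_I$ on the category of left $D$-modules. (1) Suppose $g\ge1$. The $\mathcal O$-module underlying the left $D$-module $H^g_P(\mathcal O)$ is isomorphic to the local cohomology of the $\mathcal O$-module $\mathcal O$, we have $e_{\mathcal M}(H^g_P(\mathcal O))=1$, and $H^g_P(\mathcal O)$ is a simple $D$-module. (2) Suppose $g<n$ and let $J\subseteq P$ be an ideal. Let $\theta^g\colon H^g_P(\mathcal O)\to H^g_J(\mathcal O)$ be the natural $\mathcal O$-linear map, induced by the inclusion $\Gamma_P\subseteq\Gamma_J$ on an injective resolution of $\mathcal O$. Then $\operatorname{Ass}_{\mathcal O}(\operatorname{image}\theta^g)$ is either empty or equal to $\{P\}$. In particular $\mathfrak m\notin\operatorname{Ass}_{\mathcal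 O}(\operatorname{image}\theta^g)$. -/

import Mathlib

open CategoryTheory DirectSum

universe u

noncomputable section

/-! ## Rings of differential operators -/

section DiffOps

variable (K A : Type u) [CommRing K] [CommRing A] [Algebra K A]

/-- The `K`-linear differential operators of order `≤ k` on a commutative `K`-algebra `A`:
those of order `≤ 0` are the `K`-linear maps commuting with multiplication by every `a : A`,
and `Q` has order `≤ k + 1` if `[Q, a]` has order `≤ k` for every `a : A`. -/
def diffOrder : ℕ → Submodule K (Module.End K A)
  | 0 =>
    { carrier := {Q | ∀ a : A, Q * Algebra.lmul K A a - Algebra.lmul K A a * Q = 0}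
      add_mem' := fun {Q R} hQ hR a => by
        have h : (Q + R) * Algebra.lmul K A a - Algebra.lmul K A a * (Q + R)
          = (Q * Algebra.lmul K A a - Algebra.lmul K A a * Q)
            + (R * Algebra.lmul K A a - Algebra.lmul K A a * R) := by noncomm_ring
        rw [h, hQ a, hR a, add_zero]
      zero_mem' := fun a => by simp
      smul_mem' := fun c Q hQ a => by
        rw [smul_mul_assoc, mul_smul_comm, ← smul_sub, hQ a, smul_zero] }
  | k + 1 =>
    { carrier := {Q | ∀ a : A, Q * Algebra.lmul K A a - Algebra.lmul K A a * Q ∈ diffOrder k}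
      add_mem' := fun {Q R} hQ hR a => by
        have h : (Q + R) * Algebra.lmul K A a - Algebra.lmul K A a * (Q + R)
          = (Q * Algebra.lmul K A a - Algebra.lmul K A a * Q)
            + (R * Algebra.lmul K A a - Algebra.lmul K A a * R) := by noncomm_ring
        rw [h]
        exact add_mem (hQ a) (hR a)
      zero_mem' := fun a => by simp
      smul_mem' := fun c Q hQ a => by
        rw [smul_mul_assoc, mul_smul_comm, ← smul_sub]
        exact Submodule.smul_mem _ c (hQ a) }

/-- The operators of order `< k`. -/
def diffOrderLt : ℕ → Submodule K (Module.End K A)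
  | 0 => ⊥
  | k + 1 => diffOrder K A k

variable {K A}

lemma mem_diffOrder_iff {k : ℕ} {Q : Module.End K A} :
    Q ∈ diffOrder K A k ↔
      ∀ a : A, Q * Algebra.lmul K A a - Algebra.lmul K A a * Q ∈ diffOrderLt K A k := by
  cases k <;> exact Iff.rfl

lemma diffOrder_le_succ (k : ℕ) : diffOrder K A k ≤ diffOrder K A (k + 1) := by
  induction k with
  | zero =>
    intro Q hQ
    rw [mem_diffOrder_iff]
    intro a
    have h := mem_diffOrder_iff.1 hQ a
    have h' : Q * Algebra.lmul K A a - Algebra.lmul K A a * Q = 0 := h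
    rw [h']
    exact zero_mem _
  | succ k ih =>
    intro Q hQ
    rw [mem_diffOrder_iff] at hQ ⊢
    intro a
    exact ih (hQ a)

lemma diffOrder_mono : Monotone (diffOrder K A) := monotone_nat_of_le_succ diffOrder_le_succ

lemma lmul_mem_diffOrder_zero (a : A) : Algebra.lmul K A a ∈ diffOrder K A 0 := by
  rw [mem_diffOrder_iff]
  intro b
  rw [← map_mul, ← map_mul, mul_comm a b, sub_self]
  exact zero_mem _

lemma mul_mem_diffOrder {i j : ℕ} {Q R : Module.End K A} (hQ : Q ∈ diffOrder K A i)
    (hR : R ∈ diffOrder K A j) : Q * R ∈ diffOrder K A (i + j) := by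
  induction hn : i + j generalizing i j Q R with
  | zero =>
    obtain ⟨rfl, rfl⟩ : i = 0 ∧ j = 0 := by omega
    rw [mem_diffOrder_iff] at hQ hR ⊢
    intro a
    have hQ' : Q * Algebra.lmul K A a - Algebra.lmul K A a * Q = 0 := hQ a
    have hR' : R * Algebra.lmul K A a - Algebra.lmul K A a * R = 0 := hR a
    have h : Q * R * Algebra.lmul K A a - Algebra.lmul K A a * (Q * R)
      = Q * (R * Algebra.lmul K A a - Algebra.lmul K A a * R)
        + (Q * Algebra.lmul K A a - Algebra.lmul K A a * Q) * R := by
      simp only [mul_sub, sub_mul, mul_assoc]; abel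
    rw [h, hQ', hR', mul_zero, zero_mul, add_zero]
    exact zero_mem _
  | succ m ih =>
    have hQ0 := hQ
    have hR0 := hR
    rw [mem_diffOrder_iff] at hQ hR ⊢
    intro a
    have h : Q * R * Algebra.lmul K A a - Algebra.lmul K A a * (Q * R)
      = Q * (R * Algebra.lmul K A a - Algebra.lmul K A a * R)
        + (Q * Algebra.lmul K A a - Algebra.lmul K A a * Q) * R := by
      simp only [mul_sub, sub_mul, mul_assoc]; abel
    rw [h]
    refine add_mem ?_ ?_
    · cases j with
      | zero =>
        have hR' : R * Algebra.lmul K A a - Algebra.lmul K A a * R = 0 := hR a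
        rw [hR', mul_zero]
        exact zero_mem _
      | succ j => exact ih hQ0 (hR a) (by omega)
    · cases i with
      | zero =>
        have hQ' : Q * Algebra.lmul K A a - Algebra.lmul K A a * Q = 0 := hQ a
        rw [hQ', zero_mul]
        exact zero_mem _
      | succ i => exact ih (hQ a) hR0 (by omega)

lemma apply_of_mem_diffOrder_zero {Q : Module.End K A} (hQ : Q ∈ diffOrder K A 0) (x : A) :
    Q x = x * Q 1 := by
  have h : Q * Algebra.lmul K A x - Algebra.lmul K A x * Q = 0 := mem_diffOrder_iff.1 hQ x
  have h1 := LinearMap.congr_fun h 1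
  simpa [sub_eq_zero] using h1

lemma commutator_mem_diffOrderLt {i j : ℕ} {Q R : Module.End K A} (hQ : Q ∈ diffOrder K A i)
    (hR : R ∈ diffOrder K A j) : Q * R - R * Q ∈ diffOrderLt K A (i + j) := by
  induction hn : i + j generalizing i j Q R with
  | zero =>
    obtain ⟨rfl, rfl⟩ : i = 0 ∧ j = 0 := by omega
    have h : Q * R - R * Q = 0 := by
      ext x
      simp only [LinearMap.sub_apply, Module.End.mul_apply, LinearMap.zero_apply]
      rw [apply_of_mem_diffOrder_zero hQ (R x), apply_of_mem_diffOrder_zero hR (Q x),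
        apply_of_mem_diffOrder_zero hQ x, apply_of_mem_diffOrder_zero hR x]
      ring
    rw [h]
    exact zero_mem _
  | succ m ih =>
    change Q * R - R * Q ∈ diffOrder K A m
    have hQ0 := hQ
    have hR0 := hR
    rw [mem_diffOrder_iff] at hQ hR ⊢
    intro a
    have h : (Q * R - R * Q) * Algebra.lmul K A a - Algebra.lmul K A a * (Q * R - R * Q)
      = (Q * (R * Algebra.lmul K A a - Algebra.lmul K A a * R)
          - (R * Algebra.lmul K A a - Algebra.lmul K A a * R) * Q)
        + ((Q * Algebra.lmul K A a - Algebra.lmul K A a * Q) * R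
          - R * (Q * Algebra.lmul K A a - Algebra.lmul K A a * Q)) := by
      simp only [mul_sub, sub_mul, mul_assoc]; abel
    rw [h]
    refine add_mem ?_ ?_
    · cases j with
      | zero =>
        have hR' : R * Algebra.lmul K A a - Algebra.lmul K A a * R = 0 := hR a
        rw [hR', mul_zero, zero_mul, sub_zero]
        exact zero_mem _
      | succ j => exact ih hQ0 (hR a) (by omega)
    · cases i with
      | zero =>
        have hQ' : Q * Algebra.lmul K A a - Algebra.lmul K A a * Q = 0 := hQ a
        rw [hQ', mul_zero, zero_mul, sub_zero]
        exact zero_mem _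
      | succ i => exact ih (hQ a) hR0 (by omega)

variable (K A)

/-- The ring `D` of `K`-linear differential operators on `A`. -/
def diffOps : Subalgebra K (Module.End K A) where
  carrier := {Q | ∃ k, Q ∈ diffOrder K A k}
  mul_mem' := fun ⟨i, hi⟩ ⟨j, hj⟩ => ⟨i + j, mul_mem_diffOrder hi hj⟩
  add_mem' := fun ⟨i, hi⟩ ⟨j, hj⟩ => ⟨max i j,
    add_mem (diffOrder_mono (le_max_left i j) hi) (diffOrder_mono (le_max_right i j) hj)⟩
  algebraMap_mem' := fun c => ⟨0, by
    rw [Algebra.algebraMap_eq_smul_one, ← map_one (Algebra.lmul K A)]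
    exact Submodule.smul_mem _ c (lmul_mem_diffOrder_zero 1)⟩

/-- The ring `D` of `K`-linear differential operators on `A`, as a type. -/
def DOps : Type u := diffOps K A

instance : Ring (DOps K A) := inferInstanceAs (Ring (diffOps K A))

instance : Algebra K (DOps K A) := inferInstanceAs (Algebra K (diffOps K A))

/-- The tautological representation of `D` by `K`-linear endomorphisms of `A`. -/
def DOps.toEnd : DOps K A →ₐ[K] Module.End K A := (diffOps K A).val

/-- `A` is a left `D`-module, an operator `Q` acting by `a ↦ Q a`. -/
instance : Module (DOps K A) A := Module.compHom A (DOps.toEnd K A).toRingHom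

/-- The inclusion `A → D`, sending `a` to multiplication by `a`. -/
def mulOp : A →ₐ[K] DOps K A :=
  (Algebra.lmul K A).codRestrict (diffOps K A) fun a => ⟨0, lmul_mem_diffOrder_zero a⟩

/-- The order filtration `Σ` of `D`: `Σ_k` consists of the operators of order `≤ k`. -/
def diffFilt (k : ℕ) : AddSubgroup (DOps K A) :=
  ((diffOrder K A k).toAddSubgroup).comap (DOps.toEnd K A : DOps K A →+ Module.End K A)

variable {K A}

lemma DOps.smul_def (Q : DOps K A) (a : A) : Q • a = DOps.toEnd K A Q a := rfl

lemma DOps.toEnd_mulOp (a : A) : DOps.toEnd K A (mulOp K A a) = Algebra.lmul K A a := rfl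

lemma DOps.toEnd_injective : Function.Injective (DOps.toEnd K A) := Subtype.val_injective

lemma mem_diffFilt {k : ℕ} {Q : DOps K A} :
    Q ∈ diffFilt K A k ↔ DOps.toEnd K A Q ∈ diffOrder K A k := Iff.rfl

lemma exists_mem_diffFilt (Q : DOps K A) : ∃ k, Q ∈ diffFilt K A k := Q.2

lemma diffFilt_mono : Monotone (diffFilt K A) := fun _ _ h _ hQ => diffOrder_mono h hQ

lemma mulOp_mem_diffFilt (a : A) : mulOp K A a ∈ diffFilt K A 0 := lmul_mem_diffOrder_zero a

lemma one_mem_diffFilt : (1 : DOps K A) ∈ diffFilt K A 0 := by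
  rw [← map_one (mulOp K A)]
  exact mulOp_mem_diffFilt 1

lemma mul_mem_diffFilt {i j : ℕ} {Q R : DOps K A} (hQ : Q ∈ diffFilt K A i)
    (hR : R ∈ diffFilt K A j) : Q * R ∈ diffFilt K A (i + j) := by
  rw [mem_diffFilt] at hQ hR ⊢
  rw [map_mul]
  exact mul_mem_diffOrder hQ hR

end DiffOps

/-! ## Associated graded groups, rings and modules -/

section Graded

/-- For a filtration `F` indexed by `ℕ`, the previous step `F (i - 1)`, where `F (-1) = 0`. -/
def filtLt {X : Type u} [AddCommGroup X] (F : ℕ → AddSubgroup X) : ℕ → AddSubgroup X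
  | 0 => ⊥
  | k + 1 => F k

/-- The graded piece `F i / F (i - 1)`. -/
def GrPiece {X : Type u} [AddCommGroup X] (F : ℕ → AddSubgroup X) (i : ℕ) : Type u :=
  F i ⧸ (filtLt F i).addSubgroupOf (F i)

instance {X : Type u} [AddCommGroup X] (F : ℕ → AddSubgroup X) (i : ℕ) :
    AddCommGroup (GrPiece F i) :=
  inferInstanceAs (AddCommGroup (F i ⧸ (filtLt F i).addSubgroupOf (F i)))

/-- The class in `F i / F (i - 1)` of an element of `F i`. -/
def GrPiece.mk {X : Type u} [AddCommGroup X] (F : ℕ → AddSubgroup X) (i : ℕ) :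
    F i →+ GrPiece F i :=
  QuotientAddGroup.mk' _

lemma GrPiece.mk_surjective {X : Type u} [AddCommGroup X] (F : ℕ → AddSubgroup X) (i : ℕ) :
    Function.Surjective (GrPiece.mk F i) := QuotientAddGroup.mk'_surjective _

lemma GrPiece.mk_eq_zero {X : Type u} [AddCommGroup X] {F : ℕ → AddSubgroup X} {i : ℕ}
    {x : F i} : GrPiece.mk F i x = 0 ↔ (x : X) ∈ filtLt F i := by
  refine (QuotientAddGroup.eq_zero_iff x).trans ?_
  exact AddSubgroup.mem_addSubgroupOf

lemma GrPiece.mk_eq_mk {X : Type u} [AddCommGroup X] {F : ℕ → AddSubgroup X} {i : ℕ}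
    {x y : F i} (h : (x : X) - y ∈ filtLt F i) : GrPiece.mk F i x = GrPiece.mk F i y := by
  rw [← sub_eq_zero, ← map_sub]
  exact GrPiece.mk_eq_zero.2 h

/-- Equality of homogeneous elements of the associated graded group. -/
lemma GrPiece.sigma_eq {X : Type u} [AddCommGroup X] {F : ℕ → AddSubgroup X} {i j : ℕ}
    (hij : i = j) {x : F i} {y : F j} (h : (x : X) - y ∈ filtLt F i) :
    (⟨i, GrPiece.mk F i x⟩ : Σ i, GrPiece F i) = ⟨j, GrPiece.mk F j y⟩ := by
  subst hij
  rw [GrPiece.mk_eq_mk h]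

variable {X Y Z : Type u} [AddCommGroup X] [AddCommGroup Y] [AddCommGroup Z]

/-- A homomorphism `F i → Z` that vanishes on `F (i - 1)` induces one on `F i / F (i - 1)`. -/
def GrPiece.lift {F : ℕ → AddSubgroup X} {i : ℕ} (f : F i →+ Z)
    (hf : ∀ x : F i, (x : X) ∈ filtLt F i → f x = 0) : GrPiece F i →+ Z :=
  QuotientAddGroup.lift ((filtLt F i).addSubgroupOf (F i)) f
    fun x hx => hf x (AddSubgroup.mem_addSubgroupOf.1 hx)

lemma GrPiece.lift_mk {F : ℕ → AddSubgroup X} {i : ℕ} (f : F i →+ Z)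
    (hf : ∀ x : F i, (x : X) ∈ filtLt F i → f x = 0) (x : F i) :
    GrPiece.lift f hf (GrPiece.mk F i x) = f x := rfl

lemma GrPiece.hom_ext {F : ℕ → AddSubgroup X} {i : ℕ} {f f' : GrPiece F i →+ Z}
    (h : ∀ x, f (GrPiece.mk F i x) = f' (GrPiece.mk F i x)) : f = f' := by
  ext x
  obtain ⟨x, rfl⟩ := GrPiece.mk_surjective F i x
  exact h x

/-- Multiplication by `x ∈ F i` on the graded pieces, for a biadditive map `β` that is compatible
with filtrations. -/
def grBilinAux (FX : ℕ → AddSubgroup X) (FY : ℕ → AddSubgroup Y) (FZ : ℕ → AddSubgroup Z)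
    (β : X →+ Y →+ Z) (h : ∀ i j, ∀ x ∈ FX i, ∀ y ∈ FY j, β x y ∈ FZ (i + j)) (i j : ℕ)
    (x : FX i) : GrPiece FY j →+ GrPiece FZ (i + j) :=
  GrPiece.lift
    ((GrPiece.mk FZ (i + j)).comp
      { toFun := fun y => ⟨β x y, h i j x x.2 y y.2⟩
        map_zero' := by ext; simp
        map_add' := fun y y' => by ext; simp })
    (by
      intro y hy
      refine GrPiece.mk_eq_zero.2 ?_
      cases j with
      | zero =>
        have hy0 : (y : Y) = 0 := hy
        change β x y ∈ _
        rw [hy0, map_zero]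
        exact zero_mem _
      | succ j => exact h i j x x.2 y hy)

/-- A biadditive map that is compatible with filtrations induces biadditive maps between the
graded pieces: the product of the classes of `x` and `y` is the class of `β x y`. -/
def grBilin (FX : ℕ → AddSubgroup X) (FY : ℕ → AddSubgroup Y) (FZ : ℕ → AddSubgroup Z)
    (β : X →+ Y →+ Z) (h : ∀ i j, ∀ x ∈ FX i, ∀ y ∈ FY j, β x y ∈ FZ (i + j)) (i j : ℕ) :
    GrPiece FX i →+ GrPiece FY j →+ GrPiece FZ (i + j) :=
  GrPiece.lift
    { toFun := grBilinAux FX FY FZ β h i j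
      map_zero' := GrPiece.hom_ext fun y => by
        refine GrPiece.mk_eq_zero.2 ?_
        change β (0 : X) y ∈ _
        rw [map_zero]
        exact zero_mem _
      map_add' := fun x x' => GrPiece.hom_ext fun y => by
        rw [AddMonoidHom.add_apply]
        simp only [grBilinAux, GrPiece.lift_mk, AddMonoidHom.comp_apply, AddMonoidHom.coe_mk,
          ZeroHom.coe_mk]
        rw [← map_add]
        refine GrPiece.mk_eq_mk ?_
        change β ((x : X) + x') y - (β x y + β x' y) ∈ _
        rw [map_add, AddMonoidHom.add_apply, sub_self]
        exact zero_mem _ }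
    (by
      intro x hx
      refine GrPiece.hom_ext fun y => ?_
      refine GrPiece.mk_eq_zero.2 ?_
      change β (x : X) y ∈ _
      cases i with
      | zero =>
        have hx0 : (x : X) = 0 := hx
        rw [hx0, map_zero]
        exact zero_mem _
      | succ i =>
        rw [Nat.succ_add]
        exact h i j x hx y y.2)

lemma grBilin_mk (FX : ℕ → AddSubgroup X) (FY : ℕ → AddSubgroup Y) (FZ : ℕ → AddSubgroup Z)
    (β : X →+ Y →+ Z) (h : ∀ i j, ∀ x ∈ FX i, ∀ y ∈ FY j, β x y ∈ FZ (i + j)) (i j : ℕ)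
    (x : FX i) (y : FY j) :
    grBilin FX FY FZ β h i j (GrPiece.mk FX i x) (GrPiece.mk FY j y)
      = GrPiece.mk FZ (i + j) ⟨β x y, h i j x x.2 y y.2⟩ := rfl

end Graded

section GrD

variable (K A : Type u) [CommRing K] [CommRing A] [Algebra K A]

/-- The degree `i` part `Σ_i / Σ_(i-1)` of `gr D`. -/
abbrev DGrPiece (i : ℕ) : Type u := GrPiece (X := DOps K A) (diffFilt K A) i

/-- The multiplication of `gr D`. -/
def dGrMul (i j : ℕ) : DGrPiece K A i →+ DGrPiece K A j →+ DGrPiece K A (i + j) :=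
  grBilin (diffFilt K A) (diffFilt K A) (diffFilt K A) AddMonoidHom.mul
    (fun _ _ _ hx _ hy => mul_mem_diffFilt hx hy) i j

/-- The unit of `gr D`. -/
def dGrOne : DGrPiece K A 0 := GrPiece.mk (diffFilt K A) 0 ⟨1, one_mem_diffFilt⟩

instance : GradedMonoid.GMul (DGrPiece K A) where
  mul := fun {i j} a b => dGrMul K A i j a b

instance : GradedMonoid.GOne (DGrPiece K A) where
  one := dGrOne K A

instance : GradedMonoid.GMonoid (DGrPiece K A) where
  one_mul := by
    rintro ⟨i, a⟩
    obtain ⟨a, rfl⟩ := GrPiece.mk_surjective _ _ a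
    refine GrPiece.sigma_eq (zero_add i) ?_
    change (1 : DOps K A) * a - a ∈ _
    rw [one_mul, sub_self]
    exact zero_mem _
  mul_one := by
    rintro ⟨i, a⟩
    obtain ⟨a, rfl⟩ := GrPiece.mk_surjective _ _ a
    refine GrPiece.sigma_eq (add_zero i) ?_
    change (a : DOps K A) * 1 - a ∈ _
    rw [mul_one, sub_self]
    exact zero_mem _
  mul_assoc := by
    rintro ⟨i, a⟩ ⟨j, b⟩ ⟨k, c⟩
    obtain ⟨a, rfl⟩ := GrPiece.mk_surjective _ _ a
    obtain ⟨b, rfl⟩ := GrPiece.mk_surjective _ _ b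
    obtain ⟨c, rfl⟩ := GrPiece.mk_surjective _ _ c
    refine GrPiece.sigma_eq (add_assoc i j k) ?_
    change (a : DOps K A) * b * c - a * (b * c) ∈ _
    rw [mul_assoc, sub_self]
    exact zero_mem _

instance : DirectSum.GCommRing (DGrPiece K A) where
  __ := (inferInstance : GradedMonoid.GMonoid (DGrPiece K A))
  mul_zero := fun {i j} a => map_zero _
  zero_mul := fun {i j} b => by
    change dGrMul K A i j 0 b = 0
    rw [map_zero, AddMonoidHom.zero_apply]
  mul_add := fun {i j} a b c => map_add _ b c
  add_mul := fun {i j} a b c => by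
    change dGrMul K A i j (a + b) c = dGrMul K A i j a c + dGrMul K A i j b c
    rw [map_add, AddMonoidHom.add_apply]
  mul_comm := by
    rintro ⟨i, a⟩ ⟨j, b⟩
    obtain ⟨a, rfl⟩ := GrPiece.mk_surjective _ _ a
    obtain ⟨b, rfl⟩ := GrPiece.mk_surjective _ _ b
    refine GrPiece.sigma_eq (add_comm i j) ?_
    change (a : DOps K A) * b - b * a ∈ _
    have h := commutator_mem_diffOrderLt (mem_diffFilt.1 a.2) (mem_diffFilt.1 b.2)
    cases hn : i + j with
    | zero =>
      rw [hn] at h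
      refine DOps.toEnd_injective ?_
      rw [map_sub, map_mul, map_mul, map_zero]
      exact h
    | succ m =>
      rw [hn] at h
      change _ ∈ diffFilt K A m
      rw [mem_diffFilt, map_sub, map_mul, map_mul]
      exact h
  natCast := fun n => n • dGrOne K A
  natCast_zero := zero_smul _ _
  natCast_succ := fun n => succ_nsmul _ n
  intCast := fun n => n • dGrOne K A
  intCast_ofNat := fun n => natCast_zsmul _ n
  intCast_negSucc_ofNat := fun n => negSucc_zsmul _ n

/-- The associated graded ring `gr D = Σ_0 ⊕ Σ_1 / Σ_0 ⊕ ⋯`. -/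
abbrev GrD : Type u := ⨁ i, DGrPiece K A i

instance : CommRing (GrD K A) := DirectSum.commRing _

variable [IsLocalRing A]

/-- The ring homomorphism from `gr D` to the residue field of the local ring `A` which is zero in
positive degrees and sends (the class of) an operator `Q` of order `0`, that is, multiplication
by `Q 1`, to the residue class of `Q 1`. -/
def grDAugPiece : ∀ i, DGrPiece K A i →+ IsLocalRing.ResidueField A
  | 0 => GrPiece.lift
      { toFun := fun Q => IsLocalRing.residue A ((Q : DOps K A) • (1 : A))
        map_zero' := by rw [AddSubgroup.coe_zero, zero_smul, map_zero]
        map_add' := fun Q R => by rw [AddSubgroup.coe_add, add_smul, map_add] }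
      (by
        intro Q hQ
        have hQ0 : (Q : DOps K A) = 0 := hQ
        change IsLocalRing.residue A ((Q : DOps K A) • (1 : A)) = 0
        rw [hQ0, zero_smul, map_zero])
  | _ + 1 => 0

/-- The ring homomorphism `gr D → A / m` for `A` local with maximal ideal `m`. -/
def grDAug : GrD K A →+* IsLocalRing.ResidueField A :=
  DirectSum.toSemiring (grDAugPiece K A)
    (by
      change IsLocalRing.residue A ((1 : DOps K A) • (1 : A)) = 1
      rw [one_smul, map_one])
    (by
      intro i j a b
      obtain ⟨a, rfl⟩ := GrPiece.mk_surjective _ _ a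
      obtain ⟨b, rfl⟩ := GrPiece.mk_surjective _ _ b
      cases i with
      | zero =>
        cases j with
        | zero =>
          change IsLocalRing.residue A (((a : DOps K A) * b) • (1 : A))
            = IsLocalRing.residue A ((a : DOps K A) • (1 : A))
              * IsLocalRing.residue A ((b : DOps K A) • (1 : A))
          rw [← map_mul, mul_smul, DOps.smul_def (a : DOps K A),
            apply_of_mem_diffOrder_zero (mem_diffFilt.1 a.2), mul_comm]
          rfl
        | succ j =>
          change (0 : IsLocalRing.ResidueField A) = _ * 0
          rw [mul_zero]
      | succ i =>
        have h : ∀ k, k = i + 1 + j → ∀ c : DGrPiece K A k, grDAugPiece K A k c = 0 := by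
          rintro (_ | k) hk c
          · omega
          · rfl
        rw [h _ rfl]
        change (0 : IsLocalRing.ResidueField A) = 0 * _
        rw [zero_mul])

/-- The graded maximal ideal `𝓜 = m ⊕ Σ_1 / Σ_0 ⊕ Σ_2 / Σ_1 ⊕ ⋯` of `gr D`, for `A` local with
maximal ideal `m`. -/
def grDMax : Ideal (GrD K A) := RingHom.ker (grDAug K A)

instance : (grDMax K A).IsPrime := RingHom.ker_isPrime _

end GrD

/-! ## Good filtrations and multiplicity -/

section GoodFiltrations

variable (K A : Type u) [CommRing K] [CommRing A] [Algebra K A]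
variable (M : Type u) [AddCommGroup M] [Module (DOps K A) M]

/-- An exhaustive filtration `F 0 ⊆ F 1 ⊆ ⋯` of a left `D`-module `M` with `Σ_i F_j ⊆ F_(i+j)`,
where `F i = 0` for `i < 0`. (As `Σ_0` contains the constants, each `F i` is automatically a
`K`-subspace.) -/
structure DFiltration where
  /-- the steps of the filtration -/
  F : ℕ → AddSubgroup M
  mono : Monotone F
  exhaustive : ∀ x : M, ∃ i, x ∈ F i
  smul_mem : ∀ i j, ∀ Q ∈ diffFilt K A i, ∀ x ∈ F j, Q • x ∈ F (i + j)

variable {K A M}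

/-- The degree `j` part `F_j / F_(j-1)` of `gr_F M`. -/
abbrev DFiltration.Piece (F : DFiltration K A M) (j : ℕ) : Type u := GrPiece F.F j

/-- The action of `gr D` on `gr_F M`. -/
def DFiltration.grSMul (F : DFiltration K A M) (i j : ℕ) :
    DGrPiece K A i →+ F.Piece j →+ F.Piece (i + j) :=
  grBilin (diffFilt K A) F.F F.F (smulAddHom (DOps K A) M) F.smul_mem i j

instance (F : DFiltration K A M) : DirectSum.Gmodule (DGrPiece K A) F.Piece where
  smul := fun {i j} a x => F.grSMul i j a x
  one_smul := by
    rintro ⟨j, x⟩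
    obtain ⟨x, rfl⟩ := GrPiece.mk_surjective _ _ x
    refine GrPiece.sigma_eq (zero_add j) ?_
    change (1 : DOps K A) • (x : M) - x ∈ _
    rw [one_smul, sub_self]
    exact zero_mem _
  mul_smul := by
    rintro ⟨i, a⟩ ⟨j, b⟩ ⟨k, x⟩
    obtain ⟨a, rfl⟩ := GrPiece.mk_surjective _ _ a
    obtain ⟨b, rfl⟩ := GrPiece.mk_surjective _ _ b
    obtain ⟨x, rfl⟩ := GrPiece.mk_surjective _ _ x
    refine GrPiece.sigma_eq (add_assoc i j k) ?_
    change ((a : DOps K A) * b) • (x : M) - (a : DOps K A) • (b : DOps K A) • (x : M) ∈ _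
    rw [mul_smul, sub_self]
    exact zero_mem _
  smul_add := fun {i j} a x y => map_add (F.grSMul i j a) x y
  smul_zero := fun {i j} a => map_zero (F.grSMul i j a)
  add_smul := fun {i j} a b x => by
    change F.grSMul i j (a + b) x = F.grSMul i j a x + F.grSMul i j b x
    rw [map_add, AddMonoidHom.add_apply]
  zero_smul := fun {i j} x => by
    change F.grSMul i j 0 x = 0
    rw [map_zero, AddMonoidHom.zero_apply]

/-- The associated graded module `gr_F M = F_0 ⊕ F_1 / F_0 ⊕ ⋯`, a module over `gr D`. -/
abbrev DFiltration.Gr (F : DFiltration K A M) : Type u := ⨁ j, F.Piece j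

instance (F : DFiltration K A M) : Module (GrD K A) F.Gr := DirectSum.Gmodule.module _ _

/-- `F` is a good filtration if `gr_F M` is finitely generated over `gr D`. -/
def DFiltration.IsGood (F : DFiltration K A M) : Prop := Module.Finite (GrD K A) F.Gr

end GoodFiltrations

/-- The (Hilbert-Samuel) multiplicity of a nonzero finitely generated module `N` of dimension `d`
over a Noetherian local ring `(R, m)` is `e`, that is, `d! * length (N / m ^ t N) / t ^ d` tends to
`e` as `t` tends to infinity. -/
def HasMultiplicity (R N : Type u) [CommRing R] [IsLocalRing R] [AddCommGroup N] [Module R N]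
    (e : ℕ) : Prop :=
  ∃ d : ℕ, Module.supportDim R N = d ∧
    Filter.Tendsto
      (fun t : ℕ => (Nat.factorial d : ENNReal) *
        ((Module.length R (N ⧸ (IsLocalRing.maximalIdeal R ^ t • (⊤ : Submodule R N))) : ℕ∞) :
          ENNReal) / (t : ENNReal) ^ d)
      Filter.atTop (nhds (e : ENNReal))

/-- The finitely generated left `D`-module `M` has multiplicity `e_𝓜(M) = e`: it has good
filtrations, and for every good filtration `F` of `M`, the multiplicity of the localization of
`gr_F M` at the graded maximal ideal `𝓜` of `gr D` is `e`. -/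
def HasDMultiplicity (K A M : Type u) [CommRing K] [CommRing A] [IsLocalRing A] [Algebra K A]
    [AddCommGroup M] [Module (DOps K A) M] (e : ℕ) : Prop :=
  Module.Finite (DOps K A) M ∧ (∃ F : DFiltration K A M, F.IsGood) ∧
    ∀ F : DFiltration K A M, F.IsGood →
      HasMultiplicity (Localization.AtPrime (grDMax K A))
        (LocalizedModule (grDMax K A).primeCompl F.Gr) e

/-! ## Local cohomology -/

section LocalCohomology

variable {A : Type u} [CommRing A]

/-- `Γ_I(M)`, the submodule of the elements of `M` that are killed by some power of `I`. -/
def gammaSub (I : Ideal A) (M : Type u) [AddCommGroup M] [Module A M] : Submodule A M where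
  carrier := {m | ∃ t : ℕ, ∀ a ∈ I ^ t, a • m = 0}
  zero_mem' := ⟨0, fun a _ => smul_zero a⟩
  add_mem' := by
    rintro x y ⟨s, hs⟩ ⟨t, ht⟩
    refine ⟨max s t, fun a ha => ?_⟩
    rw [smul_add, hs a (Ideal.pow_le_pow_right (le_max_left s t) ha),
      ht a (Ideal.pow_le_pow_right (le_max_right s t) ha), add_zero]
  smul_mem' := by
    rintro c x ⟨t, ht⟩
    refine ⟨t, fun a ha => ?_⟩
    rw [smul_comm, ht a ha, smul_zero]

/-- The `I`-torsion functor `Γ_I` on `A`-modules. -/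
def gammaFunctor (I : Ideal A) : ModuleCat.{u} A ⥤ ModuleCat.{u} A where
  obj M := ModuleCat.of A (gammaSub I M)
  map f := ModuleCat.ofHom (f.hom.restrict (p := gammaSub I _) (q := gammaSub I _) (by
    rintro x ⟨t, ht⟩
    refine ⟨t, fun a ha => ?_⟩
    rw [← map_smul, ht a ha, map_zero]))

instance (I : Ideal A) : (gammaFunctor I).Additive where

/-- The local cohomology functors `H^i_I` on `A`-modules: the right derived functors of `Γ_I`. -/
def localCoh (I : Ideal A) (i : ℕ) : ModuleCat.{u} A ⥤ ModuleCat.{u} A :=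
  (gammaFunctor I).rightDerived i

lemma gammaSub_le {I J : Ideal A} (h : J ≤ I) (M : Type u) [AddCommGroup M] [Module A M] :
    gammaSub I M ≤ gammaSub J M :=
  fun _ ⟨t, ht⟩ => ⟨t, fun a ha => ht a (Ideal.pow_right_mono h t ha)⟩

/-- The inclusion `Γ_I → Γ_J` for `J ⊆ I`. -/
def gammaIncl {I J : Ideal A} (h : J ≤ I) : gammaFunctor I ⟶ gammaFunctor J where
  app M := ModuleCat.ofHom (Submodule.inclusion (gammaSub_le h M))

/-- The natural map `θ^i : H^i_I(M) → H^i_J(M)` for `J ⊆ I`, induced by the inclusion `Γ_I → Γ_J`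
evaluated on an injective resolution of `M`. -/
def thetaMap {I J : Ideal A} (h : J ≤ I) (i : ℕ) (M : ModuleCat.{u} A) :
    (localCoh I i).obj M ⟶ (localCoh J i).obj M :=
  (NatTrans.rightDerived (gammaIncl h) i).app M

end LocalCohomology

section LocalCohomologyD

variable (K : Type u) {A : Type u} [CommRing K] [CommRing A] [Algebra K A]

/-- A differential operator of order `≤ k` maps elements killed by `I ^ t` to elements killed by
`I ^ (t + k)`. -/
lemma diffFilt_smul_torsion (I : Ideal A) {M : Type u} [AddCommGroup M] [Module (DOps K A) M]
    (k : ℕ) : ∀ (t : ℕ) (Q : DOps K A), Q ∈ diffFilt K A k → ∀ m : M,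
      (∀ a ∈ I ^ t, mulOp K A a • m = 0) → ∀ a ∈ I ^ (t + k), mulOp K A a • Q • m = 0 := by
  have comm : ∀ (k : ℕ) (Q : DOps K A), Q ∈ diffFilt K A (k + 1) → ∀ a : A,
      Q * mulOp K A a - mulOp K A a * Q ∈ diffFilt K A k := by
    intro k Q hQ a
    rw [mem_diffFilt, map_sub, map_mul, map_mul, DOps.toEnd_mulOp]
    exact mem_diffOrder_iff.1 (mem_diffFilt.1 hQ) a
  induction k with
  | zero =>
    intro t Q hQ m hm a ha
    have h : Q * mulOp K A a - mulOp K A a * Q = 0 := by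
      refine DOps.toEnd_injective ?_
      rw [map_sub, map_mul, map_mul, DOps.toEnd_mulOp, map_zero]
      exact mem_diffOrder_iff.1 (mem_diffFilt.1 hQ) a
    rw [← mul_smul, ← sub_eq_zero.1 h, mul_smul, hm a ha, smul_zero]
  | succ k ih =>
    intro t
    induction t with
    | zero =>
      intro Q hQ m hm a ha
      have h0 : m = 0 := by
        have := hm 1 (by simp)
        rwa [map_one, one_smul] at this
      rw [h0, smul_zero, smul_zero]
    | succ t iht =>
      intro Q hQ m hm a ha
      have ha' : a ∈ I ^ (t + (k + 1)) * I := by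
        rw [← pow_succ]
        convert ha using 2
        omega
      refine Submodule.mul_induction_on ha' ?_ ?_
      · intro b hb c hc
        have h1 : mulOp K A b • Q • mulOp K A c • m = 0 := by
          refine iht Q hQ _ (fun d hd => ?_) b hb
          rw [← mul_smul, ← map_mul]
          exact hm _ (by rw [pow_succ]; exact Ideal.mul_mem_mul hd hc)
        have h2 : mulOp K A b • (Q * mulOp K A c - mulOp K A c * Q) • m = 0 := by
          refine ih (t + 1) _ (comm k Q hQ c) m hm b ?_
          convert hb using 2
          omega
        rw [sub_smul, smul_sub, mul_smul, h1, zero_sub, neg_eq_zero, mul_smul] at h2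
        rw [map_mul, mul_smul]
        exact h2
      · intro x y hx hy
        rw [map_add, add_smul, hx, hy, add_zero]

/-- `Γ_I(M)` for a left `D`-module `M`, as a `D`-submodule of `M`. -/
def gammaSubD (I : Ideal A) (M : Type u) [AddCommGroup M] [Module (DOps K A) M] :
    Submodule (DOps K A) M where
  carrier := {m | ∃ t : ℕ, ∀ a ∈ I ^ t, mulOp K A a • m = 0}
  zero_mem' := ⟨0, fun _ _ => smul_zero _⟩
  add_mem' := by
    rintro x y ⟨s, hs⟩ ⟨t, ht⟩
    refine ⟨max s t, fun a ha => ?_⟩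
    rw [smul_add, hs a (Ideal.pow_le_pow_right (le_max_left s t) ha),
      ht a (Ideal.pow_le_pow_right (le_max_right s t) ha), add_zero]
  smul_mem' := by
    rintro Q x ⟨t, ht⟩
    obtain ⟨k, hk⟩ := exists_mem_diffFilt Q
    exact ⟨t + k, diffFilt_smul_torsion K I k t Q hk x ht⟩

/-- The `I`-torsion functor `Γ_I` on left `D`-modules. -/
def gammaFunctorD (I : Ideal A) : ModuleCat.{u} (DOps K A) ⥤ ModuleCat.{u} (DOps K A) where
  obj M := ModuleCat.of (DOps K A) (gammaSubD K I M)
  map f := ModuleCat.ofHom (f.hom.restrict (p := gammaSubD K I _) (q := gammaSubD K I _) (by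
    rintro x ⟨t, ht⟩
    refine ⟨t, fun a ha => ?_⟩
    rw [← map_smul, ht a ha, map_zero]))

instance (I : Ideal A) : (gammaFunctorD K I).Additive where

/-- The local cohomology functors `H^i_I` on left `D`-modules, computed with injective resolutions
by `D`-modules. -/
def localCohD (I : Ideal A) (i : ℕ) : ModuleCat.{u} (DOps K A) ⥤ ModuleCat.{u} (DOps K A) :=
  (gammaFunctorD K I).rightDerived i

end LocalCohomologyD

/-! ## Power series -/

/-- The ring `K[[X_1, …, X_n]]` of formal power series. -/
abbrev PowSer (K : Type u) [Field K] (n : ℕ) : Type u := MvPowerSeries (Fin n) K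

/-- The ideal `(X_1, …, X_g)` of `K[[X_1, …, X_n]]`, for `g ≤ n`. -/
def varIdeal (K : Type u) [Field K] (n g : ℕ) : Ideal (PowSer K n) :=
  Ideal.span {f | ∃ i : Fin n, i.val < g ∧ f = MvPowerSeries.X i}

end

/-! Everything follows from one description of the local cohomology module: it is generated over D
by a nonzero η with X_i η = 0 for i ≤ g and ∂_i η = 0 for i > g, morally the class of 1/(X_1⋯X_g).
This is the predicate `IsDeltaGen`.

Existence of η is proved by induction on g, on the torsion subcomplexes of an injective resolution
of O over D (`IsDeltaComplex.succ`). The ring D is free as a right O-module in characteristic zero,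
so injective D-modules are O-injective (`injective_of_injective_DOps`), and multiplication by the
next variable X is surjective on the (X_1, …, X_g)-torsion of an injective D-module. Hence, writing
H for the cohomology at stage g, the cohomology at stage g + 1 is the quotient of H[1/X] by H, one
degree higher, with generator η/X; the elements η/X^t come from η/X by differentiation, using
characteristic zero. The same resolution computes local cohomology over O, which gives the
comparison of the two theories and turns the natural map into a D-linear one
(`thetaMap_comp_localCohIsoHomology`).

Simplicity of Dη: for i ≤ g, X_i acts on Qη as -[Q, X_i] and so lowers the order of Q. By Euler's
relation (`euler_mem`) an element killed by X_1, …, X_g has the form fη, and a nonzero fη is carried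
back to η by differentiating in the other variables and dividing by a unit (`exists_smul_smul_eq`).
Since Ann η = P, the only associated prime of Dη is P. A D-linear map out of a simple module is
injective or zero, which gives part (2).

Multiplicity: for the filtration of Dη by order, the graded module is cyclic, and its annihilator is
the kernel of a map gr D → K[[X_1, …, X_n]] sending ξ_i to X_i for i ≤ g, ξ_i to 0 for i > g, and
setting X_1, …, X_g to zero in O (`exists_grMap`). After localization at the graded maximal ideal,
the quotient by this kernel agrees with the power series ring modulo every power of the maximal
ideal, so its Hilbert-Samuel function is the count of monomials. For an arbitrary good filtration
only the property of being generically cyclic along this prime survives. It passes between adjacent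
filtrations F_j ⊆ G_j ⊆ F_(j+1) through a two-periodic exact sequence
(`IsGenericallyCyclic.of_exact`), any two good filtrations are joined by a chain of adjacent ones
(`DFiltration.isGenericallyCyclic_of_isGood`), and it forces multiplicity one
(`IsCoordinateMap.hasMultiplicity_one`). -/

noncomputable section

/-! ## Power series and the ideals `(X_1, …, X_g)` -/

namespace PowSer

open MvPowerSeries

variable {K : Type u} [Field K] {n : ℕ}

/-- The total exponent of the first `g` variables. -/
def wt (g : ℕ) (α : Fin n →₀ ℕ) : ℕ := ∑ i : Fin n with i.val < g, α i

lemma wt_add (g : ℕ) (α β : Fin n →₀ ℕ) : wt g (α + β) = wt g α + wt g β := by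
  simp [wt, Finset.sum_add_distrib]

lemma wt_eq_zero {g : ℕ} {α : Fin n →₀ ℕ} : wt g α = 0 ↔ ∀ i : Fin n, i.val < g → α i = 0 := by
  simp [wt]

lemma wt_single {g : ℕ} (i : Fin n) (k : ℕ) :
    wt g (Finsupp.single i k) = if i.val < g then k else 0 := by
  classical
  simp [wt, Finsupp.single_apply]

/-- The power series with the variables `X_1, …, X_g` set to zero. -/
def kill (g : ℕ) : PowSer K n →ₐ[K] PowSer K n where
  toFun f := fun α => if wt g α = 0 then coeff α f else 0
  map_one' := by
    classical
    ext α
    change (if wt g α = 0 then coeff α 1 else 0) = coeff α (1 : PowSer K n)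
    split_ifs with h
    · rfl
    · rw [coeff_one, if_neg]
      rintro rfl
      exact h (by simp [wt])
  map_zero' := by
    ext α
    change (if wt g α = 0 then coeff α 0 else 0) = coeff α (0 : PowSer K n)
    simp
  map_add' f f' := by
    ext α
    change (if wt g α = 0 then coeff α (f + f') else 0)
      = (if wt g α = 0 then coeff α f else 0) + (if wt g α = 0 then coeff α f' else 0)
    split_ifs <;> simp
  map_mul' f f' := by
    classical
    ext α
    refine Eq.trans ?_ (coeff_mul α _ _).symm
    change (if wt g α = 0 then coeff α (f * f') else 0)
      = ∑ p ∈ Finset.HasAntidiagonal.antidiagonal α, (if wt g p.1 = 0 then coeff p.1 f else 0)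
        * (if wt g p.2 = 0 then coeff p.2 f' else 0)
    rw [coeff_mul]
    split_ifs with h
    · refine Finset.sum_congr rfl fun p hp => ?_
      rw [← Finset.HasAntidiagonal.mem_antidiagonal.1 hp, wt_add] at h
      rw [if_pos (by omega), if_pos (by omega)]
    · refine (Finset.sum_eq_zero fun p hp => ?_).symm
      rw [← Finset.HasAntidiagonal.mem_antidiagonal.1 hp, wt_add] at h
      by_cases h1 : wt g p.1 = 0
      · rw [if_neg (by omega : ¬ wt g p.2 = 0), mul_zero]
      · rw [if_neg h1, zero_mul]
  commutes' c := by
    classical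
    ext α
    change (if wt g α = 0 then coeff α (algebraMap K (PowSer K n) c) else 0)
      = coeff α (algebraMap K (PowSer K n) c)
    rw [MvPowerSeries.algebraMap_apply]
    split_ifs with h
    · rfl
    · rw [coeff_C, if_neg]
      rintro rfl
      exact h (by simp [wt])

lemma coeff_kill (g : ℕ) (f : PowSer K n) (α : Fin n →₀ ℕ) :
    coeff α (kill g f) = if wt g α = 0 then coeff α f else 0 := rfl

lemma kill_X_of_lt {g : ℕ} {i : Fin n} (h : i.val < g) : kill g (X i : PowSer K n) = 0 := by
  classical
  ext α
  rw [coeff_kill, coeff_X]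
  split_ifs with h1 h2
  · rw [h2, wt_single, if_pos h] at h1
    omega
  · simp
  · simp

lemma kill_X_of_le {g : ℕ} {i : Fin n} (h : g ≤ i.val) :
    kill g (X i : PowSer K n) = X i := by
  classical
  ext α
  rw [coeff_kill, coeff_X]
  split_ifs with h1 h2 h2
  · rfl
  · rfl
  · rw [h2, wt_single, if_neg (by omega)] at h1
    omega
  · rfl

/-- The quotient by `X_i` of the part of `f` in which `X_i` is the first variable that occurs. -/
def divX (f : PowSer K n) (i : Fin n) : PowSer K n :=
  fun α => if wt i.val α = 0 then coeff (α + Finsupp.single i 1) f else 0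

lemma coeff_divX (f : PowSer K n) (i : Fin n) (α : Fin n →₀ ℕ) :
    coeff α (divX f i) = if wt i.val α = 0 then coeff (α + Finsupp.single i 1) f else 0 := rfl

lemma coeff_X_mul (f : PowSer K n) (i : Fin n) (α : Fin n →₀ ℕ) :
    coeff α (X i * f) = if 1 ≤ α i then coeff (α - Finsupp.single i 1) f else 0 := by
  classical
  rw [X_def, coeff_monomial_mul, one_mul]
  simp only [Finsupp.single_le_iff]

lemma coeff_X_mul_divX (f : PowSer K n) (i : Fin n) (α : Fin n →₀ ℕ) :
    coeff α (X i * divX f i) = if 1 ≤ α i ∧ wt i.val α = 0 then coeff α f else 0 := by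
  classical
  rw [coeff_X_mul]
  by_cases h : 1 ≤ α i
  · rw [if_pos h, coeff_divX]
    have h1 : α - Finsupp.single i 1 + Finsupp.single i 1 = α :=
      tsub_add_cancel_of_le (Finsupp.single_le_iff.2 h)
    have h2 : wt i.val (α - Finsupp.single i 1) = wt i.val α := by
      conv_rhs => rw [← h1, wt_add, wt_single, if_neg (lt_irrefl _), add_zero]
    rw [h1, h2]
    simp [h]
  · simp [h]

/-- Sort the monomials by the first of the variables of index below g that occurs: each monomial of
positive weight is counted in exactly one `X i * divX f i`. No choice of generators or convergence
argument is needed. -/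
lemma eq_kill_add_sum (g : ℕ) (f : PowSer K n) :
    f = kill g f + ∑ i : Fin n with i.val < g, X i * divX f i := by
  classical
  ext α
  rw [map_add, map_sum, coeff_kill]
  simp only [coeff_X_mul_divX]
  by_cases h : wt g α = 0
  · rw [if_pos h, Finset.sum_eq_zero, add_zero]
    intro i hi
    rw [if_neg]
    have := wt_eq_zero.1 h i (Finset.mem_filter.1 hi).2
    omega
  · rw [if_neg h, zero_add]
    -- The smallest index with nonzero exponent selects the only surviving summand.
    have hex : ∃ k : ℕ, ∃ i : Fin n, i.val = k ∧ i.val < g ∧ α i ≠ 0 := by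
      by_contra hc
      push Not at hc
      exact h (wt_eq_zero.2 fun i hi => hc i.val i rfl hi)
    obtain ⟨i, hik, hig, hi⟩ := Nat.find_spec hex
    have hmin : ∀ j : Fin n, j.val < i.val → α j = 0 := by
      intro j hj
      by_contra hc
      exact Nat.find_min hex (m := j.val) (by omega) ⟨j, rfl, by omega, hc⟩
    rw [Finset.sum_eq_single i]
    · rw [if_pos ⟨by omega, wt_eq_zero.2 hmin⟩]
    · intro j hj hji
      rw [if_neg]
      rintro ⟨h1, h2⟩
      rcases lt_trichotomy i.val j.val with h3 | h3 | h3
      · exact hi (wt_eq_zero.1 h2 i h3)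
      · exact hji (Fin.ext h3.symm)
      · have := hmin j h3
        omega
    · intro hc
      exact absurd (by simpa using hig) hc

lemma X_mem_varIdeal {g : ℕ} {i : Fin n} (h : i.val < g) :
    (X i : PowSer K n) ∈ varIdeal K n g :=
  Ideal.subset_span ⟨i, h, rfl⟩

/-- Identifies the ideal with the kernel of an endomorphism of a domain, so that primality and
membership become statements about coefficients. -/
lemma mem_varIdeal_iff {g : ℕ} {f : PowSer K n} : f ∈ varIdeal K n g ↔ kill g f = 0 := by
  constructor
  · intro h
    have h1 : varIdeal K n g ≤ RingHom.ker (kill (K := K) (n := n) g) := by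
      refine Ideal.span_le.2 ?_
      rintro _ ⟨i, hi, rfl⟩
      exact kill_X_of_lt hi
    exact h1 h
  · intro h
    rw [eq_kill_add_sum g f, h, zero_add]
    exact Ideal.sum_mem _ fun i hi =>
      Ideal.mul_mem_right _ _ (X_mem_varIdeal (Finset.mem_filter.1 hi).2)

lemma sub_kill_mem (g : ℕ) (f : PowSer K n) : f - kill g f ∈ varIdeal K n g := by
  rw [sub_eq_of_eq_add' (eq_kill_add_sum g f)]
  exact Ideal.sum_mem _ fun i hi =>
    Ideal.mul_mem_right _ _ (X_mem_varIdeal (Finset.mem_filter.1 hi).2)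

instance : IsDomain (PowSer K n) := NoZeroDivisors.to_isDomain _

instance (g : ℕ) : (varIdeal K n g).IsPrime := by
  have h : varIdeal K n g = RingHom.ker (kill (K := K) (n := n) g) := by
    ext f
    exact mem_varIdeal_iff
  rw [h]
  exact RingHom.ker_isPrime _

lemma X_notMem_varIdeal {g : ℕ} {i : Fin n} (h : g ≤ i.val) :
    (X i : PowSer K n) ∉ varIdeal K n g := by
  rw [mem_varIdeal_iff, kill_X_of_le h]
  exact fun h0 => one_ne_zero
    ((coeff_index_single_self_X (R := K) i).symm.trans (by rw [h0, map_zero]))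

/-! ### Powers of (X_1, …, X_g) in terms of coefficients; the maximal ideal. -/

/-- The ideal of the power series whose coefficients of weight less than `t` vanish. -/
def wtIdeal (g t : ℕ) : Ideal (PowSer K n) where
  carrier := {f | ∀ α, wt g α < t → coeff α f = 0}
  add_mem' := fun {a b} ha hb α hα => by rw [map_add, ha α hα, hb α hα, add_zero]
  zero_mem' := fun α _ => by simp
  smul_mem' := fun c f hf α hα => by
    classical
    rw [smul_eq_mul, coeff_mul]
    refine Finset.sum_eq_zero fun p hp => ?_
    rw [← Finset.HasAntidiagonal.mem_antidiagonal.1 hp, wt_add] at hα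
    rw [hf p.2 (by omega), mul_zero]

lemma mul_mem_wtIdeal {g s t : ℕ} {f f' : PowSer K n} (hf : f ∈ wtIdeal g s)
    (hf' : f' ∈ wtIdeal g t) : f * f' ∈ wtIdeal g (s + t) := by
  classical
  intro α hα
  rw [coeff_mul]
  refine Finset.sum_eq_zero fun p hp => ?_
  rw [← Finset.HasAntidiagonal.mem_antidiagonal.1 hp, wt_add] at hα
  by_cases h : wt g p.1 < s
  · rw [hf p.1 h, zero_mul]
  · rw [hf' p.2 (by omega), mul_zero]

lemma divX_mem_wtIdeal {g t : ℕ} {f : PowSer K n} (hf : f ∈ wtIdeal g (t + 1)) {i : Fin n}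
    (hi : i.val < g) : divX f i ∈ wtIdeal g t := by
  intro α hα
  rw [coeff_divX]
  split_ifs
  · refine hf _ ?_
    rw [wt_add, wt_single, if_pos hi]
    omega
  · rfl

/-- A series of weight at least t + 1 has `kill g f = 0`, and its quotients `divX f i` have weight
at least t, so induction on t peels off one variable at a time. -/
lemma varIdeal_pow (g t : ℕ) : varIdeal K n g ^ t = wtIdeal g t := by
  refine le_antisymm ?_ ?_
  · have h1 : varIdeal K n g ≤ wtIdeal g 1 := by
      refine Ideal.span_le.2 ?_
      rintro _ ⟨i, hi, rfl⟩ α hα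
      have := kill_X_of_lt (K := K) hi
      rw [← if_pos (c := wt g α = 0) (t := coeff α (X i : PowSer K n)) (e := 0) (by omega),
        ← coeff_kill, this, map_zero]
    induction t with
    | zero =>
      intro f _ α hα
      omega
    | succ t ih =>
      rw [pow_succ]
      exact Ideal.mul_le.2 fun r hr s hs => mul_mem_wtIdeal (ih hr) (h1 hs)
  · induction t with
    | zero => simp
    | succ t ih =>
      intro f hf
      have h0 : kill g f = 0 := by
        ext α
        rw [coeff_kill]
        split_ifs with h
        · rw [hf α (by omega), map_zero]
        · simp
      rw [eq_kill_add_sum g f, h0, zero_add, pow_succ']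
      exact Ideal.sum_mem _ fun i hi => Ideal.mul_mem_mul
        (X_mem_varIdeal (Finset.mem_filter.1 hi).2)
        (ih (divX_mem_wtIdeal hf (Finset.mem_filter.1 hi).2))

lemma mem_varIdeal_pow {g t : ℕ} {f : PowSer K n} :
    f ∈ varIdeal K n g ^ t ↔ ∀ α, wt g α < t → coeff α f = 0 := by
  rw [varIdeal_pow]
  exact Iff.rfl

/-- The remaining variables are nonzerodivisors modulo every power of the ideal, since multiplying
by them does not change weights. This is the input for divisibility of torsion in injective modules.
-/
lemma mem_varIdeal_pow_of_X_mul_mem {g t : ℕ} {f : PowSer K n} {i : Fin n} (hi : g ≤ i.val)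
    (h : X i * f ∈ varIdeal K n g ^ t) : f ∈ varIdeal K n g ^ t := by
  rw [mem_varIdeal_pow] at h ⊢
  intro α hα
  have := h (α + Finsupp.single i 1) (by rw [wt_add, wt_single, if_neg (by omega)]; omega)
  rw [coeff_X_mul, if_pos (by simp), add_tsub_cancel_right] at this
  exact this

lemma varIdeal_zero : varIdeal K n 0 = ⊥ := by
  rw [varIdeal, Ideal.span_eq_bot]
  rintro _ ⟨i, hi, _⟩
  omega

lemma wt_eq_degree (α : Fin n →₀ ℕ) : wt n α = α.degree := by
  rw [wt, Finsupp.degree_eq_sum]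
  refine Finset.sum_congr ?_ fun _ _ => rfl
  ext i
  simp

lemma kill_eq_C (f : PowSer K n) : kill n f = C (constantCoeff f) := by
  classical
  ext α
  rw [coeff_kill, coeff_C]
  simp only [wt_eq_degree, Finsupp.degree_eq_zero_iff]
  split_ifs with h
  · rw [h, coeff_zero_eq_constantCoeff]
  · rfl

lemma sub_C_mem (f : PowSer K n) : f - C (constantCoeff f) ∈ varIdeal K n n := by
  rw [← kill_eq_C]
  exact sub_kill_mem n f

lemma mem_varIdeal_self {f : PowSer K n} : f ∈ varIdeal K n n ↔ constantCoeff f = 0 := by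
  rw [mem_varIdeal_iff, kill_eq_C]
  constructor
  · intro h
    exact C_injective (h.trans (map_zero C).symm)
  · intro h
    rw [h, map_zero]

lemma maximalIdeal_eq : IsLocalRing.maximalIdeal (PowSer K n) = varIdeal K n n := by
  ext f
  rw [IsLocalRing.mem_maximalIdeal, mem_nonunits_iff, mem_varIdeal_self,
    isUnit_iff_constantCoeff, isUnit_iff_ne_zero, not_not]

lemma eq_zero_of_forall_mem_pow {f : PowSer K n} (h : ∀ t, f ∈ varIdeal K n n ^ t) : f = 0 := by
  ext α
  exact mem_varIdeal_pow.1 (h (wt n α + 1)) α (Nat.lt_succ_self _)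

end PowSer

/-! ## The ring of differential operators on power series -/

namespace PowSer

open MvPowerSeries

variable {K : Type u} [Field K] {n : ℕ}

lemma mem_diffFilt_zero_iff {A : Type u} [CommRing A] [Algebra K A] {Q : DOps K A} :
    Q ∈ diffFilt K A 0 ↔ ∀ a, Q * mulOp K A a - mulOp K A a * Q = 0 := by
  constructor
  · intro h a
    refine DOps.toEnd_injective ?_
    rw [map_sub, map_mul, map_mul, DOps.toEnd_mulOp, map_zero]
    exact mem_diffOrder_iff.1 (mem_diffFilt.1 h) a
  · intro h
    rw [mem_diffFilt, mem_diffOrder_iff]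
    intro a
    have := congrArg (DOps.toEnd K A) (h a)
    rw [map_sub, map_mul, map_mul, DOps.toEnd_mulOp, map_zero] at this
    exact this

lemma mem_diffFilt_succ_iff {A : Type u} [CommRing A] [Algebra K A] {Q : DOps K A} {k : ℕ} :
    Q ∈ diffFilt K A (k + 1) ↔ ∀ a, Q * mulOp K A a - mulOp K A a * Q ∈ diffFilt K A k := by
  rw [mem_diffFilt, mem_diffOrder_iff]
  refine forall_congr' fun a => ?_
  rw [mem_diffFilt, map_sub, map_mul, map_mul, DOps.toEnd_mulOp]
  exact Iff.rfl

/-- Multiplication by the variable `X_i` as a differential operator. -/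
def xOp (K : Type u) [Field K] {n : ℕ} (i : Fin n) : DOps K (PowSer K n) := mulOp K (PowSer K n) (X i)

lemma mulOp_comm (a b : PowSer K n) :
    mulOp K (PowSer K n) a * mulOp K (PowSer K n) b
      = mulOp K (PowSer K n) b * mulOp K (PowSer K n) a := by
  rw [← map_mul, ← map_mul, mul_comm]

lemma mulOp_smul (a f : PowSer K n) : mulOp K (PowSer K n) a • f = a * f := rfl

/-- A `K`-linear endomorphism of the power series ring that commutes with the variables and kills
`1` vanishes. -/
lemma end_eq_zero {T : Module.End K (PowSer K n)}
    (hT : ∀ i f, T (X i * f) = X i * T f) (h1 : T 1 = 0) : T = 0 := by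
  -- No continuity of T is assumed: writing f as a constant plus ∑ X_i f_i shows inductively that T
  -- f lies in every power of the maximal ideal.
  have key : ∀ (t : ℕ) (f : PowSer K n), T f ∈ varIdeal K n n ^ t := by
    intro t
    induction t with
    | zero => simp
    | succ t ih =>
      intro f
      rw [eq_kill_add_sum n f, map_add, map_sum, kill_eq_C]
      refine add_mem ?_ (Ideal.sum_mem _ fun i hi => ?_)
      · have : C (constantCoeff f) = constantCoeff f • (1 : PowSer K n) := by
          rw [smul_eq_C_mul, mul_one]
        rw [this, map_smul, h1, smul_zero]
        exact zero_mem _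
      · rw [hT, pow_succ']
        exact Ideal.mul_mem_mul (X_mem_varIdeal (Finset.mem_filter.1 hi).2) (ih _)
  ext1 f
  exact eq_zero_of_forall_mem_pow fun t => key t f

lemma eq_mulOp_of_commute {Q : DOps K (PowSer K n)}
    (h : ∀ i, Q * xOp K i - xOp K i * Q = 0) : Q = mulOp K (PowSer K n) (Q • 1) := by
  refine DOps.toEnd_injective ?_
  rw [DOps.toEnd_mulOp, ← sub_eq_zero]
  refine end_eq_zero (fun i f => ?_) ?_
  · have h1 : (Q * xOp K i) • f = (xOp K i * Q) • f := by rw [sub_eq_zero.1 (h i)]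
    rw [mul_smul, mul_smul] at h1
    change Q • (X i * f) - (Q • (1 : PowSer K n)) * (X i * f)
      = X i * (Q • f - (Q • (1 : PowSer K n)) * f)
    have h2 : Q • (X i * f) = X i * (Q • f) := h1
    rw [h2]
    ring
  · change Q • (1 : PowSer K n) - (Q • (1 : PowSer K n)) * 1 = 0
    rw [mul_one, sub_self]

lemma mem_diffFilt_zero_of_commute {Q : DOps K (PowSer K n)}
    (h : ∀ i, Q * xOp K i - xOp K i * Q = 0) : Q ∈ diffFilt K (PowSer K n) 0 := by
  rw [eq_mulOp_of_commute h]
  exact mulOp_mem_diffFilt _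

lemma eq_mulOp_of_mem_diffFilt_zero {Q : DOps K (PowSer K n)}
    (h : Q ∈ diffFilt K (PowSer K n) 0) : Q = mulOp K (PowSer K n) (Q • 1) :=
  eq_mulOp_of_commute fun i => mem_diffFilt_zero_iff.1 h (X i)

/-- The Jacobi identity, for two multiplication operators, which commute. -/
lemma commutator_swap (Q : DOps K (PowSer K n)) (i : Fin n) (a : PowSer K n) :
    (Q * mulOp K (PowSer K n) a - mulOp K (PowSer K n) a * Q) * xOp K i
      - xOp K i * (Q * mulOp K (PowSer K n) a - mulOp K (PowSer K n) a * Q)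
    = (Q * xOp K i - xOp K i * Q) * mulOp K (PowSer K n) a
      - mulOp K (PowSer K n) a * (Q * xOp K i - xOp K i * Q) := by
  have h : mulOp K (PowSer K n) a * xOp K i = xOp K i * mulOp K (PowSer K n) a := mulOp_comm _ _
  simp only [mul_sub, sub_mul, mul_assoc, h]
  simp only [← mul_assoc, h]
  abel

/-- Order need only be tested on brackets with the variables: swapping the brackets with a and with
X_i lets the induction run, and the base case is `end_eq_zero`. -/
lemma mem_diffFilt_succ_of_commutator {k : ℕ} {Q : DOps K (PowSer K n)}
    (h : ∀ i, Q * xOp K i - xOp K i * Q ∈ diffFilt K (PowSer K n) k) :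
    Q ∈ diffFilt K (PowSer K n) (k + 1) := by
  induction k generalizing Q with
  | zero =>
    rw [mem_diffFilt_succ_iff]
    refine fun a => mem_diffFilt_zero_of_commute fun i => ?_
    rw [commutator_swap]
    exact mem_diffFilt_zero_iff.1 (h i) a
  | succ k ih =>
    rw [mem_diffFilt_succ_iff]
    refine fun a => ih fun i => ?_
    rw [commutator_swap]
    exact mem_diffFilt_succ_iff.1 (h i) a

/-- The partial derivative with respect to `X_i` as a differential operator. -/
def dOp (K : Type u) [Field K] {n : ℕ} (i : Fin n) : DOps K (PowSer K n) :=
  ⟨(pderiv K i : Derivation K (PowSer K n) (PowSer K n)).toLinearMap, 1, by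
    rw [mem_diffOrder_iff]
    intro a
    have : (pderiv K i : Derivation K (PowSer K n) (PowSer K n)).toLinearMap
        * Algebra.lmul K _ a - Algebra.lmul K _ a
          * (pderiv K i : Derivation K (PowSer K n) (PowSer K n)).toLinearMap
        = Algebra.lmul K _ (pderiv K i a) := by
      ext1 f
      change pderiv K i (a * f) - a * pderiv K i f = pderiv K i a * f
      rw [Derivation.leibniz, smul_eq_mul, smul_eq_mul]
      ring
    rw [this]
    exact lmul_mem_diffOrder_zero _⟩

lemma dOp_smul (i : Fin n) (f : PowSer K n) : dOp K i • f = pderiv K i f := rfl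

lemma DOps_ext {A : Type u} [CommRing A] [Algebra K A] {Q R : DOps K A}
    (h : ∀ f : A, Q • f = R • f) : Q = R :=
  DOps.toEnd_injective (LinearMap.ext h)

lemma dOp_mul_mulOp (i : Fin n) (a : PowSer K n) :
    dOp K i * mulOp K (PowSer K n) a
      = mulOp K (PowSer K n) a * dOp K i + mulOp K (PowSer K n) (pderiv K i a) := by
  refine DOps_ext fun f => ?_
  rw [add_smul, mul_smul, mul_smul]
  change pderiv K i (a * f) = a * pderiv K i f + pderiv K i a * f
  rw [Derivation.leibniz, smul_eq_mul, smul_eq_mul]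
  ring

lemma dOp_mul_xOp_self (i : Fin n) : dOp K i * xOp K i = xOp K i * dOp K i + 1 := by
  rw [xOp, dOp_mul_mulOp, pderiv_X_self, map_one]

lemma dOp_mul_xOp_of_ne {i j : Fin n} (h : i ≠ j) :
    dOp K i * xOp K j = xOp K j * dOp K i := by
  rw [xOp, dOp_mul_mulOp, pderiv_X_of_ne h.symm, map_zero, add_zero]

lemma dOp_mul_xOp (i j : Fin n) :
    dOp K i * xOp K j = xOp K j * dOp K i + if i = j then 1 else 0 := by
  split_ifs with h
  · rw [h, dOp_mul_xOp_self]
  · rw [dOp_mul_xOp_of_ne h, add_zero]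

lemma dOp_comm (i j : Fin n) : dOp K i * dOp K j = dOp K j * dOp K i := by
  refine DOps_ext fun f => ?_
  rw [mul_smul, mul_smul]
  change pderiv K i (pderiv K j f) = pderiv K j (pderiv K i f)
  ext α
  rw [coeff_pderiv, coeff_pderiv, coeff_pderiv, coeff_pderiv, add_right_comm]
  by_cases h : i = j
  · rw [h]
  · simp only [Finsupp.add_apply, Finsupp.single_apply, if_neg h, if_neg (Ne.symm h), add_zero]
    ring

lemma dOp_mem (i : Fin n) : dOp K i ∈ diffFilt K (PowSer K n) 1 := by
  rw [mem_diffFilt_succ_iff]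
  intro a
  rw [dOp_mul_mulOp, add_sub_cancel_left]
  exact mulOp_mem_diffFilt _

/-- The Euler relation: `∑ ∂_i [Q, X_i]` is `k Q` up to operators of order less than `k`. -/
lemma euler_mem (k : ℕ) {Q : DOps K (PowSer K n)} (hQ : Q ∈ diffFilt K (PowSer K n) (k + 1)) :
    (k + 1) • Q - ∑ i, dOp K i * (Q * xOp K i - xOp K i * Q) ∈ diffFilt K (PowSer K n) k := by
  -- Because [∂_i, X_j] = δ_ij, bracketing the defect with X_j gives the same kind of defect for [Q,
  -- X_j], with the coefficient c + 1 lowered to c. Both the base case and the induction step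
  -- follow.
  have hstep : ∀ (c : ℕ) (Q : DOps K (PowSer K n)) (j : Fin n),
      ((c + 1) • Q - ∑ i, dOp K i * (Q * xOp K i - xOp K i * Q)) * xOp K j
        - xOp K j * ((c + 1) • Q - ∑ i, dOp K i * (Q * xOp K i - xOp K i * Q))
      = c • (Q * xOp K j - xOp K j * Q)
        - ∑ i, dOp K i * ((Q * xOp K j - xOp K j * Q) * xOp K i
            - xOp K i * (Q * xOp K j - xOp K j * Q)) := by
    intro c Q j
    have h1 : ∀ i, dOp K i * (Q * xOp K i - xOp K i * Q) * xOp K j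
        - xOp K j * (dOp K i * (Q * xOp K i - xOp K i * Q))
        = dOp K i * ((Q * xOp K j - xOp K j * Q) * xOp K i
            - xOp K i * (Q * xOp K j - xOp K j * Q))
          + (if i = j then 1 else 0) * (Q * xOp K i - xOp K i * Q) := by
      intro i
      have h2 := commutator_swap Q j (X i)
      change (Q * xOp K i - xOp K i * Q) * xOp K j - xOp K j * (Q * xOp K i - xOp K i * Q)
        = (Q * xOp K j - xOp K j * Q) * xOp K i - xOp K i * (Q * xOp K j - xOp K j * Q) at h2
      rw [← h2]
      generalize Q * xOp K i - xOp K i * Q = Y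
      rw [mul_sub (dOp K i), ← mul_assoc (dOp K i) (xOp K j), dOp_mul_xOp i j, add_mul]
      simp only [mul_assoc]
      abel
    rw [sub_mul, mul_sub, Finset.sum_mul, Finset.mul_sum, smul_mul_assoc, mul_smul_comm,
      sub_sub_sub_comm, ← smul_sub, ← Finset.sum_sub_distrib, Finset.sum_congr rfl fun i _ => h1 i,
      Finset.sum_add_distrib]
    simp only [ite_mul, one_mul, zero_mul, Finset.sum_ite_eq', Finset.mem_univ, if_true]
    rw [add_smul, one_smul]
    abel
  induction k generalizing Q with
  | zero =>
    refine mem_diffFilt_zero_of_commute fun j => ?_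
    rw [hstep, zero_smul, zero_sub, neg_eq_zero]
    refine Finset.sum_eq_zero fun i _ => ?_
    exact (congrArg _ (mem_diffFilt_zero_iff.1 (mem_diffFilt_succ_iff.1 hQ (X j)) (X i))).trans
      (mul_zero _)
  | succ k ih =>
    refine mem_diffFilt_succ_of_commutator fun j => ?_
    rw [hstep]
    exact ih (mem_diffFilt_succ_iff.1 hQ (X j))

variable [CharZero K]

/-- Euler's relation divided by k + 1, which is where characteristic zero enters. It makes D
generated by O and the partial derivatives. -/
lemma exists_eq_add_sum {k : ℕ} {Q : DOps K (PowSer K n)}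
    (hQ : Q ∈ diffFilt K (PowSer K n) (k + 1)) :
    ∃ R ∈ diffFilt K (PowSer K n) k, ∃ S : Fin n → DOps K (PowSer K n),
      (∀ i, S i ∈ diffFilt K (PowSer K n) k) ∧ Q = R + ∑ i, dOp K i * S i := by
  have hsm : ∀ (c : K) (k : ℕ) (Q : DOps K (PowSer K n)), Q ∈ diffFilt K (PowSer K n) k →
      c • Q ∈ diffFilt K (PowSer K n) k := by
    intro c k Q h
    rw [mem_diffFilt, map_smul]
    exact Submodule.smul_mem _ c h
  have hk : ((k + 1 : ℕ) : K) ≠ 0 := Nat.cast_ne_zero.2 (Nat.succ_ne_zero k)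
  refine ⟨_, hsm ((k + 1 : ℕ) : K)⁻¹ k _ (euler_mem k hQ),
    fun i => ((k + 1 : ℕ) : K)⁻¹ • (Q * xOp K i - xOp K i * Q),
    fun i => hsm _ _ _ (mem_diffFilt_succ_iff.1 hQ (X i)), ?_⟩
  simp only [mul_smul_comm]
  rw [← Finset.smul_sum, ← smul_add, sub_add_cancel, ← Nat.cast_smul_eq_nsmul K, smul_smul,
    inv_mul_cancel₀ hk, one_smul]

/-- An additive subgroup of `D` that contains `O` and is stable under left multiplication by the
partial derivatives is everything. -/
lemma DOps_induction {p : DOps K (PowSer K n) → Prop} (hO : ∀ a, p (mulOp K (PowSer K n) a))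
    (hadd : ∀ Q R, p Q → p R → p (Q + R)) (hd : ∀ i Q, p Q → p (dOp K i * Q))
    (Q : DOps K (PowSer K n)) : p Q := by
  have h0 : p 0 := by
    rw [← map_zero (mulOp K (PowSer K n))]
    exact hO 0
  have key : ∀ k, ∀ Q ∈ diffFilt K (PowSer K n) k, p Q := by
    intro k
    induction k with
    | zero =>
      intro Q hQ
      rw [eq_mulOp_of_mem_diffFilt_zero hQ]
      exact hO _
    | succ k ih =>
      intro Q hQ
      obtain ⟨R, hR, S, hS, rfl⟩ := exists_eq_add_sum hQ
      refine hadd _ _ (ih R hR) ?_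
      exact Finset.sum_induction _ p (fun a b => hadd a b) h0 fun i _ => hd i _ (ih _ (hS i))
  obtain ⟨k, hk⟩ := exists_mem_diffFilt Q
  exact key k Q hk

end PowSer

/-! ## Normal forms of differential operators -/

namespace PowSer

variable {K : Type u} [Field K] {n : ℕ}

/-- The ring `D`, regarded as a module over the power series ring by right multiplication. -/
def RightD (K : Type u) [Field K] (n : ℕ) : Type u := DOps K (PowSer K n)

instance : AddCommGroup (RightD K n) := inferInstanceAs (AddCommGroup (DOps K (PowSer K n)))

/-- The identity map from `RightD` to `D`. -/
def RightD.val : RightD K n ≃+ DOps K (PowSer K n) := AddEquiv.refl _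

instance : Module (PowSer K n) (RightD K n) where
  smul a Q := RightD.val.symm (Q.val * mulOp K (PowSer K n) a)
  one_smul Q := by
    change Q.val * mulOp K (PowSer K n) 1 = Q.val
    rw [map_one, mul_one]
  mul_smul a b Q := by
    change Q.val * mulOp K (PowSer K n) (a * b)
      = Q.val * mulOp K (PowSer K n) b * mulOp K (PowSer K n) a
    rw [mul_comm, map_mul, mul_assoc]
  smul_zero a := zero_mul (M₀ := DOps K (PowSer K n)) _
  smul_add a Q R := add_mul (R := DOps K (PowSer K n)) _ _ _
  add_smul a b Q := by
    change Q.val * mulOp K (PowSer K n) (a + b)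
      = Q.val * mulOp K (PowSer K n) a + Q.val * mulOp K (PowSer K n) b
    rw [map_add, mul_add]
  zero_smul Q := by
    change Q.val * mulOp K (PowSer K n) 0 = 0
    rw [map_zero, mul_zero]

instance : Module (DOps K (PowSer K n)) (RightD K n) :=
  inferInstanceAs (Module (DOps K (PowSer K n)) (DOps K (PowSer K n)))

lemma RightD.val_smul (R : DOps K (PowSer K n)) (Q : RightD K n) :
    (R • Q).val = R * Q.val := rfl

instance : SMulCommClass (PowSer K n) (DOps K (PowSer K n)) (RightD K n) where
  smul_comm a Q R := mul_assoc (G := DOps K (PowSer K n)) Q R.val (mulOp K (PowSer K n) a)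

/-- The commutative algebra of differential operators with constant coefficients. -/
abbrev ConstD (K : Type u) [Field K] (n : ℕ) : Subalgebra K (DOps K (PowSer K n)) :=
  Algebra.adjoin K (Set.range (dOp K (n := n)))

open scoped IsMulCommutative

/-- The partial derivatives commute, so a monomial in them can be formed as a product over a
finitely supported exponent. -/
instance : IsMulCommutative (ConstD K n) :=
  Algebra.isMulCommutative_adjoin K (by
    rintro _ ⟨i, rfl⟩ _ ⟨j, rfl⟩
    exact dOp_comm i j)

/-- A partial derivative as an element of `ConstD`. -/
def dGen (i : Fin n) : ConstD K n := ⟨dOp K i, Algebra.subset_adjoin ⟨i, rfl⟩⟩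

/-- The differential operator with constant coefficients attached to a monomial. -/
def dMon (α : Fin n →₀ ℕ) : DOps K (PowSer K n) :=
  ((α.prod fun i k => dGen i ^ k : ConstD K n) : DOps K (PowSer K n))

lemma dMon_zero : dMon (K := K) (0 : Fin n →₀ ℕ) = 1 := by
  rw [dMon, Finsupp.prod_zero_index]
  rfl

lemma dMon_single_add (i : Fin n) (α : Fin n →₀ ℕ) :
    dMon (K := K) (Finsupp.single i 1 + α) = dOp K i * dMon α := by
  classical
  rw [dMon, Finsupp.prod_add_index' (fun _ => pow_zero _) (fun _ _ _ => pow_add _ _ _)]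
  rw [Finsupp.prod_single_index (h := fun i k => (dGen i : ConstD K n) ^ k) (pow_zero _), pow_one]
  rfl

/-- The differential operator `∑ ∂^α a_α` attached to the polynomial `∑ a_α ξ^α`. -/
def opOf : MvPolynomial (Fin n) (PowSer K n) →ₗ[PowSer K n] RightD K n :=
  (MvPolynomial.basisMonomials (Fin n) (PowSer K n)).constr (PowSer K n)
    fun α => RightD.val.symm (dMon α)

/-- The operator of a polynomial as an element of `D`. -/
def op (p : MvPolynomial (Fin n) (PowSer K n)) : DOps K (PowSer K n) := (opOf p).val

lemma op_add (p q : MvPolynomial (Fin n) (PowSer K n)) : op (p + q) = op p + op q :=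
  map_add opOf p q

lemma op_zero : op (0 : MvPolynomial (Fin n) (PowSer K n)) = 0 := map_zero opOf

lemma op_monomial (α : Fin n →₀ ℕ) (a : PowSer K n) :
    op (MvPolynomial.monomial α a) = dMon α * mulOp K (PowSer K n) a := by
  have h : MvPolynomial.monomial α a
      = a • (MvPolynomial.basisMonomials (Fin n) (PowSer K n)) α := by
    rw [MvPolynomial.coe_basisMonomials, MvPolynomial.smul_monomial, smul_eq_mul, mul_one]
  rw [op, h, map_smul, opOf, Module.Basis.constr_basis]
  rfl

lemma op_C (a : PowSer K n) : op (MvPolynomial.C a) = mulOp K (PowSer K n) a := by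
  rw [← MvPolynomial.monomial_zero', op_monomial, dMon_zero, one_mul]

/-- Coefficients are kept on the right of the derivatives, so left multiplication by ∂_i needs no
correction term. -/
lemma op_mul_X (p : MvPolynomial (Fin n) (PowSer K n)) (i : Fin n) :
    op (p * MvPolynomial.X i) = dOp K i * op p := by
  induction p using MvPolynomial.induction_on' with
  | monomial α a =>
    rw [MvPolynomial.X, MvPolynomial.monomial_mul, mul_one, op_monomial, op_monomial,
      add_comm, dMon_single_add, mul_assoc]
  | add p q hp hq => rw [add_mul, op_add, op_add, mul_add, hp, hq]

/-- Since [∂_j, X_i] = δ_ij, the bracket with X_i differentiates the polynomial with respect to ξ_i.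
This is what matches degree with order. -/
lemma op_pderiv (p : MvPolynomial (Fin n) (PowSer K n)) (i : Fin n) :
    op (MvPolynomial.pderiv i p) = op p * xOp K i - xOp K i * op p := by
  induction p using MvPolynomial.induction_on with
  | C a =>
    rw [MvPolynomial.pderiv_C, op_zero, op_C]
    exact (sub_eq_zero.2 (mulOp_comm _ _)).symm
  | add p q hp hq =>
    rw [map_add, op_add, op_add, hp, hq, add_mul, mul_add]
    abel
  | mul_X p j hp =>
    rw [MvPolynomial.pderiv_mul, MvPolynomial.pderiv_X, op_add, op_mul_X, op_mul_X, hp]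
    have h : op (p * Pi.single (M := fun _ => MvPolynomial (Fin n) (PowSer K n)) i 1 j)
        = (if j = i then 1 else 0) * op p := by
      rw [Pi.single_apply]
      split_ifs
      · rw [mul_one, one_mul]
      · rw [mul_zero, zero_mul, op_zero]
    rw [h, mul_sub, ← mul_assoc (dOp K j) (xOp K i) (op p), dOp_mul_xOp, add_mul, mul_assoc,
      mul_assoc]
    abel

/-- All monomials in `p` have degree at most `k`. -/
def DegLE (k : ℕ) (p : MvPolynomial (Fin n) (PowSer K n)) : Prop :=
  ∀ α : Fin n →₀ ℕ, k < α.degree → p.coeff α = 0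

lemma DegLE.add {k : ℕ} {p q : MvPolynomial (Fin n) (PowSer K n)} (hp : DegLE k p)
    (hq : DegLE k q) : DegLE k (p + q) := fun α hα => by
  rw [MvPolynomial.coeff_add, hp α hα, hq α hα, add_zero]

lemma DegLE.mono {k l : ℕ} (h : k ≤ l) {p : MvPolynomial (Fin n) (PowSer K n)} (hp : DegLE k p) :
    DegLE l p := fun α hα => hp α (by omega)

lemma DegLE.mul_X {k : ℕ} {p : MvPolynomial (Fin n) (PowSer K n)} (hp : DegLE k p) (i : Fin n) :
    DegLE (k + 1) (p * MvPolynomial.X i) := by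
  classical
  intro α hα
  rw [MvPolynomial.coeff_mul_X']
  split_ifs with h
  · refine hp _ ?_
    have h1 : α - Finsupp.single i 1 + Finsupp.single i 1 = α :=
      tsub_add_cancel_of_le (Finsupp.single_le_iff.2
        (Nat.one_le_iff_ne_zero.2 (Finsupp.mem_support_iff.1 h)))
    rw [← h1, map_add, Finsupp.degree_single] at hα
    omega
  · rfl

lemma exists_degLE (p : MvPolynomial (Fin n) (PowSer K n)) : ∃ k, DegLE k p :=
  ⟨p.totalDegree, fun α hα => MvPolynomial.coeff_eq_zero_of_totalDegree_lt (by
    rwa [Finsupp.degree_apply] at hα)⟩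

lemma DegLE.eq_C {p : MvPolynomial (Fin n) (PowSer K n)} (hp : DegLE 0 p) :
    p = MvPolynomial.C (p.coeff 0) := by
  classical
  ext1 α
  rw [MvPolynomial.coeff_C]
  split_ifs with h
  · rw [h]
  · exact hp α (Nat.pos_of_ne_zero fun h0 => h (by
      rw [(Finsupp.degree_eq_zero_iff α).1 h0]))

lemma DegLE.pderiv {k : ℕ} {p : MvPolynomial (Fin n) (PowSer K n)} (hp : DegLE (k + 1) p)
    (i : Fin n) : DegLE k (MvPolynomial.pderiv i p) := by
  intro α hα
  rw [MvPolynomial.coeff_pderiv, hp, zero_mul]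
  rw [map_add, Finsupp.degree_single]
  omega

lemma mulOp_injective : Function.Injective (mulOp K (PowSer K n)) := by
  intro a b h
  have := congrArg (fun Q : DOps K (PowSer K n) => Q • (1 : PowSer K n)) h
  simpa [mulOp_smul] using this

lemma op_mem {k : ℕ} {p : MvPolynomial (Fin n) (PowSer K n)} (hp : DegLE k p) :
    op p ∈ diffFilt K (PowSer K n) k := by
  induction k generalizing p with
  | zero =>
    rw [hp.eq_C, op_C]
    exact mulOp_mem_diffFilt _
  | succ k ih =>
    refine mem_diffFilt_succ_of_commutator fun i => ?_
    rw [← op_pderiv]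
    exact ih (hp.pderiv i)

section

variable [CharZero K]

lemma degLE_zero_of_pderiv {p : MvPolynomial (Fin n) (PowSer K n)}
    (h : ∀ i, MvPolynomial.pderiv i p = 0) : DegLE 0 p := by
  intro α hα
  have hα0 : α ≠ 0 := by
    rintro rfl
    simp at hα
  obtain ⟨i, hi⟩ := Finsupp.ne_iff.1 hα0
  have h1 : α - Finsupp.single i 1 + Finsupp.single i 1 = α :=
    tsub_add_cancel_of_le (Finsupp.single_le_iff.2 (Nat.one_le_iff_ne_zero.2 hi))
  have h2 := MvPolynomial.coeff_pderiv (i := i) p (α - Finsupp.single i 1)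
  rw [h i, MvPolynomial.coeff_zero, h1] at h2
  have : CharZero (PowSer K n) := charZero_of_injective_algebraMap (R := K)
    (FaithfulSMul.algebraMap_injective _ _)
  rcases mul_eq_zero.1 h2.symm with h3 | h3
  · exact h3
  · exact absurd h3 (Nat.cast_add_one_ne_zero _)

/-- If `op p = 0`, all its brackets with variables vanish, hence all ξ-derivatives of p vanish by
induction on the degree. In characteristic zero p is then constant, and constants act faithfully. -/
lemma op_injective : Function.Injective (op (K := K) (n := n)) := by
  have key : ∀ k (p : MvPolynomial (Fin n) (PowSer K n)), DegLE k p → op p = 0 → p = 0 := by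
    intro k
    induction k with
    | zero =>
      intro p hp h
      rw [hp.eq_C] at h ⊢
      rw [op_C, ← map_zero (mulOp K (PowSer K n))] at h
      rw [mulOp_injective h, map_zero]
    | succ k ih =>
      intro p hp h
      have h0 : DegLE 0 p := degLE_zero_of_pderiv fun i => ih _ (hp.pderiv i) (by
        rw [op_pderiv, h, zero_mul, mul_zero, sub_zero])
      rw [h0.eq_C] at h ⊢
      rw [op_C, ← map_zero (mulOp K (PowSer K n))] at h
      rw [mulOp_injective h, map_zero]
  intro p q h
  obtain ⟨k, hk⟩ := exists_degLE (p - q)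
  refine sub_eq_zero.1 (key k _ hk ?_)
  have : op (p - q) = op p - op q := map_sub opOf p q
  rw [this, h, sub_self]

lemma exists_op_eq {k : ℕ} {Q : DOps K (PowSer K n)} (hQ : Q ∈ diffFilt K (PowSer K n) k) :
    ∃ p, DegLE k p ∧ op p = Q := by
  induction k generalizing Q with
  | zero =>
    refine ⟨MvPolynomial.C (Q • (1 : PowSer K n)), fun α hα => ?_, ?_⟩
    · classical
      rw [MvPolynomial.coeff_C, if_neg]
      rintro rfl
      simp at hα
    · rw [op_C, ← eq_mulOp_of_mem_diffFilt_zero hQ]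
  | succ k ih =>
    obtain ⟨R, hR, S, hS, rfl⟩ := exists_eq_add_sum hQ
    obtain ⟨r, hr, rfl⟩ := ih hR
    choose s hs hs' using fun i => ih (hS i)
    refine ⟨r + ∑ i, s i * MvPolynomial.X i, ?_, ?_⟩
    · refine (hr.mono (Nat.le_succ k)).add ?_
      refine Finset.sum_induction _ (DegLE (k + 1)) (fun a b ha hb => ha.add hb)
        (fun α _ => by simp) fun i _ => (hs i).mul_X i
    · rw [op_add]
      congr 1
      refine (map_sum opOf _ _).trans (Finset.sum_congr rfl fun i _ => ?_)
      exact (op_mul_X _ _).trans (by rw [hs'])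

lemma opOf_bijective : Function.Bijective (opOf (K := K) (n := n)) := by
  refine ⟨op_injective, fun Q => ?_⟩
  obtain ⟨k, hk⟩ := exists_mem_diffFilt (show DOps K (PowSer K n) from Q)
  obtain ⟨p, _, hp⟩ := exists_op_eq hk
  exact ⟨p, hp⟩

/-- Freeness is used only through flatness, in `injective_of_injective_DOps`. -/
instance : Module.Free (PowSer K n) (RightD K n) :=
  Module.Free.of_equiv (LinearEquiv.ofBijective opOf opOf_bijective)

end

/-! ## Injective `D`-modules are injective over `O` -/

section

variable {E : Type u} [AddCommGroup E] [Module (DOps K (PowSer K n)) E] [Module (PowSer K n) E]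

open TensorProduct

/-- The extension of an `O`-linear map `N → E` to an additive map `D ⊗ N → E`. -/
def tensorLiftAux (hE : ∀ (a : PowSer K n) (e : E), mulOp K (PowSer K n) a • e = a • e)
    (N : Type u) [AddCommGroup N] [Module (PowSer K n) N] (f : N →ₗ[PowSer K n] E) :
    RightD K n ⊗[PowSer K n] N →+ E :=
  TensorProduct.liftAddHom
    { toFun := fun Q => (DistribSMul.toAddMonoidHom E Q.val).comp f.toAddMonoidHom
      map_zero' := by
        ext x
        exact zero_smul (DOps K (PowSer K n)) (f x)
      map_add' := fun Q R => by
        ext x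
        exact add_smul (R := DOps K (PowSer K n)) Q R (f x) }
    (fun a Q x => by
      change (Q.val * mulOp K (PowSer K n) a) • f x = Q.val • f (a • x)
      rw [mul_smul, hE, map_smul])

lemma tensorLiftAux_tmul (hE : ∀ (a : PowSer K n) (e : E), mulOp K (PowSer K n) a • e = a • e)
    (N : Type u) [AddCommGroup N] [Module (PowSer K n) N] (f : N →ₗ[PowSer K n] E)
    (Q : RightD K n) (x : N) : tensorLiftAux hE N f (Q ⊗ₜ x) = Q.val • f x := rfl

/-- The extension of an `O`-linear map `N → E` to a `D`-linear map `D ⊗ N → E`. -/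
def tensorLift (hE : ∀ (a : PowSer K n) (e : E), mulOp K (PowSer K n) a • e = a • e)
    (N : Type u) [AddCommGroup N] [Module (PowSer K n) N] (f : N →ₗ[PowSer K n] E) :
    RightD K n ⊗[PowSer K n] N →ₗ[DOps K (PowSer K n)] E where
  toFun := tensorLiftAux hE N f
  map_add' := map_add _
  map_smul' Q z := by
    induction z with
    | zero => rw [smul_zero, map_zero, smul_zero]
    | tmul R x =>
      rw [TensorProduct.smul_tmul', tensorLiftAux_tmul, tensorLiftAux_tmul, RightD.val_smul,
        mul_smul, RingHom.id_apply]
    | add z z' h h' => rw [smul_add, map_add, h, h', map_add, smul_add]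



/-- Restriction of scalars is right adjoint to D ⊗_O -, which preserves injections because D is flat
as a right O-module; hence it preserves injectives. -/
lemma injective_of_injective_DOps [CharZero K]
    (hE : ∀ (a : PowSer K n) (e : E), mulOp K (PowSer K n) a • e = a • e)
    (hinj : Module.Injective (DOps K (PowSer K n)) E) : Module.Injective (PowSer K n) E where
  out X Y _ _ _ _ i hi f := by
    have h1 : Function.Injective (i.lTensor (RightD K n)) :=
      Module.Flat.lTensor_preserves_injective_linearMap i hi
    let i' : RightD K n ⊗[PowSer K n] X →ₗ[DOps K (PowSer K n)] RightD K n ⊗[PowSer K n] Y :=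
      { toFun := i.lTensor (RightD K n)
        map_add' := map_add _
        map_smul' := fun Q z => by
          induction z with
          | zero => simp
          | tmul R x => rfl
          | add z z' h h' => rw [smul_add, map_add, h, h', map_add, smul_add] }
    obtain ⟨F, hF⟩ := hinj.out i' h1 (tensorLift hE X f)
    -- The extension over O is the restriction of the D-linear extension to the elements 1 ⊗ y.
    refine ⟨{ toFun := fun y => F ((RightD.val (K := K) (n := n)).symm 1 ⊗ₜ y)
              map_add' := fun y y' => by rw [TensorProduct.tmul_add, map_add]
              map_smul' := fun a y => ?_ }, fun x => ?_⟩
    · have : (RightD.val (K := K) (n := n)).symm 1 ⊗ₜ[PowSer K n] (a • y)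
          = mulOp K (PowSer K n) a • ((RightD.val (K := K) (n := n)).symm 1 ⊗ₜ[PowSer K n] y) := by
        rw [← TensorProduct.smul_tmul, TensorProduct.smul_tmul']
        congr 1
      rw [this, map_smul, hE, RingHom.id_apply]
    · have := hF ((RightD.val (K := K) (n := n)).symm 1 ⊗ₜ x)
      exact this.trans (one_smul _ _)

end

end PowSer

/-! ## The simple `D`-module `D / (D X_1 + ⋯ + D X_g + D ∂_(g+1) + ⋯ + D ∂_n)` -/

namespace PowSer

open MvPowerSeries

variable {K : Type u} [Field K] {n : ℕ}

/-- `η` generates the left `D`-module `M`, is nonzero, and is annihilated by `X_1, …, X_g` and by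
`∂_(g+1), …, ∂_n`. -/
structure IsDeltaGen (K : Type u) [Field K] (n g : ℕ) {M : Type u} [AddCommGroup M] [Module (DOps K (PowSer K n)) M]
    (η : M) : Prop where
  ne_zero : η ≠ 0
  exists_smul : ∀ m : M, ∃ Q : DOps K (PowSer K n), m = Q • η
  xOp_smul : ∀ i : Fin n, i.val < g → xOp K i • η = 0
  dOp_smul : ∀ i : Fin n, g ≤ i.val → dOp K i • η = 0

variable {g : ℕ} {M : Type u} [AddCommGroup M] [Module (DOps K (PowSer K n)) M] {η : M}

lemma IsDeltaGen.map {M' : Type u} [AddCommGroup M'] [Module (DOps K (PowSer K n)) M']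
    (h : IsDeltaGen K n g η) (e : M ≃ₗ[DOps K (PowSer K n)] M') : IsDeltaGen K n g (e η) where
  ne_zero := by simpa using h.ne_zero
  exists_smul m := by
    obtain ⟨Q, hQ⟩ := h.exists_smul (e.symm m)
    exact ⟨Q, by rw [← map_smul, ← hQ, e.apply_symm_apply]⟩
  xOp_smul i hi := by rw [← map_smul, h.xOp_smul i hi, map_zero]
  dOp_smul i hi := by rw [← map_smul, h.dOp_smul i hi, map_zero]

/-- The elements `Q η` with `Q` of order at most `k`. -/
def ordFilt (K : Type u) [Field K] (n : ℕ) {M : Type u} [AddCommGroup M]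
    [Module (DOps K (PowSer K n)) M] (η : M) (k : ℕ) : AddSubgroup M :=
  (diffFilt K (PowSer K n) k).map ((smulAddHom (DOps K (PowSer K n)) M).flip η)

lemma mem_ordFilt {k : ℕ} {m : M} :
    m ∈ ordFilt K n η k ↔ ∃ Q ∈ diffFilt K (PowSer K n) k, Q • η = m := Iff.rfl

lemma ordFilt_mono : Monotone (ordFilt K n η) := by
  rintro k l h _ ⟨Q, hQ, rfl⟩
  exact ⟨Q, diffFilt_mono h hQ, rfl⟩

lemma smul_mem_ordFilt {i j : ℕ} {Q : DOps K (PowSer K n)} (hQ : Q ∈ diffFilt K (PowSer K n) i)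
    {m : M} (hm : m ∈ ordFilt K n η j) :
    Q • m ∈ ordFilt K n η (i + j) := by
  obtain ⟨R, hR, rfl⟩ := hm
  exact ⟨Q * R, mul_mem_diffFilt hQ hR, mul_smul _ _ _⟩

lemma commutator_mem {k : ℕ} {Q R : DOps K (PowSer K n)} (hQ : Q ∈ diffFilt K (PowSer K n) 1)
    (hR : R ∈ diffFilt K (PowSer K n) k) : Q * R - R * Q ∈ diffFilt K (PowSer K n) k := by
  have h := commutator_mem_diffOrderLt (mem_diffFilt.1 hQ) (mem_diffFilt.1 hR)
  rw [add_comm] at h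
  rw [mem_diffFilt, map_sub, map_mul, map_mul]
  exact h

/-- As X_i kills η, its action on Qη is a commutator, which lowers the order of Q. All inductions on
order rest on this. -/
lemma xOp_smul_smul (h : IsDeltaGen K n g η) (Q : DOps K (PowSer K n)) {i : Fin n} (hi : i.val < g) :
    xOp K i • Q • η = -((Q * xOp K i - xOp K i * Q) • η) := by
  rw [sub_smul, mul_smul, h.xOp_smul i hi, smul_zero, zero_sub, neg_neg, mul_smul]

lemma mulOp_smul_eq_zero (h : IsDeltaGen K n g η) {f : PowSer K n} (hf : f ∈ varIdeal K n g) :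
    mulOp K (PowSer K n) f • η = 0 := by
  rw [eq_kill_add_sum g f, mem_varIdeal_iff.1 hf, zero_add, map_sum, Finset.sum_smul]
  refine Finset.sum_eq_zero fun i hi => ?_
  rw [mul_comm, map_mul, mul_smul]
  have := h.xOp_smul i (Finset.mem_filter.1 hi).2
  rw [xOp] at this
  rw [this, smul_zero]

variable [CharZero K]

/-- For i ≥ g one has ∂_i(fη) = (∂f/∂X_i)η. Choosing a monomial of f free of the first g variables
and differentiating it down to a nonzero constant term turns f into a unit. -/
lemma exists_smul_mulOp_smul_eq (h : IsDeltaGen K n g η) {f : PowSer K n}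
    (hf : f ∉ varIdeal K n g) :
    ∃ Q : DOps K (PowSer K n), Q • mulOp K (PowSer K n) f • η = η := by
  have key : ∀ (N : ℕ) (α : Fin n →₀ ℕ) (f : PowSer K n), α.degree = N → wt g α = 0 →
      coeff α f ≠ 0 → ∃ Q : DOps K (PowSer K n), Q • mulOp K (PowSer K n) f • η = η := by
    intro N
    induction N with
    | zero =>
      intro α f hα _ hf
      rw [Finsupp.degree_eq_zero_iff] at hα
      rw [hα, coeff_zero_eq_constantCoeff_apply] at hf
      obtain ⟨v, hv⟩ := (isUnit_iff_constantCoeff.2 (isUnit_iff_ne_zero.2 hf)).exists_left_inv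
      exact ⟨mulOp K (PowSer K n) v, by rw [← mul_smul, ← map_mul, hv, map_one, one_smul]⟩
    | succ N ih =>
      intro α f hα hw hf
      have hα0 : α ≠ 0 := by
        rintro rfl
        simp at hα
      obtain ⟨i, hi⟩ := Finsupp.ne_iff.1 hα0
      have h1 : α - Finsupp.single i 1 + Finsupp.single i 1 = α :=
        tsub_add_cancel_of_le (Finsupp.single_le_iff.2 (Nat.one_le_iff_ne_zero.2 hi))
      have hgi : g ≤ i.val := by
        by_contra hc
        exact hi (wt_eq_zero.1 hw i (by omega))
      rw [← h1, map_add, Finsupp.degree_single] at hα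
      rw [← h1, wt_add] at hw
      obtain ⟨Q, hQ⟩ := ih (α - Finsupp.single i 1) (pderiv K i f) (by omega) (by omega) (by
        rw [coeff_pderiv, h1]
        exact mul_ne_zero hf (Nat.cast_add_one_ne_zero _))
      refine ⟨Q * dOp K i, ?_⟩
      rw [mul_smul, ← mul_smul (dOp K i), dOp_mul_mulOp, add_smul, mul_smul (mulOp K _ f),
        h.dOp_smul i hgi, smul_zero, zero_add, hQ]
  rw [mem_varIdeal_iff] at hf
  obtain ⟨α, hα⟩ := (ne_zero_iff_exists_coeff_ne_zero _).1 hf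
  rw [coeff_kill] at hα
  split_ifs at hα with hw
  · exact key _ α f rfl hw hα
  · exact absurd rfl hα

lemma mulOp_smul_eq_zero_iff (h : IsDeltaGen K n g η) {f : PowSer K n} :
    mulOp K (PowSer K n) f • η = 0 ↔ f ∈ varIdeal K n g := by
  refine ⟨fun h0 => ?_, mulOp_smul_eq_zero h⟩
  by_contra hf
  obtain ⟨Q, hQ⟩ := exists_smul_mulOp_smul_eq h hf
  rw [h0, smul_zero] at hQ
  exact h.ne_zero hQ.symm

/-- Apply Euler's relation to m = Qη. For i < g the term [Q, X_i]η equals -X_i m = 0; for i ≥ g, ∂_i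
can be moved to the right, where it kills η, leaving a commutator whose order does not grow. So m
has smaller order, and one descends to order zero. -/
lemma exists_eq_mulOp_smul (h : IsDeltaGen K n g η) (k : ℕ) {m : M}
    (hm : m ∈ ordFilt K n η k) (hx : ∀ i : Fin n, i.val < g → xOp K i • m = 0) :
    ∃ f, m = mulOp K (PowSer K n) f • η := by
  induction k generalizing m with
  | zero =>
    obtain ⟨Q, hQ, rfl⟩ := hm
    exact ⟨_, congrArg (· • η) (eq_mulOp_of_mem_diffFilt_zero hQ)⟩
  | succ k ih =>
    refine ih ?_ hx
    obtain ⟨Q, hQ, rfl⟩ := mem_ordFilt.1 hm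
    have h1 : (∑ i, dOp K i * (Q * xOp K i - xOp K i * Q)) • η
        ∈ ordFilt K n η k := by
      rw [Finset.sum_smul]
      refine sum_mem fun i _ => ?_
      by_cases hi : i.val < g
      · rw [mul_smul, ← neg_neg ((Q * xOp K i - xOp K i * Q) • η), ← xOp_smul_smul h Q hi,
          hx i hi, neg_zero, smul_zero]
        exact zero_mem _
      · have h2 := mem_diffFilt_succ_iff.1 hQ (X i)
        refine ⟨_, commutator_mem (dOp_mem i) h2, ?_⟩
        change (_ - _ * dOp K i) • η = _
        rw [sub_smul, mul_smul _ (dOp K i), h.dOp_smul i (by omega), smul_zero, sub_zero]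
        rfl
    have h3 := add_mem (show _ ∈ ordFilt K n η k from ⟨_, euler_mem k hQ, rfl⟩) h1
    change (_ - _ : DOps K (PowSer K n)) • η + _ ∈ _ at h3
    rw [← add_smul, sub_add_cancel] at h3
    have hk : ((k + 1 : ℕ) : K) ≠ 0 := Nat.cast_ne_zero.2 (Nat.succ_ne_zero k)
    -- Division by k + 1 is carried out inside D, as multiplication by a constant power series.
    have h4 := smul_mem_ordFilt (mulOp_mem_diffFilt (K := K) (C ((k + 1 : ℕ) : K)⁻¹)) h3
    rw [zero_add, ← mul_smul, mul_smul_comm, ← smul_mul_assoc, ← map_nsmul, ← map_nsmul,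
      nsmul_eq_mul, mul_inv_cancel₀ hk, map_one, map_one, one_mul] at h4
    exact h4

/-- Induction on order: either some X_i with `i.val < g` sends m to a nonzero element of smaller
order, or all of them kill m, and then m = fη. -/
lemma exists_smul_smul_eq (h : IsDeltaGen K n g η) {m : M} (hm : m ≠ 0) :
    ∃ Q : DOps K (PowSer K n), Q • m = η := by
  have key : ∀ (k : ℕ) (m : M), m ∈ ordFilt K n η k → m ≠ 0 →
      ∃ Q : DOps K (PowSer K n), Q • m = η := by
    intro k
    induction k with
    | zero =>
      intro m hm h0
      obtain ⟨Q, hQ, rfl⟩ := mem_ordFilt.1 hm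
      rw [eq_mulOp_of_mem_diffFilt_zero hQ] at h0 ⊢
      exact exists_smul_mulOp_smul_eq h fun hc => h0 (mulOp_smul_eq_zero h hc)
    | succ k ih =>
      intro m hm h0
      by_cases hx : ∀ i : Fin n, i.val < g → xOp K i • m = 0
      · obtain ⟨f, rfl⟩ := exists_eq_mulOp_smul h _ hm hx
        exact exists_smul_mulOp_smul_eq h fun hc => h0 (mulOp_smul_eq_zero h hc)
      · push Not at hx
        obtain ⟨i, hi, hxm⟩ := hx
        obtain ⟨Q, hQ, rfl⟩ := mem_ordFilt.1 hm
        obtain ⟨R, hR⟩ := ih _ (by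
          rw [xOp_smul_smul h Q hi]
          exact neg_mem ⟨_, mem_diffFilt_succ_iff.1 hQ (X i), rfl⟩) hxm
        exact ⟨R * xOp K i, by rw [mul_smul, hR]⟩
  obtain ⟨Q, rfl⟩ := h.exists_smul m
  obtain ⟨k, hk⟩ := exists_mem_diffFilt Q
  exact key k _ ⟨Q, hk, rfl⟩ hm

lemma IsDeltaGen.isSimpleModule (h : IsDeltaGen K n g η) :
    IsSimpleModule (DOps K (PowSer K n)) M := by
  rw [isSimpleModule_iff_toSpanSingleton_surjective]
  refine ⟨⟨η, 0, h.ne_zero⟩, fun m hm m' => ?_⟩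
  obtain ⟨Q, hQ⟩ := exists_smul_smul_eq h hm
  obtain ⟨R, rfl⟩ := h.exists_smul m'
  exact ⟨R * Q, by rw [LinearMap.toSpanSingleton_apply, mul_smul, hQ]⟩

omit [CharZero K] in
lemma IsDeltaGen.finite (h : IsDeltaGen K n g η) : Module.Finite (DOps K (PowSer K n)) M := by
  refine ⟨⟨{η}, ?_⟩⟩
  rw [Finset.coe_singleton, eq_top_iff]
  intro m _
  obtain ⟨Q, rfl⟩ := h.exists_smul m
  exact Submodule.smul_mem _ _ (Submodule.mem_span_singleton_self η)

/-- An operator carrying m back to η sends I-torsion to torsion for a power of I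
(`diffFilt_smul_torsion`). So a power of I lies in Ann η = P, and P is prime. -/
lemma le_varIdeal_of_smul_eq_zero (h : IsDeltaGen K n g η) {I : Ideal (PowSer K n)} {m : M}
    (hm : m ≠ 0) (hI : ∀ a ∈ I, mulOp K (PowSer K n) a • m = 0) : I ≤ varIdeal K n g := by
  obtain ⟨Q, hQ⟩ := exists_smul_smul_eq h hm
  obtain ⟨k, hk⟩ := exists_mem_diffFilt Q
  have h1 := diffFilt_smul_torsion K I k 1 Q hk m (by rwa [pow_one])
  have h2 : I ^ (1 + k) ≤ varIdeal K n g := fun a ha => (mulOp_smul_eq_zero_iff h).1 (by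
    rw [← hQ]
    exact h1 a ha)
  exact Ideal.IsPrime.le_of_pow_le h2

omit [CharZero K] in
lemma exists_pow_smul_eq_zero (h : IsDeltaGen K n g η) (m : M) :
    ∃ s, ∀ a ∈ varIdeal K n g ^ s, mulOp K (PowSer K n) a • m = 0 := by
  obtain ⟨Q, rfl⟩ := h.exists_smul m
  obtain ⟨k, hk⟩ := exists_mem_diffFilt Q
  exact ⟨1 + k, diffFilt_smul_torsion K _ k 1 Q hk η fun a ha =>
    mulOp_smul_eq_zero h (by rwa [pow_one] at ha)⟩

lemma eq_zero_of_xOp_smul (h : IsDeltaGen K n g η) {i : Fin n} (hi : g ≤ i.val) {m : M}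
    (hm : xOp K i • m = 0) : m = 0 := by
  by_contra h0
  refine X_notMem_varIdeal hi (le_varIdeal_of_smul_eq_zero h h0 (I := Ideal.span {X i}) ?_
    (Ideal.mem_span_singleton_self _))
  intro a ha
  obtain ⟨b, rfl⟩ := Ideal.mem_span_singleton.1 ha
  rw [mul_comm, map_mul, mul_smul]
  rw [xOp] at hm
  rw [hm, smul_zero]

/-- If X_i m = η with i ≥ g, then X_1, …, X_g kill m, because X_i is injective on M. So m = fη and
X_i f - 1 lies in P, contradicting its constant term. This keeps the next class η/X_i nonzero. -/
lemma ne_xOp_smul (h : IsDeltaGen K n g η) {i : Fin n} (hi : g ≤ i.val) (m : M) :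
    xOp K i • m ≠ η := by
  intro hm
  have hx : ∀ j : Fin n, j.val < g → xOp K j • m = 0 := by
    intro j hj
    refine eq_zero_of_xOp_smul h hi ?_
    have hc : xOp K i * xOp K j = xOp K j * xOp K i := mulOp_comm _ _
    rw [← mul_smul, hc, mul_smul, hm, h.xOp_smul j hj]
  obtain ⟨Q, rfl⟩ := h.exists_smul m
  obtain ⟨k, hk⟩ := exists_mem_diffFilt Q
  obtain ⟨f, hf⟩ := exists_eq_mulOp_smul h k ⟨Q, hk, rfl⟩ hx
  change Q • η = _ at hf
  rw [hf, xOp, ← mul_smul, ← map_mul, ← sub_eq_zero, ← one_smul (DOps K (PowSer K n)) η,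
    ← mul_smul, mul_one, ← sub_smul, ← map_one (mulOp K (PowSer K n)), ← map_sub,
    mulOp_smul_eq_zero_iff h] at hm
  have h1 := (varIdeal K n g).neg_mem hm
  rw [mem_varIdeal_iff] at h1
  have h2 : coeff 0 (kill g (-(X i * f - 1))) = 1 := by
    rw [coeff_kill, if_pos (by simp [wt]), coeff_zero_eq_constantCoeff_apply]
    simp
  rw [h1, map_zero] at h2
  exact zero_ne_one h2

/-- Since ∂_i η = 0, the operators ∂_i R and [∂_i, R] agree on η, and the latter commutes with X_i
when R does, by Jacobi and [∂_i, X_i] = 1. -/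
lemma exists_commute_smul (h : IsDeltaGen K n g η) {i : Fin n} (hi : g ≤ i.val) (m : M) :
    ∃ Q : DOps K (PowSer K n), Q * xOp K i = xOp K i * Q ∧ m = Q • η := by
  obtain ⟨Q, rfl⟩ := h.exists_smul m
  induction Q using DOps_induction with
  | hO a => exact ⟨_, mulOp_comm _ _, rfl⟩
  | hadd Q R hQ hR =>
    obtain ⟨Q', h1, h2⟩ := hQ
    obtain ⟨R', h3, h4⟩ := hR
    exact ⟨Q' + R', by rw [add_mul, mul_add, h1, h3], by rw [add_smul, add_smul, h2, h4]⟩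
  | hd j Q hQ =>
    obtain ⟨R, h1, h2⟩ := hQ
    rw [mul_smul, h2]
    by_cases hj : j = i
    · subst hj
      refine ⟨dOp K j * R - R * dOp K j, ?_, ?_⟩
      · rw [sub_mul, mul_sub, mul_assoc, h1, ← mul_assoc, dOp_mul_xOp_self, mul_assoc R,
          dOp_mul_xOp_self, mul_add, ← mul_assoc R, h1]
        simp only [add_mul, mul_assoc, one_mul, mul_one]
        abel
      · rw [sub_smul, mul_smul, mul_smul, h.dOp_smul j hi, smul_zero, sub_zero]
    · refine ⟨dOp K j * R, ?_, (mul_smul _ _ _).symm⟩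
      rw [mul_assoc, h1, ← mul_assoc, dOp_mul_xOp_of_ne hj, mul_assoc]

/-- Every element is killed by a power of P, and the annihilator of a nonzero element is contained
in P; the prime P itself is attained at η. -/
lemma IsDeltaGen.associatedPrimes (h : IsDeltaGen K n g η) [Module (PowSer K n) M]
    (hM : ∀ (a : PowSer K n) (m : M), mulOp K (PowSer K n) a • m = a • m) :
    associatedPrimes (PowSer K n) M = {varIdeal K n g} := by
  ext p
  rw [AssociatedPrimes.mem_iff, isAssociatedPrime_iff, Set.mem_singleton_iff]
  constructor
  · rintro ⟨hp, m, hm⟩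
    have hmem : ∀ a, a ∈ p ↔ mulOp K (PowSer K n) a • m = 0 := by
      intro a
      rw [hm, Submodule.mem_colon_singleton, Submodule.mem_bot, hM]
    have hm0 : m ≠ 0 := by
      rintro rfl
      exact hp.ne_top (Ideal.eq_top_iff_one _ |>.2 ((hmem 1).2 (smul_zero _)))
    refine le_antisymm (le_varIdeal_of_smul_eq_zero h hm0 fun a ha => (hmem a).1 ha) ?_
    obtain ⟨s, hs⟩ := exists_pow_smul_eq_zero h m
    exact Ideal.IsPrime.le_of_pow_le (n := s) fun a ha => (hmem a).2 (hs a ha)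
  · rintro rfl
    refine ⟨inferInstance, η, ?_⟩
    ext a
    rw [Submodule.mem_colon_singleton, Submodule.mem_bot, ← hM, mulOp_smul_eq_zero_iff h]

end PowSer

/-! ## Local cohomology of the power series ring, from an injective resolution -/

namespace PowSer

open MvPowerSeries

variable {K : Type u} [Field K] {n : ℕ}

/-! ### Generating classes in subquotients of a D-module. -/

section Classes

variable {E : Type u} [AddCommGroup E] [Module (DOps K (PowSer K n)) E]

/-- The class of `η` in `Z / (B ∩ Z)` is a generator as in `IsDeltaGen`. -/
structure IsDeltaClass (g : ℕ) (Z B : Submodule (DOps K (PowSer K n)) E) (η : E) : Prop where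
  mem : η ∈ Z
  notMem : η ∉ B
  exists_sub_mem : ∀ z ∈ Z, ∃ Q : DOps K (PowSer K n), z - Q • η ∈ B
  xOp_smul : ∀ i : Fin n, i.val < g → xOp K i • η ∈ B
  dOp_smul : ∀ i : Fin n, g ≤ i.val → dOp K i • η ∈ B

variable {g : ℕ} {Z B : Submodule (DOps K (PowSer K n)) E} {η : E}

lemma IsDeltaClass.isDeltaGen_of_surjective {H : Type u} [AddCommGroup H]
    [Module (DOps K (PowSer K n)) H] (h : IsDeltaClass g Z B η)
    (q : Z →ₗ[DOps K (PowSer K n)] H) (hq : Function.Surjective q)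
    (hker : ∀ z, q z = 0 ↔ (z : E) ∈ B) : IsDeltaGen K n g (q ⟨η, h.mem⟩) where
  ne_zero h0 := h.notMem ((hker _).1 h0)
  exists_smul m := by
    obtain ⟨z, rfl⟩ := hq m
    obtain ⟨Q, hQ⟩ := h.exists_sub_mem z z.2
    refine ⟨Q, ?_⟩
    rw [← map_smul, ← sub_eq_zero, ← map_sub]
    exact (hker _).2 hQ
  xOp_smul i hi := by
    rw [← map_smul]
    exact (hker _).2 (h.xOp_smul i hi)
  dOp_smul i hi := by
    rw [← map_smul]
    exact (hker _).2 (h.dOp_smul i hi)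

lemma IsDeltaClass.isDeltaGen (h : IsDeltaClass g Z B η) :
    IsDeltaGen K n g ((B.comap Z.subtype).mkQ ⟨η, h.mem⟩) :=
  h.isDeltaGen_of_surjective _ (Submodule.mkQ_surjective _) fun z => by
    rw [Submodule.mkQ_apply, Submodule.Quotient.mk_eq_zero]
    rfl

variable [CharZero K]

lemma IsDeltaClass.mem_of_xOp_smul_mem (h : IsDeltaClass g Z B η) {i : Fin n} (hi : g ≤ i.val)
    {z : E} (hz : z ∈ Z) (hx : xOp K i • z ∈ B) : z ∈ B := by
  have h1 := eq_zero_of_xOp_smul h.isDeltaGen hi (m := (B.comap Z.subtype).mkQ ⟨z, hz⟩) (by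
    rw [← map_smul, Submodule.mkQ_apply, Submodule.Quotient.mk_eq_zero]
    exact hx)
  rw [Submodule.mkQ_apply, Submodule.Quotient.mk_eq_zero] at h1
  exact h1

lemma IsDeltaClass.mem_of_pow_smul_mem (h : IsDeltaClass g Z B η) {i : Fin n} (hi : g ≤ i.val)
    (t : ℕ) {z : E} (hz : z ∈ Z) (hx : xOp K i ^ t • z ∈ B) : z ∈ B := by
  induction t with
  | zero => rwa [pow_zero, one_smul] at hx
  | succ t ih =>
    rw [pow_succ', mul_smul] at hx
    exact ih (h.mem_of_xOp_smul_mem hi (Z.smul_mem _ hz) hx)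

lemma IsDeltaClass.sub_xOp_smul_notMem (h : IsDeltaClass g Z B η) {i : Fin n} (hi : g ≤ i.val)
    {z : E} (hz : z ∈ Z) : η - xOp K i • z ∉ B := by
  intro hB
  refine ne_xOp_smul h.isDeltaGen hi ((B.comap Z.subtype).mkQ ⟨z, hz⟩) ?_
  rw [← map_smul, eq_comm, ← sub_eq_zero, ← map_sub, Submodule.mkQ_apply,
    Submodule.Quotient.mk_eq_zero]
  exact hB

lemma IsDeltaClass.exists_commute (h : IsDeltaClass g Z B η) {i : Fin n} (hi : g ≤ i.val)
    {z : E} (hz : z ∈ Z) :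
    ∃ Q : DOps K (PowSer K n), Q * xOp K i = xOp K i * Q ∧ z - Q • η ∈ B := by
  obtain ⟨Q, hQ, hz⟩ := exists_commute_smul h.isDeltaGen hi ((B.comap Z.subtype).mkQ ⟨z, hz⟩)
  refine ⟨Q, hQ, ?_⟩
  rw [← map_smul, ← sub_eq_zero, ← map_sub, Submodule.mkQ_apply,
    Submodule.Quotient.mk_eq_zero] at hz
  exact hz

end Classes

/-! ### Torsion with respect to the first variables, and divisibility in injective modules. -/

section Torsion

variable {E : Type u} [AddCommGroup E] [Module (DOps K (PowSer K n)) E]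

/-- The elements of `E` killed by a power of `(X_1, …, X_g)`. -/
abbrev tors (g : ℕ) (E : Type u) [AddCommGroup E] [Module (DOps K (PowSer K n)) E] :
    Submodule (DOps K (PowSer K n)) E :=
  gammaSubD K (varIdeal K n g) E

lemma map_mem_gammaSubD {A : Type u} [CommRing A] [Algebra K A] {M M' : Type u} [AddCommGroup M]
    [Module (DOps K A) M] [AddCommGroup M'] [Module (DOps K A) M'] (I : Ideal A)
    (f : M →ₗ[DOps K A] M') {m : M} (hm : m ∈ gammaSubD K I M) : f m ∈ gammaSubD K I M' := by
  obtain ⟨t, ht⟩ := hm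
  exact ⟨t, fun a ha => by rw [← map_smul, ht a ha, map_zero]⟩

lemma varIdeal_mono {g g' : ℕ} (h : g ≤ g') : varIdeal K n g ≤ varIdeal K n g' := by
  refine Ideal.span_mono ?_
  rintro _ ⟨i, hi, rfl⟩
  exact ⟨i, by omega, rfl⟩

lemma xOp_pow (i : Fin n) (t : ℕ) : xOp K i ^ t = mulOp K (PowSer K n) (X i ^ t) :=
  (map_pow _ _ _).symm

/-- Torsion can be imposed one variable at a time, which is what allows induction on the number of
variables. -/
lemma mem_tors_succ {i : Fin n} {e : E} :
    e ∈ tors (K := K) (n := n) (i.val + 1) E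
      ↔ e ∈ tors (K := K) (n := n) i.val E ∧ ∃ t, xOp K i ^ t • e = 0 := by
  constructor
  · rintro ⟨t, ht⟩
    refine ⟨⟨t, fun a ha => ht a (Ideal.pow_right_mono (varIdeal_mono (Nat.le_succ _)) t ha)⟩,
      t, ?_⟩
    rw [xOp_pow]
    exact ht _ (Ideal.pow_mem_pow (X_mem_varIdeal (Nat.lt_succ_self _)) t)
  · rintro ⟨⟨s, hs⟩, t, ht⟩
    have h1 : varIdeal K n (i.val + 1) = varIdeal K n i.val ⊔ Ideal.span {X i} := by
      refine le_antisymm (Ideal.span_le.2 ?_)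
        (sup_le (varIdeal_mono (Nat.le_succ _)) (Ideal.span_le.2 ?_))
      · rintro _ ⟨j, hj, rfl⟩
        rcases Nat.lt_succ_iff_lt_or_eq.1 hj with h | h
        · exact Ideal.mem_sup_left (X_mem_varIdeal h)
        · rw [Fin.ext h]
          exact Ideal.mem_sup_right (Ideal.mem_span_singleton_self _)
      · rintro _ rfl
        exact X_mem_varIdeal (Nat.lt_succ_self _)
    refine ⟨s + t, fun a ha => ?_⟩
    rw [h1] at ha
    -- For ideals I and J, the power (I + J)^(s+t) lies in I^s + J^t.
    obtain ⟨b, hb, c, hc, rfl⟩ := Submodule.mem_sup.1 (Ideal.sup_pow_add_le_pow_sup_pow ha)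
    rw [Ideal.span_singleton_pow] at hc
    obtain ⟨c, rfl⟩ := Ideal.mem_span_singleton.1 hc
    rw [xOp_pow] at ht
    rw [map_add, add_smul, hs b hb, zero_add, mul_comm, map_mul, mul_smul, ht, smul_zero]

lemma tors_zero : tors (K := K) (n := n) 0 E = ⊤ := by
  rw [eq_top_iff]
  intro e _
  refine ⟨1, fun a ha => ?_⟩
  rw [varIdeal_zero, pow_one, Ideal.mem_bot] at ha
  rw [ha, map_zero, zero_smul]

/-- Multiplication by `X_(g+1)` is surjective on the `(X_1, …, X_g)`-torsion of an injective
`D`-module. -/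
lemma exists_xOp_smul_eq [CharZero K] (hE : Module.Injective (DOps K (PowSer K n)) E) {i : Fin n}
    {e : E} (he : e ∈ tors (K := K) (n := n) i.val E) :
    ∃ e' ∈ tors (K := K) (n := n) i.val E, xOp K i • e' = e := by
  let : Module (PowSer K n) E := Module.compHom E (mulOp K (PowSer K n)).toRingHom
  have hsm : ∀ (a : PowSer K n) (e : E), mulOp K (PowSer K n) a • e = a • e := fun _ _ => rfl
  have hO := injective_of_injective_DOps hsm hE
  obtain ⟨s, hs⟩ := he
  -- The element e gives a map O/I → E by 1 ↦ e. Extending it along the injective multiplication by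
  -- X_i on O/I produces an element of E, still killed by I, whose product with X_i is e.
  let I := varIdeal K n i.val ^ s
  let f : (PowSer K n ⧸ I) →ₗ[PowSer K n] E :=
    Submodule.liftQ I (LinearMap.toSpanSingleton (PowSer K n) E e) fun a ha => hs a ha
  let m : (PowSer K n ⧸ I) →ₗ[PowSer K n] (PowSer K n ⧸ I) := LinearMap.lsmul _ _ (X i)
  have hm : Function.Injective m := by
    rw [← LinearMap.ker_eq_bot, LinearMap.ker_eq_bot']
    intro y hy
    obtain ⟨y, rfl⟩ := Ideal.Quotient.mk_surjective y
    have hy' : Ideal.Quotient.mk I (X i * y) = 0 := hy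
    rw [Ideal.Quotient.eq_zero_iff_mem] at hy' ⊢
    exact mem_varIdeal_pow_of_X_mul_mem le_rfl hy'
  obtain ⟨F, hF⟩ := hO.out m hm f
  have h1 : ∀ a, F (Ideal.Quotient.mk I a) = a • F (Ideal.Quotient.mk I 1) := fun a => by
    rw [← map_smul]
    congr 1
    change _ = Ideal.Quotient.mk I (a * 1)
    rw [mul_one]
  refine ⟨F (Ideal.Quotient.mk I 1), ⟨s, fun a ha => ?_⟩, ?_⟩
  · rw [hsm, ← h1, Ideal.Quotient.eq_zero_iff_mem.2 ha, map_zero]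
  · rw [xOp, hsm, ← map_smul]
    refine (hF (Ideal.Quotient.mk I 1)).trans ?_
    change (1 : PowSer K n) • e = e
    exact one_smul _ _

end Torsion

/-! ### Induction on the number of variables in an injective resolution. -/

section Chase

variable {E : ℕ → Type u} [∀ i, AddCommGroup (E i)] [∀ i, Module (DOps K (PowSer K n)) (E i)]
  (d : ∀ i, E i →ₗ[DOps K (PowSer K n)] E (i + 1))

/-- The coboundaries of the complex of the `(X_1, …, X_g)`-torsion. -/
def bd (g : ℕ) : ∀ i, Submodule (DOps K (PowSer K n)) (E i)
  | 0 => ⊥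
  | i + 1 => (tors g (E i)).map (d i)

/-- The cocycles of the complex of the `(X_1, …, X_g)`-torsion. -/
def cyc (g i : ℕ) : Submodule (DOps K (PowSer K n)) (E i) := tors g (E i) ⊓ (d i).ker

/-- The local cohomology of the complex with respect to `(X_1, …, X_g)` is concentrated in
degree `g`, where it has a generator as in `IsDeltaGen`. -/
structure IsDeltaComplex (g : ℕ) : Prop where
  cyc_le : ∀ i, i ≠ g → cyc d g i ≤ bd d g i
  exists_gen : ∃ η, IsDeltaClass g (cyc d g g) (bd d g g) η

variable {d}

lemma bd_le_tors (g i : ℕ) : bd d g i ≤ tors g (E i) := by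
  cases i with
  | zero => exact bot_le
  | succ i =>
    rintro _ ⟨e, he, rfl⟩
    exact map_mem_gammaSubD _ _ he

lemma apply_of_mem_bd (hd : ∀ i e, d (i + 1) (d i e) = 0) {g i : ℕ} {e : E i}
    (he : e ∈ bd d g i) : d i e = 0 := by
  cases i with
  | zero =>
    rw [(Submodule.mem_bot _).1 he, map_zero]
  | succ i =>
    obtain ⟨e, _, rfl⟩ := he
    exact hd i e

variable [CharZero K]

lemma exists_pow_smul_eq (hinj : ∀ i, Module.Injective (DOps K (PowSer K n)) (E i)) {j : Fin n}
    (t : ℕ) {i : ℕ} {e : E i} (he : e ∈ tors (K := K) (n := n) j.val (E i)) :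
    ∃ e' ∈ tors (K := K) (n := n) j.val (E i), xOp K j ^ t • e' = e := by
  induction t with
  | zero => exact ⟨e, he, by rw [pow_zero, one_smul]⟩
  | succ t ih =>
    obtain ⟨e', he', rfl⟩ := ih
    obtain ⟨e'', he'', rfl⟩ := exists_xOp_smul_eq (hinj i) he'
    exact ⟨e'', he'', by rw [pow_succ, mul_smul]⟩

/-- Boundaries inherit divisibility from the torsion elements that bound them. -/
lemma exists_pow_smul_eq_of_mem_bd (hinj : ∀ i, Module.Injective (DOps K (PowSer K n)) (E i))
    {j : Fin n} (t : ℕ) {i : ℕ} {e : E i} (he : e ∈ bd d j.val i) :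
    ∃ e' ∈ bd d j.val i, xOp K j ^ t • e' = e := by
  cases i with
  | zero =>
    rw [(Submodule.mem_bot _).1 he]
    exact ⟨0, zero_mem _, smul_zero _⟩
  | succ i =>
    obtain ⟨b, hb, rfl⟩ := he
    obtain ⟨b', hb', rfl⟩ := exists_pow_smul_eq hinj t hb
    exact ⟨d i b', ⟨b', hb', rfl⟩, by rw [map_smul]⟩

/-- Write X for the variable of index j and H for the cohomology of the old torsion complex. A class
of the new complex in degree i + 1 has the form d w, where X^t w is an old cocycle; it stands for
the fraction (X^t w)/X^t in H[1/X] modulo H. Only H in degree j contributes, and there X acts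
injectively. -/
lemma IsDeltaComplex.succ (hinj : ∀ i, Module.Injective (DOps K (PowSer K n)) (E i))
    (hd : ∀ i e, d (i + 1) (d i e) = 0) (j : Fin n) (h : IsDeltaComplex d j.val) :
    IsDeltaComplex d (j.val + 1) := by
  obtain ⟨η, hη⟩ := h.exists_gen
  -- an element that is a torsion cocycle up to the bounding elements
  have tor : ∀ {i : ℕ} {w c : E i} (t : ℕ), w ∈ tors (K := K) (n := n) j.val (E i) →
      c ∈ bd d j.val i → xOp K j ^ t • w = c → d i w ∈ bd d (j.val + 1) (i + 1) := by
    intro i w c t hw hc hwc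
    -- Subtracting a boundary c' with X^t c' = c makes w torsion for X without changing d w.
    obtain ⟨c', hc', rfl⟩ := exists_pow_smul_eq_of_mem_bd hinj t hc
    refine ⟨w - c', mem_tors_succ.2 ⟨sub_mem hw (bd_le_tors _ _ hc'), t, ?_⟩, ?_⟩
    · rw [smul_sub, hwc, sub_self]
    · rw [map_sub, apply_of_mem_bd hd hc', sub_zero]
  have hηt : η ∈ tors (K := K) (n := n) j.val (E j.val) := hη.mem.1
  have hηd : d _ η = 0 := hη.mem.2
  -- Here v plays the role of η/X, and its coboundary is the new generator.
  obtain ⟨v, hv, hxv⟩ := exists_xOp_smul_eq (hinj _) hηt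
  refine ⟨fun i hi z hz => ?_, d _ v, ⟨?_, ?_⟩, ?_, ?_, ?_, ?_⟩
  · obtain ⟨hzt, t, ht⟩ := mem_tors_succ.1 hz.1
    have hzd : d i z = 0 := hz.2
    have hzb : z ∈ bd d j.val i := by
      by_cases hij : i = j.val
      · subst hij
        -- In degree j the class of z vanishes because it is killed by a power of X, which is
        -- injective on cohomology.
        exact hη.mem_of_pow_smul_mem le_rfl t ⟨hzt, hzd⟩ (by rw [ht]; exact zero_mem _)
      · exact h.cyc_le i hij ⟨hzt, hzd⟩
    cases i with
    | zero => exact hzb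
    | succ i =>
      obtain ⟨b, hb, rfl⟩ := hzb
      -- Now z = d b and X^t b is a cocycle in a degree other than j, hence a boundary, so `tor`
      -- applies to b.
      refine tor t hb (h.cyc_le i (by omega) ⟨Submodule.smul_mem _ _ hb, ?_⟩) rfl
      change d i (xOp K j ^ t • b) = 0
      rw [map_smul, ht]
  · refine mem_tors_succ.2 ⟨map_mem_gammaSubD _ _ hv, 1, ?_⟩
    rw [pow_one, ← map_smul, hxv, hηd]
  · exact hd _ _
  -- If d v = d w with w killed by X^t, then v - w is an old cocycle, and η - X(v - w) = Xw is
  -- X-torsion, hence a boundary. This would put the class of η in the image of X.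
  · rintro ⟨w, hw, hwv⟩
    obtain ⟨hwt, t, ht⟩ := mem_tors_succ.1 hw
    have hz : v - w ∈ cyc d j.val j.val := by
      refine ⟨sub_mem hv hwt, ?_⟩
      change d _ (v - w) = 0
      rw [map_sub, hwv, sub_self]
    refine hη.sub_xOp_smul_notMem le_rfl hz ?_
    have hxw : η - xOp K j • (v - w) = xOp K j • w := by
      rw [smul_sub, hxv, sub_sub_cancel]
    refine hη.mem_of_pow_smul_mem le_rfl t (sub_mem hη.mem (Submodule.smul_mem _ _ hz)) ?_
    rw [hxw, ← mul_smul, ← pow_succ, pow_succ', mul_smul, ht, smul_zero]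
    exact zero_mem _
  -- The class of η/X^(t+1) lies in the D-span of that of η/X, by induction from ∂(η/X^(t+1)) =
  -- -(t+1) η/X^(t+2), up to terms of H; division by t + 1 uses characteristic zero.
  · have gen : ∀ (t : ℕ) (w : E j.val), w ∈ tors (K := K) (n := n) j.val (E j.val) →
        xOp K j ^ (t + 1) • w = η →
        ∃ Q : DOps K (PowSer K n), d _ w - Q • d _ v ∈ bd d (j.val + 1) (j.val + 1) := by
      intro t
      induction t with
      | zero =>
        intro w hw hwη
        refine ⟨1, ?_⟩
        rw [one_smul, ← map_sub]
        refine tor 1 (sub_mem hw hv) (zero_mem _) ?_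
        rw [zero_add] at hwη
        rw [smul_sub, hwη, pow_one, hxv, sub_self]
      | succ t ih =>
        intro w hw hwη
        have hxw : xOp K j ^ (t + 1) • xOp K j • w = η := by
          rw [← mul_smul, ← pow_succ, hwη]
        obtain ⟨Q, hQ⟩ := ih _ (Submodule.smul_mem _ _ hw) hxw
        have hcom : xOp K j ^ (t + 2) * dOp K j
            = xOp K j * dOp K j * xOp K j ^ (t + 1)
              - ((t + 1 : ℕ) : DOps K (PowSer K n)) * xOp K j ^ (t + 1) := by
          rw [mul_assoc (xOp K j), xOp_pow _ (t + 1), dOp_mul_mulOp, mul_add,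
            MvPowerSeries.pderiv_pow, pderiv_X_self, mul_one, map_mul, map_natCast,
            Nat.add_sub_cancel, ← xOp_pow, ← xOp_pow, ← mul_assoc (xOp K j), ← pow_succ',
            ← mul_assoc (xOp K j), (Nat.cast_commute (t + 1) (xOp K j)).symm.eq, mul_assoc,
            ← pow_succ', add_sub_cancel_right]
        have h1 : dOp K j • d _ (xOp K j • w)
            + ((t + 1 : ℕ) : DOps K (PowSer K n)) • d _ w
              ∈ bd d (j.val + 1) (j.val + 1) := by
          rw [← map_smul, ← map_smul, ← map_add]
          refine tor (t + 2) (add_mem (Submodule.smul_mem _ _ (Submodule.smul_mem _ _ hw))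
            (Submodule.smul_mem _ _ hw))
            (Submodule.smul_mem _ (xOp K j) (hη.dOp_smul j le_rfl)) ?_
          rw [smul_add, ← mul_smul, hcom, sub_smul, mul_smul (_ * _), hxw, mul_smul _ (_ ^ _), hxw,
            ← mul_smul _ _ w, ((Nat.cast_commute (t + 1) (xOp K j ^ (t + 2))).symm.eq),
            mul_smul _ _ w, hwη, sub_add_cancel, mul_smul]
        have hinv : algebraMap K (DOps K (PowSer K n)) ((t + 1 : ℕ) : K)⁻¹
            * ((t + 1 : ℕ) : DOps K (PowSer K n)) = 1 := by
          rw [← map_natCast (algebraMap K (DOps K (PowSer K n))), ← map_mul,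
            inv_mul_cancel₀ (Nat.cast_ne_zero.2 (Nat.succ_ne_zero t)), map_one]
        refine ⟨-(algebraMap K (DOps K (PowSer K n)) ((t + 1 : ℕ) : K)⁻¹ * dOp K j * Q), ?_⟩
        have h2 := Submodule.smul_mem _
          (algebraMap K (DOps K (PowSer K n)) ((t + 1 : ℕ) : K)⁻¹)
          (sub_mem h1 (Submodule.smul_mem _ (dOp K j) hQ))
        convert h2 using 1
        rw [smul_sub (dOp K j), sub_sub_eq_add_sub, add_sub_right_comm, add_sub_cancel_left,
          smul_add, ← mul_smul _ _ (d _ w), hinv, one_smul, neg_smul, sub_neg_eq_add, mul_smul,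
          mul_smul]
    intro e he
    obtain ⟨w, hw, rfl⟩ := h.cyc_le (j.val + 1) (by omega)
      ⟨(mem_tors_succ.1 he.1).1, he.2⟩
    obtain ⟨t, ht⟩ := (mem_tors_succ.1 he.1).2
    -- The exponent t + 1 is taken so that `gen` applies; X^t already suffices to make this a
    -- cocycle.
    have hz : xOp K j ^ (t + 1) • w ∈ cyc d j.val j.val := by
      refine ⟨Submodule.smul_mem _ _ hw, ?_⟩
      change d _ (xOp K j ^ (t + 1) • w) = 0
      rw [map_smul, pow_succ', mul_smul, ht, smul_zero]
    -- Choosing R to commute with X lets the equation X^(t+1) w = Rη, valid modulo boundaries, be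
    -- divided: w represents R(η/X^(t+1)).
    obtain ⟨R, hR, hRz⟩ := hη.exists_commute le_rfl hz
    obtain ⟨v', hv', hxv'⟩ := exists_pow_smul_eq hinj (t + 1) hηt
    obtain ⟨Q, hQ⟩ := gen t v' hv' hxv'
    have hRp : R * xOp K j ^ (t + 1) = xOp K j ^ (t + 1) * R :=
      ((show Commute R (xOp K j) from hR).pow_right _).eq
    have h1 := tor (t + 1) (sub_mem hw (Submodule.smul_mem _ R hv')) hRz (by
      rw [smul_sub, ← mul_smul, ← hRp, mul_smul, hxv'])
    refine ⟨R * Q, ?_⟩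
    have h2 := add_mem h1 (Submodule.smul_mem _ R hQ)
    rwa [map_sub, map_smul, smul_sub, sub_add_sub_cancel, ← mul_smul] at h2
  · intro i hi
    rcases Nat.lt_succ_iff_lt_or_eq.1 hi with h1 | h1
    · rw [← map_smul]
      refine tor 1 (Submodule.smul_mem _ _ hv) (hη.xOp_smul i h1) ?_
      rw [pow_one, ← mul_smul, (show xOp K j * xOp K i = xOp K i * xOp K j from mulOp_comm _ _),
        mul_smul, hxv]
    · rw [Fin.ext h1, ← map_smul, hxv, hηd]
      exact zero_mem _
  · intro i hi
    rw [← map_smul]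
    refine tor 1 (Submodule.smul_mem _ _ hv) (hη.dOp_smul i (by omega)) ?_
    rw [pow_one, ← mul_smul, ← dOp_mul_xOp_of_ne (fun hc => by rw [hc] at hi; omega), mul_smul, hxv]

/-- For g = 0 every element is torsion, so the cohomology is O in degree zero, generated by 1, which
all derivatives kill. Each further variable is `IsDeltaComplex.succ`. -/
lemma IsDeltaComplex.of_resolution (hinj : ∀ i, Module.Injective (DOps K (PowSer K n)) (E i))
    (hd : ∀ i e, d (i + 1) (d i e) = 0) (hex : ∀ i e, d (i + 1) e = 0 → ∃ e', d i e' = e)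
    (ι : PowSer K n →ₗ[DOps K (PowSer K n)] E 0) (hι : Function.Injective ι)
    (hι0 : ∀ e, d 0 e = 0 ↔ ∃ f, ι f = e) {g : ℕ} (hg : g ≤ n) : IsDeltaComplex d g := by
  induction g with
  | zero =>
    refine ⟨fun i hi z hz => ?_, ι 1, ⟨?_, (hι0 _).2 ⟨1, rfl⟩⟩, ?_, ?_, ?_, ?_⟩
    · cases i with
      | zero => exact absurd rfl hi
      | succ i =>
        obtain ⟨e', rfl⟩ := hex i z hz.2
        exact ⟨e', by rw [tors_zero]; trivial, rfl⟩
    · rw [tors_zero]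
      trivial
    · intro h
      have h0 : ι 1 = 0 := h
      rw [← map_zero ι] at h0
      exact one_ne_zero (hι h0)
    · intro z hz
      obtain ⟨f, rfl⟩ := (hι0 z).1 hz.2
      refine ⟨mulOp K (PowSer K n) f, ?_⟩
      rw [← map_smul, mulOp_smul, mul_one, sub_self]
      exact zero_mem _
    · intro i hi
      omega
    · intro i _
      rw [← map_smul, PowSer.dOp_smul, MvPowerSeries.pderiv_one, map_zero]
      exact zero_mem _
  | succ g ih => exact IsDeltaComplex.succ hinj hd ⟨g, by omega⟩ (ih (by omega))

end Chase

end PowSer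

/-! ## Comparison of local cohomology over `D` and over `O` -/

namespace PowSer

/-! ### Restriction of scalars from D to A and derived torsion functors. -/

section General

open HomologicalComplex

variable {K A : Type u} [CommRing K] [CommRing A] [Algebra K A]

variable (K A) in
/-- Restriction of scalars from `D` to `A`. -/
abbrev resD : ModuleCat.{u} (DOps K A) ⥤ ModuleCat.{u} A :=
  ModuleCat.restrictScalars (mulOp K A).toRingHom

instance : Limits.PreservesFiniteLimits (resD K A) :=
  ⟨fun _ _ _ => ⟨fun {F} => by
    have : Small.{u} (F ⋙ forget _).sections := inferInstance
    infer_instance⟩⟩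

/-- `Γ_I` commutes with restriction of scalars from `D` to `A`. -/
def gammaResIso (I : Ideal A) (M : ModuleCat.{u} (DOps K A)) :
    (gammaFunctor I).obj ((resD K A).obj M) ≅ (resD K A).obj ((gammaFunctorD K I).obj M) where
  hom := ModuleCat.ofHom
    (Y := (resD K A).obj ((gammaFunctorD K I).obj M))
    { toFun := fun x => (⟨x.1, x.2⟩ : gammaSubD K I M)
      map_add' := fun _ _ => rfl
      map_smul' := fun _ _ => rfl }
  inv := ModuleCat.ofHom
    (X := (resD K A).obj ((gammaFunctorD K I).obj M))
    { toFun := fun x : gammaSubD K I M => (⟨x.1, x.2⟩ : gammaSub I ((resD K A).obj M))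
      map_add' := fun _ _ => rfl
      map_smul' := fun _ _ => rfl }

/-- `Γ_I` commutes with restriction of scalars, on complexes. -/
def gammaResComplexIso (I : Ideal A) (C : CochainComplex (ModuleCat.{u} (DOps K A)) ℕ) :
    ((gammaFunctor I).mapHomologicalComplex _).obj (((resD K A).mapHomologicalComplex _).obj C) ≅
      ((resD K A).mapHomologicalComplex _).obj
        (((gammaFunctorD K I).mapHomologicalComplex _).obj C) :=
  HomologicalComplex.Hom.isoOfComponents (fun i => gammaResIso I (C.X i)) (fun _ _ _ => rfl)

/-- The `D`-linear inclusion `Γ_I → Γ_J` for `J ⊆ I`. -/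
def gammaInclD {I J : Ideal A} (h : J ≤ I) : gammaFunctorD K I ⟶ gammaFunctorD K J where
  app M := ModuleCat.ofHom (Submodule.inclusion (p := gammaSubD K I M) (p' := gammaSubD K J M)
    (fun _ ⟨t, ht⟩ => ⟨t, fun a ha => ht a (Ideal.pow_right_mono h t ha)⟩))

lemma gammaResComplexIso_hom_incl {I J : Ideal A} (h : J ≤ I)
    (C : CochainComplex (ModuleCat.{u} (DOps K A)) ℕ) :
    (gammaResComplexIso I C).hom ≫ ((resD K A).mapHomologicalComplex _).map
        ((NatTrans.mapHomologicalComplex (gammaInclD h) _).app C) =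
      (NatTrans.mapHomologicalComplex (gammaIncl h) _).app _ ≫ (gammaResComplexIso J C).hom :=
  rfl

/-- An injective resolution over `D` restricts to one over `A` if injective `D`-modules are
injective over `A`. -/
def resInjectiveResolution
    (hinj : ∀ M : ModuleCat.{u} (DOps K A), Injective M → Injective ((resD K A).obj M))
    {M : ModuleCat.{u} (DOps K A)} (I : InjectiveResolution M) {N : ModuleCat.{u} A}
    (e : N ≅ (resD K A).obj M) : InjectiveResolution N where
  cocomplex := ((resD K A).mapHomologicalComplex _).obj I.cocomplex
  injective i := hinj _ (I.injective i)
  ι := (CochainComplex.single₀ _).map e.hom ≫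
    (singleMapHomologicalComplex (resD K A) (ComplexShape.up ℕ) 0).inv.app M ≫
      ((resD K A).mapHomologicalComplex _).map I.ι
  quasiIso := by
    have : QuasiIso I.ι := I.quasiIso
    infer_instance

/-- Homology commutes with restriction of scalars. -/
def homologyResIso (C : CochainComplex (ModuleCat.{u} (DOps K A)) ℕ) (i : ℕ) :
    (homologyFunctor _ _ i).obj (((resD K A).mapHomologicalComplex _).obj C) ≅
      (resD K A).obj ((homologyFunctor _ _ i).obj C) :=
  (C.sc i).mapHomologyIso (resD K A)

lemma homologyResIso_hom_naturality {C C' : CochainComplex (ModuleCat.{u} (DOps K A)) ℕ}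
    (f : C ⟶ C') (i : ℕ) :
    (homologyFunctor _ _ i).map (((resD K A).mapHomologicalComplex _).map f) ≫
        (homologyResIso C' i).hom =
      (homologyResIso C i).hom ≫ (resD K A).map ((homologyFunctor _ _ i).map f) :=
  ShortComplex.mapHomologyIso_hom_naturality ((shortComplexFunctor _ _ i).map f) (resD K A)

variable (hinj : ∀ M : ModuleCat.{u} (DOps K A), Injective M → Injective ((resD K A).obj M))
  {M : ModuleCat.{u} (DOps K A)} (R : InjectiveResolution M) {N : ModuleCat.{u} A}
  (e : N ≅ (resD K A).obj M)

/-- Local cohomology over `A` from an injective resolution over `D`. -/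
def localCohIsoHomology (I : Ideal A) (i : ℕ) :
    (localCoh I i).obj N ≅ (resD K A).obj ((homologyFunctor _ _ i).obj
      (((gammaFunctorD K I).mapHomologicalComplex _).obj R.cocomplex)) :=
  (resInjectiveResolution hinj R e).isoRightDerivedObj (gammaFunctor I) i ≪≫
    (homologyFunctor _ _ i).mapIso (gammaResComplexIso I R.cocomplex) ≪≫
      homologyResIso _ i

lemma comp_eq_of_squares {C : Type*} [Category C] {T T' X X' Y Y' Z Z' : C} {θ : T ⟶ T'}
    {a : T ⟶ X} (a' : T' ≅ X') {b : X ⟶ X'} {c : X ⟶ Y} {c' : X' ⟶ Y'} {d : Y ⟶ Y'}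
    {r : Y ⟶ Z} {r' : Y' ⟶ Z'} {s : Z ⟶ Z'} (h1 : θ = a ≫ b ≫ a'.inv) (h2 : c ≫ d = b ≫ c')
    (h3 : d ≫ r' = r ≫ s) : θ ≫ a'.hom ≫ c' ≫ r' = (a ≫ c ≫ r) ≫ s := by
  subst h1
  simp only [Category.assoc, Iso.inv_hom_id_assoc, ← h3]
  rw [reassoc_of% h2]

/-- Computed on a single resolution over D, the natural map is the restriction of a D-linear map.
This gives access to simplicity over D. -/
lemma thetaMap_comp_localCohIsoHomology {I J : Ideal A} (h : J ≤ I) (i : ℕ) :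
    thetaMap h i N ≫ (localCohIsoHomology hinj R e J i).hom =
      (localCohIsoHomology hinj R e I i).hom ≫ (resD K A).map ((homologyFunctor _ _ i).map
        ((NatTrans.mapHomologicalComplex (gammaInclD h) _).app R.cocomplex)) := by
  have h1 := InjectiveResolution.rightDerived_app_eq (gammaIncl h)
    (resInjectiveResolution hinj R e) i
  have h2 := homologyResIso_hom_naturality
    ((NatTrans.mapHomologicalComplex (gammaInclD h) _).app R.cocomplex) i
  have h3 := congrArg (homologyFunctor _ _ i).map (gammaResComplexIso_hom_incl h R.cocomplex)
  rw [Functor.map_comp, Functor.map_comp] at h3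
  exact comp_eq_of_squares _ h1 h3 h2

end General

/-! ### Local cohomology of O: the generator and the natural map. -/

section PowerSeries

variable {K : Type u} [Field K] {n g : ℕ}

/-- The torsion complex of a complex of `D`-modules. -/
abbrev torsComplex (C : CochainComplex (ModuleCat.{u} (DOps K (PowSer K n))) ℕ) (g : ℕ) :
    CochainComplex (ModuleCat.{u} (DOps K (PowSer K n))) ℕ :=
  ((gammaFunctorD K (varIdeal K n g)).mapHomologicalComplex _).obj C

/-- The homology in degree `i` of a cochain complex of `D`-modules. -/
abbrev homologyD (C : CochainComplex (ModuleCat.{u} (DOps K (PowSer K n))) ℕ) (i : ℕ) :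
    ModuleCat.{u} (DOps K (PowSer K n)) :=
  (HomologicalComplex.homologyFunctor _ _ i).obj C

/-- The differentials of a cochain complex of `D`-modules. -/
abbrev diffHom (C : CochainComplex (ModuleCat.{u} (DOps K (PowSer K n))) ℕ) (i : ℕ) :
    C.X i →ₗ[DOps K (PowSer K n)] C.X (i + 1) := (C.d i (i + 1)).hom

lemma torsComplex_d_eq_zero_iff (C : CochainComplex (ModuleCat.{u} (DOps K (PowSer K n))) ℕ)
    {i j : ℕ} (hj : j = i + 1) (y : tors g (C.X i)) :
    ((torsComplex C g).d i j).hom y = 0 ↔ diffHom C i y = 0 := by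
  subst hj
  exact Subtype.ext_iff

lemma exists_torsComplex_d_eq_iff (C : CochainComplex (ModuleCat.{u} (DOps K (PowSer K n))) ℕ)
    {i j : ℕ} (hj : j = (ComplexShape.up ℕ).prev i) (y : tors g (C.X i)) :
    (∃ x, ((torsComplex C g).d j i).hom x = y) ↔ (y : C.X i) ∈ bd (diffHom C) g i := by
  cases i with
  | zero =>
    -- In degree zero `prev` takes its default value 0, so the incoming differential vanishes, in
    -- agreement with `bd` in degree zero.
    rw [HomologicalComplex.shape _ _ _ (by simp)]
    change (∃ x, 0 = y) ↔ y.1 ∈ (⊥ : Submodule _ _)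
    rw [Submodule.mem_bot]
    constructor
    · rintro ⟨_, rfl⟩
      rfl
    · intro h
      exact ⟨0, Subtype.ext h.symm⟩
  | succ i =>
    rw [CochainComplex.prev_nat_succ] at hj
    subst hj
    constructor
    · rintro ⟨x, rfl⟩
      exact ⟨x.1, x.2, rfl⟩
    · rintro ⟨x, hx, hxy⟩
      exact ⟨⟨x, hx⟩, Subtype.ext hxy⟩

lemma exists_isDeltaGen_of_isDeltaComplex
    {C : CochainComplex (ModuleCat.{u} (DOps K (PowSer K n))) ℕ}
    (h : IsDeltaComplex (diffHom C) g) :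
    ∃ η : homologyD (torsComplex C g) g, IsDeltaGen K n g η := by
  obtain ⟨η, hη⟩ := h.exists_gen
  let S := (torsComplex C g).sc g
  let q : cyc (diffHom C) g g →ₗ[DOps K (PowSer K n)] S.moduleCatLeftHomologyData.H :=
    (LinearMap.range S.moduleCatToCycles).mkQ.comp
      (LinearMap.codRestrict (LinearMap.ker S.g.hom)
        (Submodule.inclusion (inf_le_left : cyc (diffHom C) g g ≤ tors g (C.X g)))
        fun z => (torsComplex_d_eq_zero_iff C (by simp) _).2 z.2.2)
  have hq : Function.Surjective q := by
    intro x
    obtain ⟨⟨⟨z, hz⟩, hz'⟩, rfl⟩ := Submodule.mkQ_surjective _ x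
    exact ⟨⟨z, hz, (torsComplex_d_eq_zero_iff C (by simp) ⟨z, hz⟩).1 hz'⟩, rfl⟩
  have hker : ∀ z, q z = 0 ↔ (z : C.X g) ∈ bd (diffHom C) g g := by
    intro z
    rw [← exists_torsComplex_d_eq_iff C rfl ⟨z.1, z.2.1⟩]
    refine (Submodule.Quotient.mk_eq_zero _).trans ?_
    refine exists_congr fun x => ?_
    exact Subtype.ext_iff
  exact ⟨_, (hη.isDeltaGen_of_surjective q hq hker).map S.moduleCatHomologyIso.symm.toLinearEquiv⟩

variable [CharZero K]

lemma isDeltaComplex_injectiveResolution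
    (R : InjectiveResolution (ModuleCat.of (DOps K (PowSer K n)) (PowSer K n))) (hg : g ≤ n) :
    IsDeltaComplex (diffHom R.cocomplex) g := by
  have hex0 : (ShortComplex.mk _ _ R.ι_f_zero_comp_complex_d).Exact :=
    ShortComplex.exact_of_f_is_kernel _ R.isLimitKernelFork
  refine IsDeltaComplex.of_resolution
    (fun i => ?_) ?_ ?_ (R.ι.f 0).hom ?_ ?_ hg
  · have := R.injective i
    exact Module.injective_module_of_injective_object _ _
  · intro i e
    exact (ShortComplex.mk _ _ (R.complex_d_comp i)).moduleCat_zero_apply e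
  · intro i e he
    exact (ShortComplex.moduleCat_exact_iff _).1 (R.exact_succ i) e he
  · exact (ModuleCat.mono_iff_injective _).1 inferInstance
  · intro e
    refine ⟨fun he => (ShortComplex.moduleCat_exact_iff _).1 hex0 e he, ?_⟩
    rintro ⟨f, rfl⟩
    exact (ShortComplex.mk _ _ R.ι_f_zero_comp_complex_d).moduleCat_zero_apply f

lemma exists_isDeltaGen_localCohD (hg : g ≤ n) :
    ∃ η : (localCohD K (varIdeal K n g) g).obj
      (ModuleCat.of (DOps K (PowSer K n)) (PowSer K n)), IsDeltaGen K n g η := by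
  let R := injectiveResolution (ModuleCat.of (DOps K (PowSer K n)) (PowSer K n))
  obtain ⟨η, hη⟩ := exists_isDeltaGen_of_isDeltaComplex (isDeltaComplex_injectiveResolution R hg)
  exact ⟨_, hη.map (R.isoRightDerivedObj (gammaFunctorD K (varIdeal K n g)) g).symm.toLinearEquiv⟩

lemma injective_resD_obj (M : ModuleCat.{u} (DOps K (PowSer K n))) (hM : Injective M) :
    Injective ((resD K (PowSer K n)).obj M) := by
  have h1 : Module.Injective (DOps K (PowSer K n)) M :=
    Module.injective_module_of_injective_object _ _
  let := Module.compHom M (mulOp K (PowSer K n)).toRingHom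
  have h2 : Module.Injective (PowSer K n) M :=
    injective_of_injective_DOps (fun _ _ => rfl) h1
  exact Module.injective_object_of_injective_module (PowSer K n) M

variable (K n) in
/-- The `D`-module `O` restricts to the `O`-module `O`. -/
def resSelfIso : ModuleCat.of (PowSer K n) (PowSer K n) ≅
    (resD K (PowSer K n)).obj (ModuleCat.of (DOps K (PowSer K n)) (PowSer K n)) :=
  { hom := ModuleCat.ofHom (X := PowSer K n) (Y := (resD K (PowSer K n)).obj
      (ModuleCat.of (DOps K (PowSer K n)) (PowSer K n)))
      { toFun := fun f => f
        map_add' := fun _ _ => rfl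
        map_smul' := fun _ _ => rfl }
    inv := ModuleCat.ofHom (Y := PowSer K n) (X := (resD K (PowSer K n)).obj
      (ModuleCat.of (DOps K (PowSer K n)) (PowSer K n)))
      { toFun := fun f => f
        map_add' := fun _ _ => rfl
        map_smul' := fun _ _ => rfl } }

lemma nonempty_resD_localCohD_iso (I : Ideal (PowSer K n)) (i : ℕ) :
    Nonempty ((resD K (PowSer K n)).obj ((localCohD K I i).obj
      (ModuleCat.of (DOps K (PowSer K n)) (PowSer K n))) ≅
      (localCoh I i).obj (ModuleCat.of (PowSer K n) (PowSer K n))) := by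
  let R := injectiveResolution (ModuleCat.of (DOps K (PowSer K n)) (PowSer K n))
  exact ⟨(resD K (PowSer K n)).mapIso (R.isoRightDerivedObj (gammaFunctorD K I) i) ≪≫
    (localCohIsoHomology injective_resD_obj R (resSelfIso K n) I i).symm⟩

/-- Up to isomorphism the natural map is D-linear with simple source, so it is injective or zero.
Its image is accordingly a copy of Dη or trivial. -/
lemma associatedPrimes_range_thetaMap (hg : g ≤ n) {J : Ideal (PowSer K n)}
    (hJ : J ≤ varIdeal K n g) :
    associatedPrimes (PowSer K n)
        (thetaMap hJ g (ModuleCat.of (PowSer K n) (PowSer K n))).hom.range = ∅ ∨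
      associatedPrimes (PowSer K n)
        (thetaMap hJ g (ModuleCat.of (PowSer K n) (PowSer K n))).hom.range = {varIdeal K n g} := by
  let R := injectiveResolution (ModuleCat.of (DOps K (PowSer K n)) (PowSer K n))
  obtain ⟨η, hη⟩ := exists_isDeltaGen_of_isDeltaComplex (isDeltaComplex_injectiveResolution R hg)
  have hθ := thetaMap_comp_localCohIsoHomology injective_resD_obj R (resSelfIso K n) hJ g
  set θ := thetaMap hJ g (ModuleCat.of (PowSer K n) (PowSer K n))
  set a := localCohIsoHomology injective_resD_obj R (resSelfIso K n) (varIdeal K n g) g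
  set b := localCohIsoHomology injective_resD_obj R (resSelfIso K n) J g
  set ψ := (HomologicalComplex.homologyFunctor _ _ g).map
    ((NatTrans.mapHomologicalComplex (gammaInclD (K := K) hJ) (ComplexShape.up ℕ)).app R.cocomplex)
  have hθ' : ∀ x, b.hom.hom (θ.hom x) = ψ.hom (a.hom.hom x) := fun x =>
    congrArg (fun f => ModuleCat.Hom.hom f x) hθ
  have := hη.isSimpleModule
  rcases LinearMap.injective_or_eq_zero ψ.hom with h | h
  · right
    have hinj : Function.Injective θ.hom := by
      intro x y hxy
      have h1 := congrArg b.hom.hom hxy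
      rw [hθ', hθ'] at h1
      exact a.toLinearEquiv.injective (h h1)
    rw [← LinearEquiv.AssociatedPrimes.eq (LinearEquiv.ofInjective θ.hom hinj),
      LinearEquiv.AssociatedPrimes.eq a.toLinearEquiv]
    let := Module.compHom (homologyD (torsComplex R.cocomplex g) g)
      (mulOp K (PowSer K n)).toRingHom
    exact hη.associatedPrimes (fun _ _ => rfl)
  · left
    have h0 : θ.hom = 0 := by
      ext x
      refine b.toLinearEquiv.injective ?_
      refine (hθ' x).trans ?_
      rw [LinearMap.zero_apply, map_zero]
      exact congrArg (fun f => f (a.hom.hom x)) h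
    rw [h0, LinearMap.range_zero]
    exact associatedPrimes.eq_empty_of_subsingleton

omit [CharZero K] in
lemma varIdeal_self_ne (hg : g < n) : varIdeal K n n ≠ varIdeal K n g := fun h =>
  X_notMem_varIdeal (K := K) (i := ⟨g, hg⟩) le_rfl (h ▸ X_mem_varIdeal (i := ⟨g, hg⟩) hg)

end PowerSeries

end PowSer

/-! ## The Hilbert-Samuel function of the power series ring -/

namespace PowSer

open MvPowerSeries

variable {K : Type u} [Field K] {n : ℕ}

/-- The number of monomials of degree `< t` in `n` variables. -/
def hilb (n t : ℕ) : ℕ := ∑ s ∈ Finset.range t, n.multichoose s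

/-- Turns the count of monomials into a rising factorial with leading term t^n, from which the limit
is immediate. -/
lemma factorial_mul_hilb_succ (n k : ℕ) :
    n.factorial * hilb n (k + 1) = (k + 1).ascFactorial n := by
  rw [hilb, Nat.sum_range_multichoose, Nat.ascFactorial_eq_factorial_mul_choose, add_comm]

lemma tendsto_ascFactorial_div (n : ℕ) :
    Filter.Tendsto (fun t : ℕ => (t.ascFactorial n : ℝ) / (t : ℝ) ^ n) Filter.atTop (nhds 1) := by
  induction n with
  | zero => simp
  | succ n ih =>
    have h1 : Filter.Tendsto (fun t : ℕ => 1 + (n : ℝ) / (t : ℝ)) Filter.atTop (nhds (1 + 0)) :=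
      tendsto_const_nhds.add (tendsto_const_div_atTop_nhds_zero_nat _)
    have h2 := h1.mul ih
    rw [add_zero, one_mul] at h2
    refine h2.congr' ?_
    filter_upwards [Filter.eventually_gt_atTop 0] with t ht
    have : (t : ℝ) ≠ 0 := by positivity
    rw [Nat.ascFactorial_succ, pow_succ]
    push_cast
    field_simp

lemma tendsto_hilb (n : ℕ) :
    Filter.Tendsto (fun t : ℕ => ((n.factorial * hilb n t : ℕ) : ℝ) / (t : ℝ) ^ n)
      Filter.atTop (nhds 1) := by
  refine (tendsto_ascFactorial_div n).congr' ?_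
  filter_upwards [Filter.eventually_gt_atTop 0] with t ht
  obtain ⟨k, rfl⟩ := Nat.exists_eq_add_of_lt ht
  rw [zero_add, factorial_mul_hilb_succ]

lemma tendsto_hilb_sub (n c : ℕ) :
    Filter.Tendsto (fun t : ℕ => ((n.factorial * hilb n (t - c) : ℕ) : ℝ) / (t : ℝ) ^ n)
      Filter.atTop (nhds 1) := by
  have h1 := (tendsto_hilb n).comp (Filter.tendsto_sub_atTop_nat c)
  have h2 : Filter.Tendsto (fun t : ℕ => (1 - (c : ℝ) / (t : ℝ)) ^ n) Filter.atTop
      (nhds ((1 - 0) ^ n)) :=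
    (tendsto_const_nhds.sub (tendsto_const_div_atTop_nhds_zero_nat _)).pow n
  have h3 := h1.mul h2
  rw [sub_zero, one_pow, one_mul] at h3
  refine h3.congr' ?_
  filter_upwards [Filter.eventually_gt_atTop c] with t ht
  have h4 : (t : ℝ) ≠ 0 := by
    have : 0 < t := by omega
    positivity
  have h5 : ((t : ℝ) - c) ≠ 0 := by
    rw [sub_ne_zero]
    exact_mod_cast ht.ne'
  simp only [Function.comp_apply]
  rw [Nat.cast_sub ht.le, one_sub_div h4, div_pow]
  have h6 : ((t : ℝ) - c) ^ n ≠ 0 := pow_ne_zero _ h5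
  field_simp

/-- A squeeze: a t lies between `hilb n (t - c)` and `hilb n t` plus r times the difference of
these, and the difference is negligible against t^n. The second bound is written additively to avoid
truncated subtraction. -/
lemma tendsto_factorial_mul_div {a : ℕ → ℕ} {r c : ℕ} (h₁ : ∀ t, hilb n (t - c) ≤ a t)
    (h₂ : ∀ t, a t + r * hilb n (t - c) ≤ hilb n t + r * hilb n t) :
    Filter.Tendsto (fun t => ((n.factorial * a t : ℕ) : ℝ) / (t : ℝ) ^ n) Filter.atTop (nhds 1) := by
  have hu : Filter.Tendsto (fun t : ℕ =>
      (1 + r) * (((n.factorial * hilb n t : ℕ) : ℝ) / (t : ℝ) ^ n) -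
        r * (((n.factorial * hilb n (t - c) : ℕ) : ℝ) / (t : ℝ) ^ n))
      Filter.atTop (nhds ((1 + r) * 1 - r * 1)) :=
    (tendsto_const_nhds.mul (tendsto_hilb n)).sub (tendsto_const_nhds.mul (tendsto_hilb_sub n c))
  rw [show ((1 + r) * 1 - r * 1 : ℝ) = 1 by ring] at hu
  refine tendsto_of_tendsto_of_tendsto_of_le_of_le (tendsto_hilb_sub n c) hu (fun t => ?_)
    fun t => ?_
  · have := h₁ t
    gcongr
  · have h3 : (a t : ℝ) + r * hilb n (t - c) ≤ hilb n t + r * hilb n t := by exact_mod_cast h₂ t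
    have h4 : (1 + r) * (((n.factorial * hilb n t : ℕ) : ℝ) / (t : ℝ) ^ n) -
        r * (((n.factorial * hilb n (t - c) : ℕ) : ℝ) / (t : ℝ) ^ n) =
        (n.factorial * ((1 + r) * hilb n t - r * hilb n (t - c)) : ℝ) / (t : ℝ) ^ n := by
      push_cast
      ring
    dsimp only
    rw [h4]
    push_cast
    gcongr
    linarith

lemma mem_maximalIdeal_pow {t : ℕ} {f : PowSer K n} :
    f ∈ IsLocalRing.maximalIdeal (PowSer K n) ^ t ↔ ∀ α, α.degree < t → coeff α f = 0 := by
  rw [maximalIdeal_eq, mem_varIdeal_pow]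
  simp only [wt_eq_degree]

lemma mem_maximalIdeal_pow_iff_le_order {t : ℕ} {f : PowSer K n} :
    f ∈ IsLocalRing.maximalIdeal (PowSer K n) ^ t ↔ t ≤ f.order := by
  rw [mem_maximalIdeal_pow]
  refine ⟨nat_le_order, fun h α hα => coeff_of_lt_order (lt_of_lt_of_le ?_ h)⟩
  exact_mod_cast hα

/-- The constant c is the order of f, and orders of power series over a field add under
multiplication. -/
lemma exists_mul_mem_maximalIdeal_pow {f : PowSer K n} (hf : f ≠ 0) :
    ∃ c : ℕ, ∀ t b, f * b ∈ IsLocalRing.maximalIdeal (PowSer K n) ^ t →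
      b ∈ IsLocalRing.maximalIdeal (PowSer K n) ^ (t - c) := by
  obtain ⟨c, hc⟩ := ENat.ne_top_iff_exists.1 (mt order_eq_top_iff.1 hf)
  refine ⟨c, fun t b h => ?_⟩
  rw [mem_maximalIdeal_pow_iff_le_order] at h ⊢
  rw [order_mul, ← hc] at h
  rw [ENat.natCast_sub]
  exact tsub_le_iff_left.2 h

/-- The coefficients of degree `t` of an element of `m ^ t`, modulo `m`. -/
def leadingCoeffs (K : Type u) [Field K] (n t : ℕ) :
    ↥(IsLocalRing.maximalIdeal (PowSer K n) ^ t) →ₗ[PowSer K n]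
      (Finset.finsuppAntidiag (Finset.univ : Finset (Fin n)) t →
        PowSer K n ⧸ IsLocalRing.maximalIdeal (PowSer K n)) where
  toFun f α := Ideal.Quotient.mk _ (C (coeff α.1 f.1))
  map_add' f f' := by
    ext α
    simp
  map_smul' a f := by
    classical
    ext α
    have hα : α.1.degree = t := by
      rw [Finsupp.degree_eq_sum]
      exact (Finset.mem_finsuppAntidiag.1 α.2).1
    -- On terms of lowest possible degree t, only the constant term of a contributes.
    have h1 : coeff α.1 (a * f.1) = constantCoeff a * coeff α.1 f.1 := by
      rw [coeff_mul, Finset.sum_eq_single (0, α.1)]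
      · rfl
      · rintro ⟨β, γ⟩ h hne
        rw [Finset.HasAntidiagonal.mem_antidiagonal] at h
        dsimp only at h ⊢
        rw [mem_maximalIdeal_pow.1 f.2 γ, mul_zero]
        rw [← hα, ← h, map_add]
        refine Nat.lt_add_of_pos_left (Nat.pos_of_ne_zero fun h0 => hne ?_)
        rw [Finsupp.degree_eq_zero_iff] at h0
        rw [h0, zero_add] at h
        rw [h0, h]
      · intro h
        exact absurd (Finset.HasAntidiagonal.mem_antidiagonal.2 (zero_add _)) h
    rw [RingHom.id_apply, Submodule.coe_smul, smul_eq_mul, h1, Pi.smul_apply, map_mul, map_mul,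
      ← smul_eq_mul (Ideal.Quotient.mk _ _), Algebra.smul_def]
    congr 1
    rw [Ideal.Quotient.algebraMap_eq, Ideal.Quotient.eq, ← neg_sub, neg_mem_iff, maximalIdeal_eq]
    exact sub_C_mem a

lemma leadingCoeffs_surjective (t : ℕ) : Function.Surjective (leadingCoeffs K n t) := by
  classical
  intro v
  choose w hw using fun α => Ideal.Quotient.mk_surjective (v α)
  let f : PowSer K n := fun α =>
    if h : α ∈ Finset.finsuppAntidiag (Finset.univ : Finset (Fin n)) t then
      constantCoeff (w ⟨α, h⟩) else 0
  refine ⟨⟨f, ?_⟩, ?_⟩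
  · rw [mem_maximalIdeal_pow]
    intro α hα
    refine dif_neg fun h => hα.ne ?_
    rw [Finsupp.degree_eq_sum]
    exact (Finset.mem_finsuppAntidiag.1 h).1
  · ext α
    have h1 : coeff α.1 f = constantCoeff (w α) := dif_pos α.2
    change Ideal.Quotient.mk _ (C (coeff α.1 f)) = _
    rw [h1, ← hw, Ideal.Quotient.eq, ← neg_sub, neg_mem_iff, maximalIdeal_eq]
    exact sub_C_mem _

lemma mem_ker_leadingCoeffs {t : ℕ} {f : ↥(IsLocalRing.maximalIdeal (PowSer K n) ^ t)} :
    leadingCoeffs K n t f = 0 ↔ (f : PowSer K n) ∈ IsLocalRing.maximalIdeal (PowSer K n) ^ (t + 1) := by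
  rw [mem_maximalIdeal_pow]
  constructor
  · intro h α hα
    rcases Nat.lt_succ_iff_lt_or_eq.1 hα with h1 | h1
    · exact mem_maximalIdeal_pow.1 f.2 α h1
    · have h2 := congrFun h ⟨α, Finset.mem_finsuppAntidiag.2
        ⟨by rw [← h1, Finsupp.degree_eq_sum], Finset.subset_univ _⟩⟩
      have h3 : (C (coeff α f.1) : PowSer K n) ∈ IsLocalRing.maximalIdeal (PowSer K n) :=
        Ideal.Quotient.eq_zero_iff_mem.1 h2
      have h4 := maximalIdeal_eq.le h3
      rwa [mem_varIdeal_self, constantCoeff_C] at h4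
  · intro h
    ext α
    change Ideal.Quotient.mk _ (C (coeff α.1 f.1)) = 0
    rw [h, map_zero, map_zero]
    refine Nat.lt_succ_of_le (le_of_eq ?_)
    rw [Finsupp.degree_eq_sum]
    exact (Finset.mem_finsuppAntidiag.1 α.2).1

/-- Each layer m^t/m^(t+1) is a sum of copies of the residue field indexed by the monomials of
degree t. -/
lemma length_quotient_maximalIdeal_pow (t : ℕ) :
    Module.length (PowSer K n) (PowSer K n ⧸ IsLocalRing.maximalIdeal (PowSer K n) ^ t)
      = hilb n t := by
  set m := IsLocalRing.maximalIdeal (PowSer K n)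
  induction t with
  | zero =>
    rw [pow_zero, Ideal.one_eq_top, hilb, Finset.sum_range_zero, Nat.cast_zero,
      Module.length_eq_zero_iff]
    infer_instance
  | succ t ih =>
    have hle : m ^ (t + 1) ≤ m ^ t := Ideal.pow_le_pow_right (Nat.le_succ t)
    let f : ↥(m ^ t) →ₗ[PowSer K n] PowSer K n ⧸ m ^ (t + 1) :=
      (m ^ (t + 1)).mkQ.comp (m ^ t).subtype
    let p : (PowSer K n ⧸ m ^ (t + 1)) →ₗ[PowSer K n] PowSer K n ⧸ m ^ t :=
      Submodule.factor hle
    have h1 := Module.length_eq_add_of_exact (Submodule.subtype (LinearMap.ker p)) p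
      (Submodule.subtype_injective _) (Submodule.factor_surjective hle)
      (LinearMap.exact_subtype_ker_map p)
    have hrange : LinearMap.range f = LinearMap.ker p := by
      ext x
      obtain ⟨x, rfl⟩ := Submodule.mkQ_surjective _ x
      constructor
      · rintro ⟨y, hy⟩
        rw [← hy]
        exact (Submodule.Quotient.mk_eq_zero _).2 y.2
      · intro hx
        exact ⟨⟨x, (Submodule.Quotient.mk_eq_zero _).1 hx⟩, rfl⟩
    have hker : LinearMap.ker f = LinearMap.ker (leadingCoeffs K n t) := by
      ext x
      rw [LinearMap.mem_ker, LinearMap.mem_ker, mem_ker_leadingCoeffs]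
      exact Submodule.Quotient.mk_eq_zero _
    have h2 : Module.length (PowSer K n) (LinearMap.ker p) = n.multichoose t := by
      rw [← hrange, ← f.quotKerEquivRange.length_eq,
        (Submodule.quotEquivOfEq _ _ hker).length_eq,
        ((leadingCoeffs K n t).quotKerEquivOfSurjective (leadingCoeffs_surjective t)).length_eq,
        Module.length_pi, Module.length_eq_one_iff.2 (by
          rw [isSimpleModule_iff_isCoatom]
          exact Ideal.isMaximal_def.1 inferInstance), mul_one, ENat.card_eq_coe_fintype_card, Fintype.card_coe,
        Finset.card_finsuppAntidiag_nat_eq_multichoose, Finset.card_fin]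
    rw [h1, h2, ih, hilb, hilb, Finset.sum_range_succ, Nat.cast_add, add_comm]

end PowSer

/-! ## Generically cyclic modules and their multiplicity -/

section GenericallyCyclic

variable {R N N' : Type*} [CommRing R] [AddCommGroup N] [Module R N] [AddCommGroup N'] [Module R N']

/-- `N` is killed by a power of `q`, and up to a module killed by an element outside `q` it is
isomorphic to `R ⧸ q`. -/
structure IsGenericallyCyclic (q : Ideal R) (N : Type*) [AddCommGroup N] [Module R N] : Prop where
  exists_generator : ∃ (x : N) (f : R), (∀ r : R, r • x = 0 ↔ r ∈ q) ∧ f ∉ q ∧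
    ∀ z : N, ∃ r : R, f • z = r • x
  exists_pow : ∃ k : ℕ, ∀ r ∈ q ^ k, ∀ z : N, r • z = 0

/-- Two modules linked by a periodic exact sequence of period two are generically cyclic
simultaneously. -/
lemma IsGenericallyCyclic.of_exact {q : Ideal R} [q.IsPrime] (h : IsGenericallyCyclic q N)
    {φ : N →ₗ[R] N'} {ψ : N' →ₗ[R] N} (h₁ : Function.Exact ψ φ) (h₂ : Function.Exact φ ψ) :
    IsGenericallyCyclic q N' := by
  constructor
  · obtain ⟨x, f, hx, hf, hz⟩ := h.exists_generator
    -- Near q, exactness leaves two cases. If φ x is killed outside q, then φ is generically zero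
    -- and N' embeds generically in N through ψ; otherwise ψ is generically zero and φ x is the new
    -- generator.
    by_cases hc : ∃ f' ∉ q, f' • φ x = 0
    · obtain ⟨f', hf', hfx⟩ := hc
      have hkill : ∀ z, (f * f') • φ z = 0 := by
        intro z
        obtain ⟨r, hr⟩ := hz z
        rw [mul_comm, mul_smul, ← map_smul φ, hr, map_smul, smul_comm, hfx, smul_zero]
      have hff : f * f' ∉ q := fun h0 => (Ideal.IsPrime.mem_or_mem inferInstance h0).elim hf hf'
      have hsq : (f * f') * (f * f') ∉ q := fun h0 =>
        (Ideal.IsPrime.mem_or_mem inferInstance h0).elim hff hff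
      -- A preimage y of f'x generates generically. Its multiple by f f' is used instead because f
      -- f' kills the image of φ, which is the kernel of ψ, making the annihilator exactly q.
      obtain ⟨y, hy⟩ := (h₁ (f' • x)).1 (by rw [map_smul, hfx])
      refine ⟨(f * f') • y, (f * f') * (f * f'), fun r => ⟨fun hr => ?_, fun hr => ?_⟩, hsq,
        fun z => ?_⟩
      · have h1 := congrArg ψ hr
        rw [map_zero, map_smul, map_smul, hy, ← mul_smul, ← mul_smul, hx] at h1
        rcases Ideal.IsPrime.mem_or_mem inferInstance h1 with h1 | h1
        · rcases Ideal.IsPrime.mem_or_mem inferInstance h1 with h1 | h1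
          · exact h1
          · exact absurd h1 hff
        · exact absurd h1 hf'
      · obtain ⟨v, hv⟩ := (h₂ (r • y)).1 (by rw [map_smul, hy, smul_comm, (hx r).2 hr, smul_zero])
        rw [smul_comm, ← hv, hkill]
      · obtain ⟨r, hr⟩ := hz (ψ z)
        obtain ⟨v, hv⟩ := (h₂ ((f * f') • z - r • y)).1 (by
          rw [map_sub, map_smul, map_smul, hy, mul_comm, mul_smul, hr, smul_comm, sub_self])
        refine ⟨r, ?_⟩
        have h1 := hkill v
        rw [hv, smul_sub, sub_eq_zero] at h1
        rw [mul_smul, h1, smul_comm]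
    · push Not at hc
      have hφx : ∀ r, r • φ x = 0 ↔ r ∈ q := by
        intro r
        constructor
        · intro h0
          by_contra hr
          exact hc r hr h0
        · intro hr
          rw [← map_smul, (hx r).2 hr, map_zero]
      have hψ : ∀ z, f • ψ z = 0 := by
        intro z
        obtain ⟨r, hr⟩ := hz (ψ z)
        have h1 : φ (ψ z) = 0 := (h₁ _).2 ⟨z, rfl⟩
        have h2 := congrArg φ hr
        rw [map_smul, h1, smul_zero, map_smul, eq_comm, hφx] at h2
        rw [hr, (hx r).2 h2]
      refine ⟨φ x, f * f, hφx, fun h0 => (Ideal.IsPrime.mem_or_mem inferInstance h0).elim hf hf,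
        fun z => ?_⟩
      obtain ⟨v, hv⟩ := (h₂ (f • z)).1 (by rw [map_smul, hψ])
      obtain ⟨r, hr⟩ := hz v
      exact ⟨r, by rw [mul_smul, ← hv, ← map_smul, hr, map_smul]⟩
  · obtain ⟨k, hk⟩ := h.exists_pow
    -- N' is an extension of a submodule of N by a quotient of N, so the exponents add.
    refine ⟨k + k, fun r hr z => ?_⟩
    rw [pow_add] at hr
    refine Submodule.mul_induction_on hr (fun a ha b hb => ?_) fun a b ha hb => ?_
    · obtain ⟨v, hv⟩ := (h₂ (b • z)).1 (by rw [map_smul, hk b hb])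
      rw [mul_smul, ← hv, ← map_smul, hk a ha, map_zero]
    · rw [add_smul, ha, hb, add_zero]

end GenericallyCyclic

/-! ### Length estimates for Hilbert-Samuel functions. -/

section Length

variable {R N : Type*} [CommRing R] [AddCommGroup N] [Module R N]

/-- Right exactness of reduction modulo a; the map from the reduced submodule need not be injective,
so only an inequality holds. -/
lemma length_quotient_smul_le (a : Ideal R) (N₁ : Submodule R N) :
    Module.length R (N ⧸ (a • ⊤ : Submodule R N)) ≤
      Module.length R (N₁ ⧸ (a • ⊤ : Submodule R N₁)) +
        Module.length R ((N ⧸ N₁) ⧸ (a • ⊤ : Submodule R (N ⧸ N₁))) := by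
  have hp : (a • ⊤ : Submodule R N) ≤ (a • ⊤ : Submodule R (N ⧸ N₁)).comap N₁.mkQ := by
    rw [← Submodule.map_le_iff_le_comap, Submodule.map_smul'']
    exact Submodule.smul_mono le_rfl le_top
  have hi : (a • ⊤ : Submodule R N₁) ≤ (a • ⊤ : Submodule R N).comap N₁.subtype := by
    rw [← Submodule.map_le_iff_le_comap, Submodule.map_smul'']
    exact Submodule.smul_mono le_rfl le_top
  let p := Submodule.mapQ _ _ N₁.mkQ hp
  let i := Submodule.mapQ _ _ N₁.subtype hi
  have hps : Function.Surjective p := by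
    intro y
    obtain ⟨y, rfl⟩ := Submodule.mkQ_surjective _ y
    obtain ⟨y, rfl⟩ := Submodule.mkQ_surjective _ y
    exact ⟨Submodule.Quotient.mk y, rfl⟩
  have hker : LinearMap.ker p ≤ LinearMap.range i := by
    intro y hy
    obtain ⟨y, rfl⟩ := Submodule.mkQ_surjective _ y
    have h1 : N₁.mkQ y ∈ (a • ⊤ : Submodule R (N ⧸ N₁)) := (Submodule.Quotient.mk_eq_zero _).1 hy
    rw [← Submodule.range_mkQ N₁, LinearMap.range_eq_map, ← Submodule.map_smul''] at h1
    obtain ⟨v, hv, hvy⟩ := h1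
    have h2 : y - v ∈ N₁ := by
      rw [← Submodule.Quotient.mk_eq_zero, ← Submodule.mkQ_apply, map_sub, hvy, sub_self]
    refine ⟨Submodule.Quotient.mk ⟨y - v, h2⟩, ?_⟩
    refine (Submodule.Quotient.eq _).2 ?_
    change y - v - y ∈ _
    rw [sub_sub_cancel_left, neg_mem_iff]
    exact hv
  rw [Module.length_eq_add_of_exact (Submodule.subtype (LinearMap.ker p)) p
    (Submodule.subtype_injective _) hps (LinearMap.exact_subtype_ker_map p)]
  gcongr
  exact (Module.length_le_of_injective (Submodule.inclusion hker)
    (Submodule.inclusion_injective _)).trans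
    (Module.length_le_of_surjective i.rangeRestrict i.surjective_rangeRestrict)

lemma length_le_mul_length_quotient (I : Ideal R) {r : ℕ} (v : Fin r → N)
    (hv : Submodule.span R (Set.range v) = ⊤) (hI : ∀ a ∈ I, ∀ z : N, a • z = 0) :
    Module.length R N ≤ r * Module.length R (R ⧸ I) := by
  let φ : (Fin r → R ⧸ I) →ₗ[R] N := LinearMap.lsum R (fun _ => R ⧸ I) ℕ fun i =>
    Submodule.liftQ I (LinearMap.toSpanSingleton R N (v i)) fun a ha => hI a ha _
  have hφ : Function.Surjective φ := by
    rw [← LinearMap.range_eq_top, eq_top_iff, ← hv, Submodule.span_le]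
    rintro _ ⟨i, rfl⟩
    refine ⟨Pi.single i (Submodule.Quotient.mk 1), ?_⟩
    rw [LinearMap.lsum_piSingle]
    exact one_smul R (v i)
  refine (Module.length_le_of_surjective φ hφ).trans (le_of_eq ?_)
  rw [Module.length_pi]
  simp

lemma length_quotient_smul_le_of_span (a I : Ideal R) {r : ℕ} (v : Fin r → N)
    (hv : Submodule.span R (Set.range v) = ⊤) (hI : ∀ b ∈ I, ∀ z : N, b • z = 0) :
    Module.length R (N ⧸ (a • ⊤ : Submodule R N)) ≤ r * Module.length R (R ⧸ (I ⊔ a)) := by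
  refine length_le_mul_length_quotient (I ⊔ a) (fun i => (a • ⊤ : Submodule R N).mkQ (v i)) ?_ ?_
  · rw [Set.range_comp', Submodule.span_image, hv, Submodule.map_top, Submodule.range_mkQ]
  · intro b hb z
    obtain ⟨z, rfl⟩ := Submodule.mkQ_surjective _ z
    obtain ⟨c, hc, d, hd, rfl⟩ := Submodule.mem_sup.1 hb
    rw [← map_smul, add_smul, hI c hc, zero_add, Submodule.mkQ_apply,
      Submodule.Quotient.mk_eq_zero]
    exact Submodule.smul_mem_smul hd trivial

/-- If a finite module is killed by `f` and by a power of `q`, its Hilbert-Samuel function is bounded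
by a multiple of that of `R ⧸ (q + (f))`. -/
lemma exists_length_quotient_smul_le [IsNoetherianRing R] (q : Ideal R) (f : R) (k : ℕ) :
    ∀ {N : Type u} [AddCommGroup N] [Module R N] [Module.Finite R N],
      (∀ z : N, f • z = 0) → (∀ b ∈ q ^ k, ∀ z : N, b • z = 0) →
      ∃ r : ℕ, ∀ a : Ideal R, Module.length R (N ⧸ (a • ⊤ : Submodule R N)) ≤
        r * Module.length R (R ⧸ (q ⊔ Ideal.span {f} ⊔ a)) := by
  induction k with
  | zero =>
    intro N _ _ _ _ hq
    have : Subsingleton N := ⟨fun x y => by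
      rw [← one_smul R x, ← one_smul R y, hq 1 (by simp), hq 1 (by simp)]⟩
    refine ⟨0, fun a => ?_⟩
    rw [Module.length_eq_zero]
    exact zero_le
  | succ k ih =>
    intro N _ _ _ hf hq
    -- Cut along qN: the submodule is killed by q^k, and the quotient by q + (f), so it is covered
    -- by finitely many copies of R/(q + (f)).
    let N₁ : Submodule R N := q • ⊤
    have h1 : ∀ z : N₁, f • z = 0 := fun z => Subtype.ext (hf z)
    have h2 : ∀ b ∈ q ^ k, ∀ z : N₁, b • z = 0 := by
      rintro b hb ⟨z, hz⟩
      refine Subtype.ext ?_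
      change b • z = 0
      refine Submodule.smul_induction_on hz (fun c hc v _ => ?_) fun v v' hv hv' => ?_
      · rw [← mul_smul]
        exact hq _ (by rw [pow_succ]; exact Ideal.mul_mem_mul hb hc) v
      · rw [smul_add, hv, hv', add_zero]
    obtain ⟨r, hr⟩ := ih h1 h2
    obtain ⟨s, v, hv⟩ := Module.Finite.exists_fin (R := R) (M := N ⧸ N₁)
    have h3 : ∀ b ∈ q ⊔ Ideal.span {f}, ∀ z : N ⧸ N₁, b • z = 0 := by
      intro b hb z
      obtain ⟨z, rfl⟩ := Submodule.mkQ_surjective _ z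
      obtain ⟨c, hc, d, hd, rfl⟩ := Submodule.mem_sup.1 hb
      obtain ⟨d, rfl⟩ := Ideal.mem_span_singleton'.1 hd
      rw [← map_smul, add_smul, mul_smul, hf, smul_zero, add_zero, Submodule.mkQ_apply,
        Submodule.Quotient.mk_eq_zero]
      exact Submodule.smul_mem_smul hc trivial
    refine ⟨r + s, fun a => (length_quotient_smul_le a N₁).trans ?_⟩
    rw [Nat.cast_add, add_mul]
    exact add_le_add (hr a) (length_quotient_smul_le_of_span a _ v hv h3)

end Length

/-! ## Local rings that map to a power series ring -/

namespace PowSer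

open MvPowerSeries IsLocalRing

variable {K : Type u} [Field K] {n : ℕ} {L : Type u} [CommRing L] [IsLocalRing L] [Algebra K L]

/-- The maximal ideal of `L` is generated by the kernel of `θ : L → K[[X_1, …, X_n]]` and by lifts
`w_i` of the variables. -/
structure IsCoordinateMap (θ : L →ₐ[K] PowSer K n) (w : Fin n → L) : Prop where
  map_eq : ∀ i, θ (w i) = X i
  maximalIdeal_le : maximalIdeal L ≤ RingHom.ker θ ⊔ Ideal.span (Set.range w)

lemma isCoordinateMap_id : IsCoordinateMap (AlgHom.id K (PowSer K n)) X where
  map_eq _ := rfl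
  maximalIdeal_le := by
    rw [maximalIdeal_eq]
    refine le_sup_of_le_right (Ideal.span_le.2 ?_)
    rintro _ ⟨i, _, rfl⟩
    exact Ideal.subset_span ⟨i, rfl⟩

variable {θ : L →ₐ[K] PowSer K n} {w : Fin n → L}

lemma mem_maximalIdeal_of_map_mem {l : L} (h : θ l ∈ maximalIdeal (PowSer K n)) :
    l ∈ maximalIdeal L := fun hl => h (hl.map θ)

namespace IsCoordinateMap

variable (h : IsCoordinateMap θ w)
include h

lemma map_mem {l : L} (hl : l ∈ maximalIdeal L) : θ l ∈ maximalIdeal (PowSer K n) := by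
  have h1 : RingHom.ker θ ⊔ Ideal.span (Set.range w) ≤ (maximalIdeal (PowSer K n)).comap θ := by
    refine sup_le (fun x hx => ?_) (Ideal.span_le.2 ?_)
    · rw [Ideal.mem_comap, (RingHom.mem_ker).1 hx]
      exact zero_mem _
    · rintro _ ⟨i, rfl⟩
      change θ (w i) ∈ maximalIdeal (PowSer K n)
      rw [h.map_eq, maximalIdeal_eq]
      exact X_mem_varIdeal i.2
  exact h1 (h.maximalIdeal_le hl)

lemma map_mem_pow {t : ℕ} {l : L} (hl : l ∈ maximalIdeal L ^ t) :
    θ l ∈ maximalIdeal (PowSer K n) ^ t := by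
  have h1 : (maximalIdeal L).map θ ≤ maximalIdeal (PowSer K n) :=
    Ideal.map_le_iff_le_comap.2 fun _ => h.map_mem
  have h2 := Ideal.mem_map_of_mem θ hl
  rw [Ideal.map_pow] at h2
  exact Ideal.pow_right_mono h1 t h2

lemma w_mem (i : Fin n) : w i ∈ maximalIdeal L := by
  refine mem_maximalIdeal_of_map_mem (θ := θ) ?_
  rw [h.map_eq, maximalIdeal_eq]
  exact X_mem_varIdeal i.2

/-- Modulo ker θ the maximal ideal is generated by the w_i, and every residue class contains a
scalar, so elements of L have Taylor expansions in w up to any order. -/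
lemma exists_aeval_sub_mem (t : ℕ) (l : L) :
    ∃ p : MvPolynomial (Fin n) K, l - MvPolynomial.aeval w p ∈
      RingHom.ker θ ⊔ maximalIdeal L ^ t := by
  induction t generalizing l with
  | zero => exact ⟨0, Ideal.mem_sup_right (by simp)⟩
  | succ t ih =>
    set k := constantCoeff (θ l)
    have h1 : l - algebraMap K L k ∈ maximalIdeal L := by
      refine mem_maximalIdeal_of_map_mem (θ := θ) ?_
      rw [map_sub, AlgHom.commutes, maximalIdeal_eq]
      exact sub_C_mem _
    obtain ⟨a, ha, b, hb, hab⟩ := Submodule.mem_sup.1 (h.maximalIdeal_le h1)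
    obtain ⟨c, rfl⟩ := Ideal.mem_span_range_iff_exists_fun.1 hb
    choose p hp using fun i => ih (c i)
    refine ⟨MvPolynomial.C k + ∑ i, p i * MvPolynomial.X i, ?_⟩
    have h2 : l - MvPolynomial.aeval w (MvPolynomial.C k + ∑ i, p i * MvPolynomial.X i)
        = a + ∑ i, (c i - MvPolynomial.aeval w (p i)) * w i := by
      simp only [map_add, map_sum, map_mul, MvPolynomial.aeval_X, MvPolynomial.aeval_C, sub_mul,
        Finset.sum_sub_distrib]
      linear_combination -hab
    rw [h2]
    refine add_mem (Ideal.mem_sup_left ha) (Ideal.sum_mem _ fun i _ => ?_)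
    obtain ⟨d, hd, e, he, hde⟩ := Submodule.mem_sup.1 (hp i)
    rw [← hde, add_mul, pow_succ]
    exact add_mem (Ideal.mem_sup_left (Ideal.mul_mem_right _ _ hd))
      (Ideal.mem_sup_right (Ideal.mul_mem_mul he (h.w_mem i)))

lemma map_aeval (p : MvPolynomial (Fin n) K) :
    θ (MvPolynomial.aeval w p) = (p : PowSer K n) := by
  have h1 : θ.comp (MvPolynomial.aeval w) = MvPolynomial.coeToMvPowerSeries.algHom K := by
    refine MvPolynomial.algHom_ext fun i => ?_
    simp [h.map_eq]
  have h2 := congrArg (fun f => f p) h1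
  simpa using h2

/-- A polynomial approximation p(w) of l satisfies θ(p(w)) = p; if this has order at least t, then
p(w) already lies in the t-th power. Thus θ induces injections modulo powers of the maximal ideals.
-/
lemma mem_sup_of_map_mem {t : ℕ} {l : L} (hl : θ l ∈ maximalIdeal (PowSer K n) ^ t) :
    l ∈ RingHom.ker θ ⊔ maximalIdeal L ^ t := by
  obtain ⟨p, hp⟩ := h.exists_aeval_sub_mem t l
  have h1 : θ (MvPolynomial.aeval w p) ∈ maximalIdeal (PowSer K n) ^ t := by
    obtain ⟨d, hd, e, he, hde⟩ := Submodule.mem_sup.1 hp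
    have h2 : θ (MvPolynomial.aeval w p) = θ l - θ e := by
      rw [← map_sub, ← sub_eq_zero, ← map_sub]
      have : MvPolynomial.aeval w p - (l - e) = -d := by linear_combination hde
      rw [this, map_neg, (RingHom.mem_ker).1 hd, neg_zero]
    rw [h2]
    exact sub_mem hl (h.map_mem_pow he)
  rw [h.map_aeval, mem_maximalIdeal_pow] at h1
  have h2 : MvPolynomial.aeval w p ∈ maximalIdeal L ^ t := by
    rw [MvPolynomial.aeval_def, MvPolynomial.eval₂_eq']
    refine Ideal.sum_mem _ fun α hα => Ideal.mul_mem_left _ _ ?_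
    have h3 : t ≤ α.degree := by
      by_contra hlt
      have := h1 α (not_le.1 hlt)
      rw [MvPolynomial.coeff_coe] at this
      exact MvPolynomial.mem_support_iff.1 hα this
    refine Ideal.pow_le_pow_right h3 ?_
    rw [Finsupp.degree_eq_sum, ← Finset.prod_pow_eq_pow_sum]
    exact Ideal.prod_mem_prod fun i _ => Ideal.pow_mem_pow (h.w_mem i) _
  have h3 := add_mem hp (Ideal.mem_sup_right (S := RingHom.ker θ) h2)
  rwa [sub_add_cancel] at h3

lemma comap_pow (t : ℕ) : (maximalIdeal (PowSer K n) ^ t).comap θ =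
    RingHom.ker θ ⊔ maximalIdeal L ^ t := by
  refine le_antisymm (fun l hl => h.mem_sup_of_map_mem hl) (sup_le (fun l hl => ?_) fun l hl => ?_)
  · rw [Ideal.mem_comap, (RingHom.mem_ker).1 hl]
    exact zero_mem _
  · exact h.map_mem_pow hl

omit h in
lemma exists_coe_sub_mem (t : ℕ) (f : PowSer K n) :
    ∃ p : MvPolynomial (Fin n) K, f - (p : PowSer K n) ∈ maximalIdeal (PowSer K n) ^ t := by
  obtain ⟨p, hp⟩ := isCoordinateMap_id.exists_aeval_sub_mem t f
  refine ⟨p, ?_⟩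
  rw [← isCoordinateMap_id.comap_pow, Ideal.mem_comap] at hp
  rw [← isCoordinateMap_id.map_aeval p, AlgHom.id_apply]
  exact hp

/-- Although θ need not be surjective, it is so modulo each power of the maximal ideal, since
polynomials are dense in the power series ring. -/
lemma length_quotient (t : ℕ) :
    Module.length L (L ⧸ (RingHom.ker θ ⊔ maximalIdeal L ^ t)) = hilb n t := by
  let : Algebra L (PowSer K n) := θ.toRingHom.toAlgebra
  let m := maximalIdeal (PowSer K n) ^ t
  have hsurj : Function.Surjective (algebraMap L (PowSer K n ⧸ m)) := by
    intro f
    obtain ⟨f, rfl⟩ := Ideal.Quotient.mk_surjective f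
    obtain ⟨p, hp⟩ := exists_coe_sub_mem t f
    refine ⟨MvPolynomial.aeval w p, ?_⟩
    change Ideal.Quotient.mk m (θ _) = _
    rw [h.map_aeval, eq_comm, Ideal.Quotient.eq]
    exact hp
  have hker : LinearMap.ker (Algebra.linearMap L (PowSer K n ⧸ m)) =
      RingHom.ker θ ⊔ maximalIdeal L ^ t := by
    rw [← h.comap_pow]
    ext l
    exact Ideal.Quotient.eq_zero_iff_mem
  rw [← (Submodule.quotEquivOfEq _ _ hker).length_eq,
    ((Algebra.linearMap L (PowSer K n ⧸ m)).quotKerEquivOfSurjective hsurj).length_eq,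
    Module.length_eq_of_surjective (R := PowSer K n ⧸ m) hsurj,
    ← Module.length_eq_of_surjective (S := PowSer K n) (R := PowSer K n ⧸ m)
      Ideal.Quotient.mk_surjective]
  exact length_quotient_maximalIdeal_pow t

lemma exists_mem_sup {f : L} (hf : f ∉ RingHom.ker θ) : ∃ c : ℕ, ∀ t b,
    f * b ∈ RingHom.ker θ ⊔ maximalIdeal L ^ t → b ∈ RingHom.ker θ ⊔ maximalIdeal L ^ (t - c) := by
  obtain ⟨c, hc⟩ := exists_mul_mem_maximalIdeal_pow hf
  refine ⟨c, fun t b hb => ?_⟩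
  rw [← h.comap_pow, Ideal.mem_comap] at hb ⊢
  rw [map_mul] at hb
  exact hc t _ hb

/-- Dividing further by f removes at least the image of multiplication by f, which surjects onto
L/(ker θ + m^(t-c)) by the choice of c. So the remaining length grows more slowly than t^n. -/
lemma length_quotient_add_le {f : L} {c t : ℕ}
    (hc : ∀ b, f * b ∈ RingHom.ker θ ⊔ maximalIdeal L ^ t →
      b ∈ RingHom.ker θ ⊔ maximalIdeal L ^ (t - c)) :
    Module.length L (L ⧸ (RingHom.ker θ ⊔ Ideal.span {f} ⊔ maximalIdeal L ^ t)) + hilb n (t - c) ≤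
      hilb n t := by
  rw [← h.length_quotient t, ← h.length_quotient (t - c)]
  set J := RingHom.ker θ ⊔ maximalIdeal L ^ t
  have hle : J ≤ RingHom.ker θ ⊔ Ideal.span {f} ⊔ maximalIdeal L ^ t :=
    sup_le_sup_right le_sup_left _
  let p := Submodule.factor hle
  let φ : L →ₗ[L] L ⧸ J := LinearMap.toSpanSingleton L _ (Submodule.Quotient.mk f)
  have hφ : ∀ b, φ b = Submodule.Quotient.mk (f * b) := by
    intro b
    rw [LinearMap.toSpanSingleton_apply, ← Submodule.Quotient.mk_smul, smul_eq_mul, mul_comm]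
  have hp : LinearMap.range φ ≤ LinearMap.ker p := by
    rintro _ ⟨b, rfl⟩
    rw [hφ]
    refine (Submodule.Quotient.mk_eq_zero _).2 ?_
    exact Ideal.mem_sup_left (Ideal.mem_sup_right
      (Ideal.mul_mem_right _ _ (Ideal.mem_span_singleton_self f)))
  have hker : LinearMap.ker φ ≤ RingHom.ker θ ⊔ maximalIdeal L ^ (t - c) := by
    intro b hb
    rw [LinearMap.mem_ker, hφ] at hb
    exact hc b ((Submodule.Quotient.mk_eq_zero _).1 hb)
  rw [Module.length_eq_add_of_exact (Submodule.subtype (LinearMap.ker p)) p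
    (Submodule.subtype_injective _) (Submodule.factor_surjective hle)
    (LinearMap.exact_subtype_ker_map p), add_comm]
  gcongr
  refine le_trans ?_ (Module.length_le_of_injective (Submodule.inclusion hp)
    (Submodule.inclusion_injective _))
  rw [← φ.quotKerEquivRange.length_eq]
  exact Module.length_le_of_surjective (Submodule.factor hker) (Submodule.factor_surjective hker)

variable {N : Type u} [AddCommGroup N] [Module L N]

/-- If bx lies in m^t N, then fbx lies in m^t x, so fb is in ker θ + m^t and b in ker θ + m^(t-c).
The class of x therefore spans a large cyclic submodule. -/
lemma hilb_sub_le_length {f : L} {c t : ℕ}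
    (hc : ∀ b, f * b ∈ RingHom.ker θ ⊔ maximalIdeal L ^ t →
      b ∈ RingHom.ker θ ⊔ maximalIdeal L ^ (t - c)) {x : N}
    (hx : ∀ r : L, r • x = 0 ↔ r ∈ RingHom.ker θ) (hf : ∀ z : N, ∃ r : L, f • z = r • x) :
    hilb n (t - c) ≤ Module.length L (N ⧸ (maximalIdeal L ^ t • ⊤ : Submodule L N)) := by
  let φ : L →ₗ[L] N ⧸ (maximalIdeal L ^ t • ⊤ : Submodule L N) :=
    LinearMap.toSpanSingleton L _ (Submodule.Quotient.mk x)
  have hy : ∀ y ∈ (maximalIdeal L ^ t • ⊤ : Submodule L N),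
      ∃ s ∈ maximalIdeal L ^ t, f • y = s • x := by
    intro y hy
    refine Submodule.smul_induction_on hy (fun a ha v _ => ?_) ?_
    · obtain ⟨r, hr⟩ := hf v
      exact ⟨a * r, Ideal.mul_mem_right _ _ ha, by rw [smul_comm, hr, mul_smul]⟩
    · rintro v v' ⟨s, hs, hv⟩ ⟨s', hs', hv'⟩
      exact ⟨s + s', add_mem hs hs', by rw [smul_add, hv, hv', add_smul]⟩
  have hker : LinearMap.ker φ ≤ RingHom.ker θ ⊔ maximalIdeal L ^ (t - c) := by
    intro b hb
    rw [LinearMap.mem_ker, LinearMap.toSpanSingleton_apply, ← Submodule.Quotient.mk_smul,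
      Submodule.Quotient.mk_eq_zero] at hb
    obtain ⟨s, hs, hsx⟩ := hy _ hb
    refine hc b ?_
    rw [← mul_smul, ← sub_eq_zero, ← sub_smul, hx] at hsx
    have := add_mem (Ideal.mem_sup_left (T := maximalIdeal L ^ t) hsx) (Ideal.mem_sup_right hs)
    rwa [sub_add_cancel] at this
  rw [← h.length_quotient (t - c)]
  refine le_trans ?_ (Module.length_le_of_injective (LinearMap.range φ).subtype
    (Submodule.subtype_injective _))
  rw [← φ.quotKerEquivRange.length_eq]
  exact Module.length_le_of_surjective (Submodule.factor hker) (Submodule.factor_surjective hker)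

/-- The Hilbert-Samuel function of a generically cyclic module. -/
lemma exists_length_bounds [IsNoetherianRing L] [Module.Finite L N]
    (hN : IsGenericallyCyclic (RingHom.ker θ) N) :
    ∃ (a : ℕ → ℕ) (r c : ℕ), ∀ t,
      Module.length L (N ⧸ (maximalIdeal L ^ t • ⊤ : Submodule L N)) = a t ∧
      hilb n (t - c) ≤ a t ∧ a t + r * hilb n (t - c) ≤ hilb n t + r * hilb n t := by
  obtain ⟨x, f, hx, hf, hz⟩ := hN.exists_generator
  obtain ⟨k, hk⟩ := hN.exists_pow
  obtain ⟨c, hc⟩ := h.exists_mem_sup hf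
  let N₁ := Submodule.span L {x}
  have h1 : ∀ z : N ⧸ N₁, f • z = 0 := by
    intro z
    obtain ⟨z, rfl⟩ := Submodule.mkQ_surjective _ z
    obtain ⟨r, hr⟩ := hz z
    rw [← map_smul, hr, Submodule.mkQ_apply, Submodule.Quotient.mk_eq_zero]
    exact Submodule.smul_mem _ _ (Submodule.mem_span_singleton_self x)
  have h2 : ∀ b ∈ RingHom.ker θ ^ k, ∀ z : N ⧸ N₁, b • z = 0 := by
    intro b hb z
    obtain ⟨z, rfl⟩ := Submodule.mkQ_surjective _ z
    rw [← map_smul, hk b hb, map_zero]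
  -- The quotient by the cyclic submodule is killed by f outside ker θ, so its contribution is at
  -- most r(hilb n t - hilb n (t - c)).
  obtain ⟨r, hr⟩ := exists_length_quotient_smul_le (RingHom.ker θ) f k h1 h2
  have h3 : ∀ t, Module.length L (N₁ ⧸ (maximalIdeal L ^ t • ⊤ : Submodule L N₁)) ≤ hilb n t := by
    intro t
    refine (length_quotient_smul_le_of_span (maximalIdeal L ^ t) (RingHom.ker θ)
      (fun _ : Fin 1 => (⟨x, Submodule.mem_span_singleton_self x⟩ : N₁)) ?_ ?_).trans ?_
    · rw [Set.range_const, eq_top_iff]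
      rintro ⟨y, hy⟩ _
      obtain ⟨b, rfl⟩ := Submodule.mem_span_singleton.1 hy
      exact Submodule.mem_span_singleton.2 ⟨b, rfl⟩
    · rintro b hb ⟨y, hy⟩
      obtain ⟨s, rfl⟩ := Submodule.mem_span_singleton.1 hy
      refine Subtype.ext ?_
      change b • s • x = 0
      rw [smul_comm, (hx b).2 hb, smul_zero]
    · rw [h.length_quotient, Nat.cast_one, one_mul]
  have key : ∀ t, ∃ a : ℕ, Module.length L (N ⧸ (maximalIdeal L ^ t • ⊤ : Submodule L N)) = a ∧
      hilb n (t - c) ≤ a ∧ a + r * hilb n (t - c) ≤ hilb n t + r * hilb n t := by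
    intro t
    have h4 := h.length_quotient_add_le (hc t)
    have h5 := h.hilb_sub_le_length (hc t) hx hz
    have h6 := (length_quotient_smul_le (maximalIdeal L ^ t) N₁).trans (add_le_add (h3 t) (hr _))
    have h7 : Module.length L (L ⧸ (RingHom.ker θ ⊔ Ideal.span {f} ⊔ maximalIdeal L ^ t)) ≠ ⊤ :=
      ne_top_of_le_ne_top (ENat.natCast_ne_top _) (le_self_add.trans h4)
    obtain ⟨d, hd⟩ := ENat.ne_top_iff_exists.1 h7
    rw [← hd] at h4 h6
    obtain ⟨a, ha⟩ := ENat.ne_top_iff_exists.1 (ne_top_of_le_ne_top (by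
      exact_mod_cast ENat.natCast_ne_top (hilb n t + r * d)) h6)
    rw [← ha] at h5 h6
    norm_cast at h4 h5 h6
    refine ⟨a, ha.symm, h5, ?_⟩
    have h8 := Nat.mul_le_mul_left r h4
    rw [mul_add] at h8
    omega
  choose a ha using key
  exact ⟨a, r, c, ha⟩

/-! ### Dimension of generically cyclic modules. -/

section Dimension

lemma spanFinrank_map_maximalIdeal_le {S : Type*} [CommRing S] [IsLocalRing S] (π : L →+* S)
    (hπ : Function.Surjective π) (hker : RingHom.ker θ ≤ RingHom.ker π) :
    (maximalIdeal S).spanFinrank ≤ n := by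
  have hloc : IsLocalHom π := .of_surjective π hπ
  have h1 : maximalIdeal S = Ideal.span (Set.range (π ∘ w)) := by
    refine le_antisymm (fun s hs => ?_) (Ideal.span_le.2 ?_)
    · obtain ⟨l, rfl⟩ := hπ s
      have hl : l ∈ maximalIdeal L := fun hu => hs (hu.map π)
      obtain ⟨a, ha, b, hb, rfl⟩ := Submodule.mem_sup.1 (h.maximalIdeal_le hl)
      have ha' : π a = 0 := hker ha
      rw [map_add, ha', zero_add, Set.range_comp, ← Ideal.map_span]
      exact Ideal.mem_map_of_mem π hb
    · rintro _ ⟨i, rfl⟩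
      exact fun hu => h.w_mem i (isUnit_of_map_unit π _ hu)
  rw [h1]
  refine (Submodule.spanFinrank_span_le_ncard_of_finite (Set.finite_range _)).trans ?_
  rw [← Set.image_univ]
  refine (Set.ncard_image_le Set.finite_univ).trans ?_
  rw [Set.ncard_univ, Nat.card_eq_fintype_card, Fintype.card_fin]

variable [IsNoetherianRing L]

/-- Above, the maximal ideal of the quotient has n generators. Below, the primes where the first i
variables vanish, for i = 0, …, n, pull back to a chain that is strict because w_i enters at step i
+ 1. -/
lemma ringKrullDim_quotient_ker : ringKrullDim (L ⧸ RingHom.ker θ) = n := by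
  have : Nontrivial (L ⧸ RingHom.ker θ) :=
    Ideal.Quotient.nontrivial_iff.2 (RingHom.ker_ne_top θ)
  have : IsLocalRing (L ⧸ RingHom.ker θ) :=
    .of_surjective' (Ideal.Quotient.mk _) Ideal.Quotient.mk_surjective
  refine le_antisymm ?_ ?_
  · refine (ringKrullDim_le_spanFinrank_maximalIdeal _).trans ?_
    exact_mod_cast h.spanFinrank_map_maximalIdeal_le (Ideal.Quotient.mk (RingHom.ker θ))
      Ideal.Quotient.mk_surjective (by rw [Ideal.mk_ker])
  · rw [ringKrullDim_quotient]
    let q : Fin (n + 1) → PrimeSpectrum L := fun i =>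
      ⟨RingHom.ker ((kill (K := K) (n := n) i.val).comp θ), RingHom.ker_isPrime _⟩
    have hmono : StrictMono fun i => (⟨q i, fun l hl => by
        change kill _ (θ l) = 0
        rw [(RingHom.mem_ker).1 hl, map_zero]⟩ : PrimeSpectrum.zeroLocus (RingHom.ker θ : Set L)) := by
      refine Fin.strictMono_iff_lt_succ.2 fun i => ?_
      change (q i.castSucc).asIdeal < (q i.succ).asIdeal
      refine lt_of_le_of_ne (fun l hl => ?_) fun heq => ?_
      · have h1 : θ l ∈ varIdeal K n i.val := mem_varIdeal_iff.2 hl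
        exact mem_varIdeal_iff.1 (varIdeal_mono (Nat.le_succ _) h1)
      · have h1 : w i ∈ (q i.succ).asIdeal := by
          change kill _ (θ (w i)) = 0
          rw [h.map_eq, kill_X_of_lt (by simp)]
        rw [← heq] at h1
        change kill _ (θ (w i)) = 0 at h1
        rw [h.map_eq, ← mem_varIdeal_iff] at h1
        exact X_notMem_varIdeal le_rfl h1
    exact Order.LTSeries.length_le_krullDim (LTSeries.mk n _ hmono)

/-- The annihilator of N lies between a power of ker θ and ker θ, so the support is the zero locus
of ker θ. -/
lemma supportDim_eq [Module.Finite L N] (hN : IsGenericallyCyclic (RingHom.ker θ) N) :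
    Module.supportDim L N = n := by
  obtain ⟨x, f, hx, -, -⟩ := hN.exists_generator
  obtain ⟨k, hk⟩ := hN.exists_pow
  have h1 : Module.annihilator L N ≤ RingHom.ker θ := fun r hr =>
    (hx r).1 (Module.mem_annihilator.1 hr x)
  have h2 : RingHom.ker θ ^ k ≤ Module.annihilator L N := fun r hr =>
    Module.mem_annihilator.2 (hk r hr)
  have h3 : PrimeSpectrum.zeroLocus (Module.annihilator L N : Set L) =
      PrimeSpectrum.zeroLocus (RingHom.ker θ : Set L) := by
    refine Set.Subset.antisymm (fun p hp => ?_) (PrimeSpectrum.zeroLocus_anti_mono h1)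
    exact Ideal.IsPrime.le_of_pow_le (h2.trans hp)
  rw [← h.ringKrullDim_quotient_ker, ringKrullDim_quotient, ← h3,
    Module.supportDim, Module.support_eq_zeroLocus]

end Dimension

/-- A finite generically cyclic module has multiplicity one. -/
theorem hasMultiplicity_one [IsNoetherianRing L] [Module.Finite L N]
    (hN : IsGenericallyCyclic (RingHom.ker θ) N) : HasMultiplicity L N 1 := by
  refine ⟨n, h.supportDim_eq hN, ?_⟩
  obtain ⟨a, r, c, ha⟩ := h.exists_length_bounds hN
  have h1 := ENNReal.tendsto_ofReal
    (tendsto_factorial_mul_div (fun t => (ha t).2.1) (fun t => (ha t).2.2))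
  rw [ENNReal.ofReal_one] at h1
  rw [Nat.cast_one]
  refine h1.congr' ?_
  filter_upwards [Filter.eventually_gt_atTop 0] with t ht
  rw [(ha t).1, ENNReal.ofReal_div_of_pos (by positivity), ENNReal.ofReal_natCast,
    ENNReal.ofReal_pow (by positivity), ENNReal.ofReal_natCast]
  push_cast
  rfl

end IsCoordinateMap

end PowSer

/-! ## Comparison of good filtrations -/

section Filtrations

variable {X : Type u} [AddCommGroup X]

lemma of_grPiece_mk_congr {F : ℕ → AddSubgroup X} {i j : ℕ} (h : i = j) {x : F i} {y : F j}
    (hxy : (x : X) = y) :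
    DirectSum.of (GrPiece F) i (GrPiece.mk F i x) = DirectSum.of (GrPiece F) j (GrPiece.mk F j y) := by
  subst h
  rw [Subtype.ext hxy]

/-- The map of graded groups of degree `s` induced by the identity. -/
def grShiftAux (F G : ℕ → AddSubgroup X) (s : ℕ) (h : ∀ j, F j ≤ G (j + s)) :
    (⨁ j, GrPiece F j) →+ ⨁ j, GrPiece G j :=
  DirectSum.toAddMonoid fun j => (DirectSum.of (GrPiece G) (j + s)).comp
    (GrPiece.lift ((GrPiece.mk G (j + s)).comp (AddSubgroup.inclusion (h j))) (by
      intro x hx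
      refine GrPiece.mk_eq_zero.2 ?_
      cases j with
      | zero =>
        have hx0 : (x : X) = 0 := hx
        change (x : X) ∈ _
        rw [hx0]
        exact zero_mem _
      | succ j =>
        have h1 : filtLt G (j + 1 + s) = G (j + s) := by rw [Nat.add_right_comm]; rfl
        exact h1.ge (h j hx)))

lemma grShiftAux_of {F G : ℕ → AddSubgroup X} {s : ℕ} (h : ∀ j, F j ≤ G (j + s)) (j : ℕ)
    (x : F j) : grShiftAux F G s h (DirectSum.of (GrPiece F) j (GrPiece.mk F j x)) =
      DirectSum.of (GrPiece G) (j + s) (GrPiece.mk G (j + s) ⟨x, h j x.2⟩) := by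
  rw [grShiftAux, DirectSum.toAddMonoid_of]
  rfl

variable {K A M : Type u} [CommRing K] [CommRing A] [Algebra K A] [AddCommGroup M]
  [Module (DOps K A) M]

lemma of_smul_of_mk (F : DFiltration K A M) {i j : ℕ} (Q : diffFilt K A i) (x : F.F j) :
    (DirectSum.of (DGrPiece K A) i (GrPiece.mk (diffFilt K A) i Q) : GrD K A) •
      (DirectSum.of F.Piece j (GrPiece.mk F.F j x) : F.Gr) =
    DirectSum.of F.Piece (i + j) (GrPiece.mk F.F (i + j)
      ⟨(Q : DOps K A) • (x : M), F.smul_mem i j Q Q.2 x x.2⟩) := by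
  rw [DirectSum.Gmodule.of_smul_of]
  rfl

/-- The map of graded modules of degree `s` induced by the identity of `M`. -/
def DFiltration.grShift (F G : DFiltration K A M) (s : ℕ) (h : ∀ j, F.F j ≤ G.F (j + s)) :
    F.Gr →ₗ[GrD K A] G.Gr where
  toFun := grShiftAux F.F G.F s h
  map_add' := map_add _
  map_smul' r x := by
    rw [RingHom.id_apply]
    induction r using DirectSum.induction_on with
    | zero => rw [zero_smul, zero_smul, map_zero]
    | add r r' hr hr' => rw [add_smul, add_smul, map_add, hr, hr']
    | of i r =>
      obtain ⟨Q, rfl⟩ := GrPiece.mk_surjective _ _ r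
      induction x using DirectSum.induction_on with
      | zero => rw [smul_zero, map_zero, smul_zero]
      | add x x' hx hx' => rw [smul_add, map_add, map_add, smul_add, hx, hx']
      | of j x =>
        obtain ⟨x, rfl⟩ := GrPiece.mk_surjective _ _ x
        rw [of_smul_of_mk, grShiftAux_of, grShiftAux_of]
        refine Eq.trans ?_ (of_smul_of_mk G Q _).symm
        exact of_grPiece_mk_congr (add_assoc i j s) rfl

lemma DFiltration.grShift_of_mk {F G : DFiltration K A M} {s : ℕ} (h : ∀ j, F.F j ≤ G.F (j + s))
    {j : ℕ} (x : F.F j) : F.grShift G s h (DirectSum.of F.Piece j (GrPiece.mk F.F j x)) =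
      DirectSum.of G.Piece (j + s) (GrPiece.mk G.F (j + s) ⟨x, h j x.2⟩) :=
  grShiftAux_of h j x

lemma DFiltration.grShift_apply {F G : DFiltration K A M} {s : ℕ} (h : ∀ j, F.F j ≤ G.F (j + s))
    (z : F.Gr) {j : ℕ} {x : F.F j} (hx : z j = GrPiece.mk F.F j x) :
    F.grShift G s h z (j + s) = GrPiece.mk G.F (j + s) ⟨x, h j x.2⟩ := by
  induction z using DirectSum.induction_on generalizing x with
  | zero =>
    rw [map_zero, DirectSum.zero_apply, eq_comm]
    rw [DirectSum.zero_apply, eq_comm, GrPiece.mk_eq_zero] at hx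
    have h1 := grShiftAux_of h j x
    rw [GrPiece.mk_eq_zero.2 hx, map_zero, map_zero, eq_comm] at h1
    have h2 := congrArg (fun z : G.Gr => z (j + s)) h1
    simpa using h2
  | add z z' hz hz' =>
    obtain ⟨y, hy⟩ := GrPiece.mk_surjective F.F j (z j)
    obtain ⟨y', hy'⟩ := GrPiece.mk_surjective F.F j (z' j)
    rw [map_add, DirectSum.add_apply, hz hy.symm, hz' hy'.symm, ← map_add]
    rw [DirectSum.add_apply, ← hy, ← hy', ← map_add] at hx
    have h1 := congrArg (fun z => grShiftAux F.F G.F s h (DirectSum.of (GrPiece F.F) j z)) hx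
    rw [grShiftAux_of, grShiftAux_of] at h1
    have h2 := congrArg (fun z : G.Gr => z (j + s)) h1
    simpa using h2
  | of i z =>
    obtain ⟨z, rfl⟩ := GrPiece.mk_surjective F.F i z
    rw [grShift_of_mk]
    by_cases hij : i = j
    · subst hij
      rw [DirectSum.of_eq_same] at hx ⊢
      have h1 := congrArg (fun z => grShiftAux F.F G.F s h (DirectSum.of (GrPiece F.F) i z)) hx
      rw [grShiftAux_of, grShiftAux_of] at h1
      exact DirectSum.of_injective _ h1
    · rw [DirectSum.of_eq_of_ne _ _ _ (Ne.symm hij)] at hx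
      rw [DirectSum.of_eq_of_ne _ _ _ (by omega)]
      rw [eq_comm, GrPiece.mk_eq_zero] at hx
      have h1 := grShiftAux_of h j x
      rw [GrPiece.mk_eq_zero.2 hx, map_zero, map_zero, eq_comm] at h1
      have h2 := congrArg (fun z : G.Gr => z (j + s)) h1
      simpa using h2.symm

/-- Exactness is checked on homogeneous components. The second alternative in `h₁` covers degrees
below s, which the first map does not reach. -/
lemma DFiltration.exact_grShift {F G H : DFiltration K A M} {s t : ℕ}
    (h : ∀ j, F.F j ≤ G.F (j + s)) (h' : ∀ j, G.F j ≤ H.F (j + t))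
    (h₀ : ∀ j, ∀ x ∈ F.F j, x ∈ filtLt H.F (j + s + t))
    (h₁ : ∀ j, ∀ x ∈ G.F j, x ∈ filtLt H.F (j + t) →
      (∃ i, i + s = j ∧ x ∈ F.F i) ∨ x ∈ filtLt G.F j) :
    Function.Exact (F.grShift G s h) (G.grShift H t h') := by
  intro z
  constructor
  · intro hz
    classical
    rw [← DirectSum.sum_support_of z]
    rw [← LinearMap.coe_range, SetLike.mem_coe]
    refine Submodule.sum_mem _ fun j _ => ?_
    obtain ⟨x, hx⟩ := GrPiece.mk_surjective G.F j (z j)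
    have h2 := grShift_apply h' z hx.symm
    rw [hz, DirectSum.zero_apply, eq_comm, GrPiece.mk_eq_zero] at h2
    rw [← hx]
    rcases h₁ j x x.2 h2 with ⟨i, rfl, hi⟩ | h3
    · exact ⟨DirectSum.of F.Piece i (GrPiece.mk F.F i ⟨x, hi⟩), grShift_of_mk h _⟩
    · rw [GrPiece.mk_eq_zero.2 h3, map_zero]
      exact zero_mem _
  · rintro ⟨y, rfl⟩
    induction y using DirectSum.induction_on with
    | zero => rw [map_zero, map_zero]
    | add y y' hy hy' => rw [map_add, map_add, hy, hy', add_zero]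
    | of i y =>
      obtain ⟨y, rfl⟩ := GrPiece.mk_surjective F.F i y
      rw [grShift_of_mk, grShift_of_mk, GrPiece.mk_eq_zero.2 (h₀ i y y.2), map_zero]

namespace DFiltration

section Adjacent

variable {F G : DFiltration K A M} (h : ∀ j, F.F j ≤ G.F j) (h' : ∀ j, G.F j ≤ F.F (j + 1))

/-- For F_j ⊆ G_j ⊆ F_(j+1), the kernel of gr F → gr G has pieces G_(j-1)/F_(j-1), which are exactly
the images of the map from gr G of degree one. With its companion this gives a sequence of period
two. -/
lemma exact_grShift_zero_one : Function.Exact (F.grShift G 0 h) (G.grShift F 1 h') :=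
  exact_grShift h h' (fun _ _ hx => hx) fun j _ _ hx => Or.inl ⟨j, rfl, hx⟩

lemma exact_grShift_one_zero : Function.Exact (G.grShift F 1 h') (F.grShift G 0 h) :=
  exact_grShift h' h (fun _ _ hx => hx) fun j x _ hx => by
    cases j with
    | zero => exact Or.inr hx
    | succ j => exact Or.inl ⟨j, rfl, hx⟩

include h h'

lemma isGenericallyCyclic_iff (q : Ideal (GrD K A)) [q.IsPrime] :
    IsGenericallyCyclic q F.Gr ↔ IsGenericallyCyclic q G.Gr :=
  ⟨fun hF => hF.of_exact (exact_grShift_one_zero h h') (exact_grShift_zero_one h h'),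
    fun hG => hG.of_exact (exact_grShift_zero_one h h') (exact_grShift_one_zero h h')⟩

end Adjacent

/-- The filtration `j ↦ F_(j + a)`. -/
def shift (F : DFiltration K A M) (a : ℕ) : DFiltration K A M where
  F j := F.F (j + a)
  mono := fun _ _ h => F.mono (Nat.add_le_add_right h a)
  exhaustive x := by
    obtain ⟨i, hi⟩ := F.exhaustive x
    exact ⟨i, F.mono (Nat.le_add_right i a) hi⟩
  smul_mem i j Q hQ x hx := by
    rw [add_assoc]
    exact F.smul_mem i _ Q hQ x hx

/-- The filtration `j ↦ F_j + G_j`. -/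
def sup (F G : DFiltration K A M) : DFiltration K A M where
  F j := F.F j ⊔ G.F j
  mono := fun _ _ h => sup_le_sup (F.mono h) (G.mono h)
  exhaustive x := by
    obtain ⟨i, hi⟩ := F.exhaustive x
    exact ⟨i, AddSubgroup.mem_sup_left hi⟩
  smul_mem i j Q hQ x hx := by
    obtain ⟨y, hy, z, hz, rfl⟩ := AddSubgroup.mem_sup.1 hx
    rw [smul_add]
    exact AddSubgroup.add_mem_sup (F.smul_mem i j Q hQ y hy) (G.smul_mem i j Q hQ z hz)

/-- The filtration `j ↦ F_j ∩ G_j`. -/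
def inf (F G : DFiltration K A M) : DFiltration K A M where
  F j := F.F j ⊓ G.F j
  mono := fun _ _ h => inf_le_inf (F.mono h) (G.mono h)
  exhaustive x := by
    obtain ⟨i, hi⟩ := F.exhaustive x
    obtain ⟨j, hj⟩ := G.exhaustive x
    exact ⟨max i j, F.mono (le_max_left _ _) hi, G.mono (le_max_right _ _) hj⟩
  smul_mem i j Q hQ x hx := ⟨F.smul_mem i j Q hQ x hx.1, G.smul_mem i j Q hQ x hx.2⟩

lemma isGenericallyCyclic_shift_iff (F : DFiltration K A M) (q : Ideal (GrD K A)) [q.IsPrime]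
    (a : ℕ) : IsGenericallyCyclic q (F.shift a).Gr ↔ IsGenericallyCyclic q F.Gr := by
  induction a with
  | zero => exact Iff.rfl
  | succ a ih =>
    rw [← ih]
    refine (isGenericallyCyclic_iff (F := F.shift a) (G := F.shift (a + 1)) (fun j => ?_)
      (fun j => ?_) q).symm
    · exact F.mono (by omega)
    · exact F.mono (by omega)

/-- The filtrations F_j + S_(j+b-k), for k = 0, …, b, are successively adjacent and lead from a
shift of S to F. -/
lemma isGenericallyCyclic_of_le_of_le {F S : DFiltration K A M} {b : ℕ} (h : ∀ j, S.F j ≤ F.F j)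
    (h' : ∀ j, F.F j ≤ S.F (j + b)) (q : Ideal (GrD K A)) [q.IsPrime]
    (hS : IsGenericallyCyclic q S.Gr) : IsGenericallyCyclic q F.Gr := by
  have key : ∀ k ≤ b, IsGenericallyCyclic q (F.sup (S.shift (b - k))).Gr := by
    intro k
    induction k with
    | zero =>
      intro _
      refine (isGenericallyCyclic_iff (F := S.shift b) (fun j => le_sup_right) (fun j => ?_) q).1
        ((S.isGenericallyCyclic_shift_iff q b).2 hS)
      exact (sup_le (h' j) le_rfl).trans (S.mono (by omega))
    | succ k ih =>
      intro hk
      refine (isGenericallyCyclic_iff (fun j => ?_) (fun j => ?_) q).2 (ih (by omega))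
      · exact sup_le_sup le_rfl (S.mono (by omega))
      · exact sup_le_sup (F.mono (by omega)) (S.mono (by omega))
  refine (isGenericallyCyclic_iff (fun j => le_sup_left) (fun j => ?_) q).2 (key b le_rfl)
  refine (sup_le le_rfl ?_).trans (F.mono (Nat.le_succ j))
  rw [Nat.sub_self]
  exact h j

lemma inf_F_le (F G : DFiltration K A M) (j : ℕ) : (F.inf G).F j ≤ F.F (j + 0) := inf_le_left

/-- A good filtration is contained in a shift of any other filtration. -/
lemma IsGood.exists_le_add {F : DFiltration K A M} (hF : F.IsGood) (G : DFiltration K A M) :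
    ∃ b, ∀ j, F.F j ≤ G.F (j + b) := by
  -- `N b` consists of the elements whose homogeneous components have representatives in G_(j+b).
  -- These submodules increase and exhaust gr F, so finite generation makes one of them everything.
  let N : ℕ → Submodule (GrD K A) F.Gr := fun b =>
    LinearMap.range ((F.inf (G.shift b)).grShift F 0 (F.inf_F_le (G.shift b)))
  have hmono : Monotone N := by
    rintro b c hbc _ ⟨z, rfl⟩
    induction z using DirectSum.induction_on with
    | zero =>
      rw [map_zero]
      exact zero_mem _
    | add z z' hz hz' =>
      rw [map_add]
      exact add_mem hz hz'
    | of j z =>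
      obtain ⟨z, rfl⟩ := GrPiece.mk_surjective _ j z
      refine (congrArg (· ∈ N c) (grShift_of_mk _ z)).mpr ?_
      exact ⟨_, grShift_of_mk _ (⟨z, z.2.1, G.mono (Nat.add_le_add_left hbc j) z.2.2⟩ :
        (F.inf (G.shift c)).F j)⟩
  have hN : ∀ z : F.Gr, ∃ b, z ∈ N b := by
    intro z
    induction z using DirectSum.induction_on with
    | zero => exact ⟨0, zero_mem _⟩
    | add z z' hz hz' =>
      obtain ⟨b, hb⟩ := hz
      obtain ⟨c, hc⟩ := hz'
      exact ⟨max b c, add_mem (hmono (le_max_left b c) hb) (hmono (le_max_right b c) hc)⟩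
    | of j z =>
      obtain ⟨z, rfl⟩ := GrPiece.mk_surjective _ j z
      obtain ⟨b, hb⟩ := G.exhaustive (z : M)
      exact ⟨b, _, grShift_of_mk _ (⟨z, z.2, G.mono (Nat.le_add_left b j) hb⟩ :
        (F.inf (G.shift b)).F j)⟩
  obtain ⟨s, hs⟩ := (show Module.Finite (GrD K A) F.Gr from hF).fg_top
  choose c hc using hN
  have htop : N (s.sup c) = ⊤ := by
    rw [eq_top_iff, ← hs, Submodule.span_le]
    exact fun z hz => hmono (Finset.le_sup hz) (hc z)
  refine ⟨s.sup c, fun j => ?_⟩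
  set b := s.sup c
  -- Every x in F_j agrees with an element of G_(j+b) up to F_(j-1), so induction on j applies.
  have hstep : ∀ j, ∀ x ∈ F.F j, ∃ y ∈ G.F (j + b), x - y ∈ filtLt F.F j := by
    intro j x hx
    obtain ⟨z, hz⟩ : DirectSum.of F.Piece j (GrPiece.mk F.F j ⟨x, hx⟩) ∈ N b := by
      rw [htop]
      exact Submodule.mem_top
    obtain ⟨y, hy⟩ := GrPiece.mk_surjective _ j (z j)
    have h1 := grShift_apply (F.inf_F_le (G.shift b)) z hy.symm
    rw [hz] at h1
    have h2 : GrPiece.mk F.F j ⟨x, hx⟩ = GrPiece.mk F.F j ⟨y, y.2.1⟩ :=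
      (DirectSum.of_eq_same j _).symm.trans h1
    rw [← sub_eq_zero, ← map_sub, GrPiece.mk_eq_zero] at h2
    exact ⟨y, y.2.2, h2⟩
  induction j with
  | zero =>
    intro x hx
    obtain ⟨y, hy, hxy⟩ := hstep 0 x hx
    have h1 : x - y = 0 := hxy
    rw [sub_eq_zero.1 h1]
    exact hy
  | succ j ih =>
    intro x hx
    obtain ⟨y, hy, hxy⟩ := hstep (j + 1) x hx
    rw [← sub_add_cancel x y]
    exact add_mem (G.mono (by omega) (ih hxy)) hy

lemma isGenericallyCyclic_of_isGood {F S : DFiltration K A M} (hF : F.IsGood) (hS : S.IsGood)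
    (q : Ideal (GrD K A)) [q.IsPrime] (h : IsGenericallyCyclic q S.Gr) :
    IsGenericallyCyclic q F.Gr := by
  obtain ⟨a, ha⟩ := hS.exists_le_add F
  obtain ⟨b, hb⟩ := hF.exists_le_add S
  rw [← F.isGenericallyCyclic_shift_iff q a]
  refine isGenericallyCyclic_of_le_of_le (F := F.shift a) (b := a + b) ha (fun j => (hb _).trans ?_) q h
  exact S.mono (by omega)

end DFiltration

end Filtrations

/-! ## The associated graded ring of `D` -/

namespace PowSer

open MvPowerSeries

section GrRing

variable {K A : Type u} [CommRing K] [CommRing A] [Algebra K A]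

lemma of_mk_mul_of_mk {i j : ℕ} (Q : diffFilt K A i) (R : diffFilt K A j) :
    (DirectSum.of (DGrPiece K A) i (GrPiece.mk (diffFilt K A) i Q) : GrD K A) *
      DirectSum.of (DGrPiece K A) j (GrPiece.mk (diffFilt K A) j R) =
    DirectSum.of (DGrPiece K A) (i + j) (GrPiece.mk (diffFilt K A) (i + j)
      ⟨(Q : DOps K A) * R, mul_mem_diffFilt Q.2 R.2⟩) := by
  rw [DirectSum.of_mul_of]
  rfl

variable (K A) in
/-- The inclusion of `A` in `gr D` as the part of degree zero. -/
def ofRing : A →+* GrD K A where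
  toFun a := DirectSum.of (DGrPiece K A) 0 (GrPiece.mk (diffFilt K A) 0
    ⟨mulOp K A a, mulOp_mem_diffFilt a⟩)
  map_one' := of_grPiece_mk_congr rfl (map_one (mulOp K A))
  map_mul' a b := by
    rw [of_mk_mul_of_mk]
    exact of_grPiece_mk_congr rfl (map_mul (mulOp K A) a b)
  map_zero' := by
    rw [← map_zero (DirectSum.of (DGrPiece K A) 0), ← map_zero (GrPiece.mk (diffFilt K A) 0)]
    exact of_grPiece_mk_congr rfl (map_zero (mulOp K A))
  map_add' a b := by
    rw [← map_add, ← map_add]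
    exact of_grPiece_mk_congr rfl (map_add (mulOp K A) a b)

end GrRing

variable {K : Type u} [Field K] {n : ℕ}

/-- The class of `∂_i` in `gr D`. -/
def xi (i : Fin n) : GrD K (PowSer K n) :=
  DirectSum.of (DGrPiece K (PowSer K n)) 1 (GrPiece.mk (diffFilt K (PowSer K n)) 1
    ⟨dOp K i, dOp_mem i⟩)

/-- The ring homomorphism from a polynomial ring over `O` to `gr D`, an isomorphism in
characteristic zero. -/
def polyToGr (K : Type u) [Field K] (n : ℕ) :
    MvPolynomial (Fin n) (PowSer K n) →+* GrD K (PowSer K n) :=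
  MvPolynomial.eval₂Hom (ofRing K (PowSer K n)) xi

lemma polyToGr_C (a : PowSer K n) : polyToGr K n (MvPolynomial.C a) = ofRing K _ a :=
  MvPolynomial.eval₂_C _ _ _

lemma polyToGr_X (i : Fin n) : polyToGr K n (MvPolynomial.X i) = xi i :=
  MvPolynomial.eval₂_X _ _ _

lemma degLE_of_isHomogeneous {k : ℕ} {p : MvPolynomial (Fin n) (PowSer K n)}
    (hp : p.IsHomogeneous k) : DegLE k p := fun _ hα => hp.coeff_eq_zero (by
  rw [Finsupp.degree_apply] at hα ⊢
  exact hα.ne')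

lemma polyToGr_monomial {α : Fin n →₀ ℕ} {d : ℕ} (hα : α.degree = d) {a : PowSer K n}
    (Q : diffFilt K (PowSer K n) d)
    (hQ : (Q : DOps K (PowSer K n)) = op (MvPolynomial.monomial α a)) :
    polyToGr K n (MvPolynomial.monomial α a) =
      DirectSum.of (DGrPiece K (PowSer K n)) d (GrPiece.mk (diffFilt K (PowSer K n)) d Q) := by
  induction d generalizing α with
  | zero =>
    obtain rfl := (Finsupp.degree_eq_zero_iff α).1 hα
    rw [MvPolynomial.monomial_zero', polyToGr_C]
    exact of_grPiece_mk_congr rfl ((op_C a).symm.trans hQ.symm)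
  | succ d ih =>
    have hα0 : α ≠ 0 := by
      rintro rfl
      simp at hα
    obtain ⟨i, hi⟩ := Finsupp.ne_iff.1 hα0
    obtain ⟨β, rfl⟩ : ∃ β, α = β + Finsupp.single i 1 := by
      refine ⟨α - Finsupp.single i 1, (tsub_add_cancel_of_le ?_).symm⟩
      rw [Finsupp.single_le_iff]
      exact Nat.one_le_iff_ne_zero.2 hi
    have hβ : β.degree = d := by
      rw [map_add, Finsupp.degree_single] at hα
      omega
    have h1 : MvPolynomial.monomial (β + Finsupp.single i 1) a =
        MvPolynomial.monomial β a * MvPolynomial.X i := by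
      rw [MvPolynomial.X, MvPolynomial.monomial_mul, mul_one]
    rw [h1, op_mul_X] at hQ
    rw [h1, map_mul, polyToGr_X, ih hβ ⟨op (MvPolynomial.monomial β a), op_mem
      (degLE_of_isHomogeneous (MvPolynomial.isHomogeneous_monomial a hβ))⟩ rfl, mul_comm, xi,
      of_mk_mul_of_mk]
    exact of_grPiece_mk_congr (add_comm 1 d) hQ.symm

/-- On homogeneous polynomials `polyToGr` computes the principal symbol of `op p`. -/
lemma polyToGr_of_isHomogeneous {k : ℕ} {p : MvPolynomial (Fin n) (PowSer K n)}
    (hp : p.IsHomogeneous k) (Q : diffFilt K (PowSer K n) k)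
    (hQ : (Q : DOps K (PowSer K n)) = op p) : polyToGr K n p =
      DirectSum.of (DGrPiece K (PowSer K n)) k (GrPiece.mk (diffFilt K (PowSer K n)) k Q) := by
  have key : ∀ s ⊆ p.support, ∀ Q : diffFilt K (PowSer K n) k,
      (Q : DOps K (PowSer K n)) = op (∑ α ∈ s, MvPolynomial.monomial α (p.coeff α)) →
      polyToGr K n (∑ α ∈ s, MvPolynomial.monomial α (p.coeff α)) =
        DirectSum.of (DGrPiece K (PowSer K n)) k (GrPiece.mk (diffFilt K (PowSer K n)) k Q) := by
    classical
    intro s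
    induction s using Finset.induction_on with
    | empty =>
      intro _ Q hQ
      rw [Finset.sum_empty, op_zero] at hQ
      rw [Finset.sum_empty, map_zero, ← map_zero (DirectSum.of (DGrPiece K (PowSer K n)) k),
        ← map_zero (GrPiece.mk (diffFilt K (PowSer K n)) k)]
      exact of_grPiece_mk_congr rfl hQ.symm
    | insert α s hα ih =>
      intro hs Q hQ
      rw [Finset.insert_subset_iff] at hs
      have hd : α.degree = k := by
        have := hp (MvPolynomial.mem_support_iff.1 hs.1)
        rwa [Finsupp.degree_eq_weight_one]
      have hR : op (MvPolynomial.monomial α (p.coeff α)) ∈ diffFilt K (PowSer K n) k :=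
        op_mem (degLE_of_isHomogeneous (MvPolynomial.isHomogeneous_monomial _ hd))
      rw [Finset.sum_insert hα, op_add] at hQ
      have hS : op (∑ α ∈ s, MvPolynomial.monomial α (p.coeff α)) ∈ diffFilt K (PowSer K n) k := by
        have := sub_mem Q.2 hR
        rwa [hQ, add_sub_cancel_left] at this
      rw [Finset.sum_insert hα, map_add, polyToGr_monomial hd ⟨_, hR⟩ rfl, ih hs.2 ⟨_, hS⟩ rfl,
        ← map_add, ← map_add]
      exact of_grPiece_mk_congr rfl hQ.symm
  have h1 := key p.support subset_rfl Q
  rw [MvPolynomial.support_sum_monomial_coeff] at h1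
  exact h1 hQ

/-- The decomposition of Q in `exists_eq_add_sum` becomes ∑ ξ_i S_i in the graded ring. Only
surjectivity of `polyToGr` is needed below. -/
lemma polyToGr_surjective [CharZero K] : Function.Surjective (polyToGr K n) := by
  have key : ∀ (k : ℕ) (Q : diffFilt K (PowSer K n) k),
      DirectSum.of (DGrPiece K (PowSer K n)) k (GrPiece.mk (diffFilt K (PowSer K n)) k Q) ∈
        (polyToGr K n).range := by
    intro k
    induction k with
    | zero =>
      intro Q
      refine ⟨MvPolynomial.C ((Q : DOps K (PowSer K n)) • 1), ?_⟩
      rw [polyToGr_C]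
      exact of_grPiece_mk_congr rfl (eq_mulOp_of_mem_diffFilt_zero Q.2).symm
    | succ k ih =>
      rintro ⟨Q, hQ⟩
      obtain ⟨R, hR, S, hS, rfl⟩ := exists_eq_add_sum hQ
      have h1 : DirectSum.of (DGrPiece K (PowSer K n)) (k + 1)
          (GrPiece.mk (diffFilt K (PowSer K n)) (k + 1) ⟨_, hQ⟩) =
          ∑ i, xi i * DirectSum.of (DGrPiece K (PowSer K n)) k
            (GrPiece.mk (diffFilt K (PowSer K n)) k ⟨S i, hS i⟩) := by
        have h2 : ∀ i, xi i * DirectSum.of (DGrPiece K (PowSer K n)) k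
            (GrPiece.mk (diffFilt K (PowSer K n)) k ⟨S i, hS i⟩) =
            DirectSum.of (DGrPiece K (PowSer K n)) (k + 1)
              (GrPiece.mk (diffFilt K (PowSer K n)) (k + 1) ⟨dOp K i * S i, by
                rw [add_comm]
                exact mul_mem_diffFilt (dOp_mem i) (hS i)⟩) := by
          intro i
          rw [xi, of_mk_mul_of_mk]
          exact of_grPiece_mk_congr (add_comm 1 k) rfl
        simp only [h2]
        rw [← map_sum, ← map_sum]
        congr 1
        refine GrPiece.mk_eq_mk ?_
        rw [AddSubgroup.val_finsetSum, add_sub_cancel_right]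
        exact hR
      rw [h1]
      refine Subring.sum_mem _ fun i _ => Subring.mul_mem _ ⟨MvPolynomial.X i, polyToGr_X i⟩ (ih _)
  intro x
  rw [← RingHom.mem_range]
  induction x using DirectSum.induction_on with
  | zero => exact zero_mem _
  | add x y hx hy => exact add_mem hx hy
  | of i x =>
    obtain ⟨x, rfl⟩ := GrPiece.mk_surjective _ i x
    exact key i x

end PowSer

/-! ## The annihilator of a generator of the associated graded module -/

namespace PowSer

open MvPowerSeries

variable {K : Type u} [Field K] {n : ℕ}

/-- The ring homomorphism `O[ξ_1, …, ξ_n] → K[[X_1, …, X_n]]` with `X_i ↦ 0` and `ξ_i ↦ X_i` for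
`i ≤ g`, and `X_i ↦ X_i` and `ξ_i ↦ 0` for `i > g`. -/
def symMap (K : Type u) [Field K] (n g : ℕ) :
    MvPolynomial (Fin n) (PowSer K n) →+* PowSer K n :=
  MvPolynomial.eval₂Hom (kill (K := K) (n := n) g).toRingHom fun i => if i.val < g then X i else 0

lemma symMap_C (g : ℕ) (a : PowSer K n) : symMap K n g (MvPolynomial.C a) = kill g a :=
  MvPolynomial.eval₂_C _ _ _

lemma symMap_X (g : ℕ) (i : Fin n) :
    symMap K n g (MvPolynomial.X i) = if i.val < g then X i else 0 :=
  MvPolynomial.eval₂_X _ _ _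

lemma symMap_monomial_of_le {g : ℕ} {γ : Fin n →₀ ℕ} (hγ : ∀ i : Fin n, g ≤ i.val → γ i = 0)
    (a : PowSer K n) :
    symMap K n g (MvPolynomial.monomial γ a) = monomial γ 1 * kill g a := by
  rw [symMap, MvPolynomial.coe_eval₂Hom, MvPolynomial.eval₂_monomial, mul_comm]
  congr 1
  rw [monomial_one_eq]
  refine Finsupp.prod_congr fun i hi => ?_
  rw [if_pos]
  by_contra hc
  exact Finsupp.mem_support_iff.1 hi (hγ i (not_lt.1 hc))

lemma symMap_monomial_of_ne_zero {g : ℕ} {γ : Fin n →₀ ℕ} {i : Fin n} (hi : g ≤ i.val)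
    (hγ : γ i ≠ 0) (a : PowSer K n) : symMap K n g (MvPolynomial.monomial γ a) = 0 := by
  rw [symMap, MvPolynomial.coe_eval₂Hom, MvPolynomial.eval₂_monomial, Finsupp.prod,
    Finset.prod_eq_zero (Finsupp.mem_support_iff.2 hγ), mul_zero]
  rw [if_neg (not_lt.2 hi), zero_pow hγ]

/-- An exponent splits uniquely into a part in the first g variables, coming from the ξ_i, and a
part in the others, coming from coefficients. Hence no cancellation occurs between monomials. -/
lemma coeff_symMap {g : ℕ} {α β : Fin n →₀ ℕ} (hα : ∀ i : Fin n, g ≤ i.val → α i = 0)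
    (hβ : wt g β = 0) (p : MvPolynomial (Fin n) (PowSer K n)) :
    coeff (α + β) (symMap K n g p) = coeff β (p.coeff α) := by
  classical
  induction p using MvPolynomial.induction_on' with
  | monomial γ a =>
    rw [MvPolynomial.coeff_monomial]
    by_cases hγ : ∀ i : Fin n, g ≤ i.val → γ i = 0
    · rw [symMap_monomial_of_le hγ, coeff_monomial_mul]
      by_cases h : γ = α
      · subst h
        rw [if_pos le_self_add, if_pos rfl, one_mul, add_tsub_cancel_left, coeff_kill, if_pos hβ]
      · rw [if_neg h, map_zero, ite_eq_right_iff]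
        intro hle
        rw [one_mul, coeff_kill, if_neg]
        intro hw
        refine h (Finsupp.ext fun i => ?_)
        by_cases hi : i.val < g
        · have h1 := wt_eq_zero.1 hw i hi
          have h2 := wt_eq_zero.1 hβ i hi
          have h3 := hle i
          rw [Finsupp.tsub_apply, Finsupp.add_apply, h2] at h1
          rw [Finsupp.add_apply, h2] at h3
          omega
        · rw [hγ i (not_lt.1 hi), hα i (not_lt.1 hi)]
    · push Not at hγ
      obtain ⟨i, hi, hγi⟩ := hγ
      rw [symMap_monomial_of_ne_zero hi hγi, map_zero, if_neg, map_zero]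
      rintro rfl
      exact hγi (hα i hi)
  | add p q hp hq => rw [map_add, map_add, hp, hq, MvPolynomial.coeff_add, map_add]

lemma coeff_mem_varIdeal_of_symMap_eq_zero {g : ℕ} {p : MvPolynomial (Fin n) (PowSer K n)}
    (hp : symMap K n g p = 0) {α : Fin n →₀ ℕ} (hα : ∀ i : Fin n, g ≤ i.val → α i = 0) :
    p.coeff α ∈ varIdeal K n g := by
  rw [mem_varIdeal_iff]
  ext β
  rw [coeff_kill, map_zero]
  split_ifs with hβ
  · rw [← coeff_symMap hα hβ, hp, map_zero]
  · rfl

variable {g : ℕ} {M : Type u} [AddCommGroup M] [Module (DOps K (PowSer K n)) M] {η : M}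

/-- Acting by X_i with `i.val < g` replaces p by its ξ_i-derivative up to sign and lowers the order,
so these derivatives map to zero by induction. Euler's identity ∑ ξ_i ∂p/∂ξ_i = (k+1)p then gives
the claim, as the other ξ_i map to zero. -/
lemma symMap_eq_zero_of_smul_mem [CharZero K] (h : IsDeltaGen K n g η) {k : ℕ}
    {p : MvPolynomial (Fin n) (PowSer K n)} (hp : p.IsHomogeneous k)
    (hη : op p • η ∈ filtLt (ordFilt K n η) k) : symMap K n g p = 0 := by
  induction k generalizing p with
  | zero =>
    have h0 : op p • η = 0 := hη
    have h1 := (degLE_of_isHomogeneous hp).eq_C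
    rw [h1, op_C, mulOp_smul_eq_zero_iff h, mem_varIdeal_iff] at h0
    rw [h1, symMap_C, h0]
  | succ k ih =>
    obtain ⟨Q, hQ, hQη⟩ := mem_ordFilt.1 hη
    have h1 : ∀ i : Fin n, i.val < g → symMap K n g (MvPolynomial.pderiv i p) = 0 := by
      intro i hi
      refine ih hp.pderiv ?_
      rw [op_pderiv, ← neg_neg ((op p * xOp K i - xOp K i * op p) • η), ← xOp_smul_smul h _ hi,
        ← hQη, xOp_smul_smul h _ hi, neg_neg]
      cases k with
      | zero =>
        have h2 : Q * xOp K i - xOp K i * Q = 0 := mem_diffFilt_zero_iff.1 hQ (X i)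
        rw [h2, zero_smul]
        exact zero_mem _
      | succ k => exact ⟨_, mem_diffFilt_succ_iff.1 hQ (X i), rfl⟩
    have h2 := congrArg (symMap K n g) hp.sum_X_mul_pderiv
    rw [map_sum, Finset.sum_eq_zero, map_nsmul, eq_comm, ← Nat.cast_smul_eq_nsmul K] at h2
    · exact (smul_eq_zero.1 h2).resolve_left (Nat.cast_ne_zero.2 (Nat.succ_ne_zero k))
    · intro i _
      rw [map_mul, symMap_X]
      split_ifs with hi
      · rw [h1 i hi, mul_zero]
      · rw [zero_mul]

/-- The filtration of `M = D η` by the order of differential operators. -/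
def ordDFiltration (h : IsDeltaGen K n g η) : DFiltration K (PowSer K n) M where
  F := ordFilt K n η
  mono := ordFilt_mono
  exhaustive m := by
    obtain ⟨Q, rfl⟩ := h.exists_smul m
    obtain ⟨k, hk⟩ := exists_mem_diffFilt Q
    exact ⟨k, Q, hk, rfl⟩
  smul_mem _ _ _ hQ _ hm := smul_mem_ordFilt hQ hm

/-- The class of the generator `η` in the associated graded module. -/
def grGen (h : IsDeltaGen K n g η) : (ordDFiltration h).Gr :=
  DirectSum.of (ordDFiltration h).Piece 0 (GrPiece.mk (ordDFiltration h).F 0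
    ⟨η, 1, one_mem_diffFilt, one_smul _ η⟩)

lemma of_mk_smul_grGen (h : IsDeltaGen K n g η) {k : ℕ} (Q : diffFilt K (PowSer K n) k) :
    (DirectSum.of (DGrPiece K (PowSer K n)) k (GrPiece.mk (diffFilt K (PowSer K n)) k Q) :
      GrD K (PowSer K n)) • grGen h =
    DirectSum.of (ordDFiltration h).Piece k (GrPiece.mk (ordDFiltration h).F k
      ⟨(Q : DOps K (PowSer K n)) • η, Q, Q.2, rfl⟩) :=
  (of_smul_of_mk (ordDFiltration h) Q _).trans (of_grPiece_mk_congr (add_zero k) rfl)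

lemma exists_smul_grGen_eq (h : IsDeltaGen K n g η) (z : (ordDFiltration h).Gr) :
    ∃ r : GrD K (PowSer K n), z = r • grGen h := by
  induction z using DirectSum.induction_on with
  | zero => exact ⟨0, (zero_smul _ _).symm⟩
  | add z z' hz hz' =>
    obtain ⟨r, rfl⟩ := hz
    obtain ⟨r', rfl⟩ := hz'
    exact ⟨r + r', (add_smul _ _ _).symm⟩
  | of k z =>
    obtain ⟨⟨z, Q, hQ, rfl⟩, rfl⟩ := GrPiece.mk_surjective _ _ z
    exact ⟨_, (of_mk_smul_grGen h ⟨Q, hQ⟩).symm⟩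

lemma isGood_ordDFiltration (h : IsDeltaGen K n g η) : (ordDFiltration h).IsGood := by
  refine Module.Finite.of_surjective (LinearMap.toSpanSingleton (GrD K (PowSer K n)) _ (grGen h))
    fun z => ?_
  obtain ⟨r, rfl⟩ := exists_smul_grGen_eq h z
  exact ⟨r, rfl⟩

lemma of_mk_smul_grGen_eq_zero (h : IsDeltaGen K n g η) {k : ℕ} {Q : diffFilt K (PowSer K n) k}
    (hQ : (Q : DOps K (PowSer K n)) • η = 0) :
    (DirectSum.of (DGrPiece K (PowSer K n)) k (GrPiece.mk (diffFilt K (PowSer K n)) k Q) :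
      GrD K (PowSer K n)) • grGen h = 0 := by
  rw [of_mk_smul_grGen, ← map_zero (DirectSum.of _ k)]
  congr 1
  refine GrPiece.mk_eq_zero.2 ?_
  change (Q : DOps K (PowSer K n)) • η ∈ _
  rw [hQ]
  exact zero_mem _

lemma polyToGr_smul_grGen_eq_zero (h : IsDeltaGen K n g η)
    {p : MvPolynomial (Fin n) (PowSer K n)} (hp : symMap K n g p = 0) :
    polyToGr K n p • grGen h = 0 := by
  rw [← MvPolynomial.support_sum_monomial_coeff p, map_sum, Finset.sum_smul]
  refine Finset.sum_eq_zero fun α _ => ?_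
  by_cases hα : ∀ i : Fin n, g ≤ i.val → α i = 0
  · have h1 := coeff_mem_varIdeal_of_symMap_eq_zero hp hα
    rw [← mul_one (p.coeff α), ← MvPolynomial.C_mul_monomial, mul_comm, map_mul, mul_smul,
      polyToGr_C]
    refine (congrArg _ (of_mk_smul_grGen_eq_zero h ?_)).trans (smul_zero _)
    exact mulOp_smul_eq_zero h h1
  · push Not at hα
    obtain ⟨i, hi, hαi⟩ := hα
    have h1 : MvPolynomial.monomial α (p.coeff α) =
        MvPolynomial.monomial (α - Finsupp.single i 1) (p.coeff α) * MvPolynomial.X i := by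
      rw [MvPolynomial.X, MvPolynomial.monomial_mul, mul_one, tsub_add_cancel_of_le]
      exact Finsupp.single_le_iff.2 (Nat.one_le_iff_ne_zero.2 hαi)
    rw [h1, map_mul, mul_smul, polyToGr_X, xi, of_mk_smul_grGen_eq_zero h (h.dOp_smul i hi),
      smul_zero]

lemma polyToGr_smul_grGen_eq_zero_iff [CharZero K] (h : IsDeltaGen K n g η)
    {p : MvPolynomial (Fin n) (PowSer K n)} :
    polyToGr K n p • grGen h = 0 ↔ symMap K n g p = 0 := by
  refine ⟨fun h0 => ?_, polyToGr_smul_grGen_eq_zero h⟩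
  have hk : ∀ k, op (MvPolynomial.homogeneousComponent k p) ∈ diffFilt K (PowSer K n) k := fun k =>
    op_mem (degLE_of_isHomogeneous (MvPolynomial.homogeneousComponent_isHomogeneous k p))
  have h1 : ∀ k, polyToGr K n (MvPolynomial.homogeneousComponent k p) • grGen h =
      DirectSum.of (ordDFiltration h).Piece k (GrPiece.mk (ordDFiltration h).F k
        ⟨op (MvPolynomial.homogeneousComponent k p) • η, _, hk k, rfl⟩) := fun k => by
    rw [polyToGr_of_isHomogeneous (MvPolynomial.homogeneousComponent_isHomogeneous k p)
      ⟨_, hk k⟩ rfl, of_mk_smul_grGen]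
  rw [← MvPolynomial.sum_homogeneousComponent p, map_sum, Finset.sum_smul] at h0
  simp only [h1] at h0
  rw [← MvPolynomial.sum_homogeneousComponent p, map_sum]
  refine Finset.sum_eq_zero fun j hj => ?_
  refine symMap_eq_zero_of_smul_mem h (MvPolynomial.homogeneousComponent_isHomogeneous j p) ?_
  have h2 := congrArg (fun z : (ordDFiltration h).Gr => z j) h0
  simp only [DirectSum.sum_apply, DirectSum.zero_apply] at h2
  rw [Finset.sum_eq_single j] at h2
  · exact GrPiece.mk_eq_zero.1 ((DirectSum.of_eq_same j _).symm.trans h2)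
  · intro i _ hij
    exact DirectSum.of_eq_of_ne _ _ _ hij.symm
  · exact fun hc => absurd hj hc

/-- The annihilator computation shows that `symMap` kills ker `polyToGr`, so it descends to gr D,
with kernel the annihilator of the class of η. -/
lemma exists_grMap [CharZero K] (h : IsDeltaGen K n g η) :
    ∃ θ : GrD K (PowSer K n) →+* PowSer K n, (∀ p, θ (polyToGr K n p) = symMap K n g p) ∧
      ∀ r, r • grGen h = 0 ↔ r ∈ RingHom.ker θ := by
  have hker : RingHom.ker (polyToGr K n) ≤ RingHom.ker (symMap K n g) := by
    intro p hp
    rw [RingHom.mem_ker] at hp ⊢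
    rw [← polyToGr_smul_grGen_eq_zero_iff h, hp, zero_smul]
  have h1 : ∀ p, RingHom.liftOfSurjective (polyToGr K n) polyToGr_surjective
      ⟨symMap K n g, hker⟩ (polyToGr K n p) = symMap K n g p :=
    RingHom.liftOfRightInverse_comp_apply _ _ _ _
  refine ⟨_, h1, fun r => ?_⟩
  obtain ⟨p, rfl⟩ := polyToGr_surjective r
  rw [RingHom.mem_ker, h1, polyToGr_smul_grGen_eq_zero_iff]

lemma isGenericallyCyclic_ordDFiltration (h : IsDeltaGen K n g η)
    {θ : GrD K (PowSer K n) →+* PowSer K n}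
    (hθ : ∀ r, r • grGen h = 0 ↔ r ∈ RingHom.ker θ) :
    IsGenericallyCyclic (RingHom.ker θ) (ordDFiltration h).Gr where
  exists_generator := by
    refine ⟨grGen h, 1, hθ, (Ideal.ne_top_iff_one _).1 (RingHom.ker_ne_top θ), fun z => ?_⟩
    obtain ⟨r, rfl⟩ := exists_smul_grGen_eq h z
    exact ⟨r, one_smul _ _⟩
  exists_pow := by
    refine ⟨1, fun r hr z => ?_⟩
    rw [pow_one] at hr
    obtain ⟨s, rfl⟩ := exists_smul_grGen_eq h z
    rw [smul_comm, (hθ r).2 hr, smul_zero]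

end PowSer

/-! ## Localization and the multiplicity -/

section Localization

variable {R : Type*} [CommRing R] {S : Submonoid R} {N : Type*} [AddCommGroup N] [Module R N]

lemma Localization.mk_smul_localizedModule_mk (r : R) (s t : S) (z : N) :
    Localization.mk r s • LocalizedModule.mk z t = LocalizedModule.mk (r • z) (s * t) :=
  LocalizedModule.mk_smul_mk _ _ _ _

lemma IsGenericallyCyclic.localizedModule {q : Ideal R} [hp : q.IsPrime]
    (h : IsGenericallyCyclic q N) {Q : Ideal (Localization S)}
    (hQ : ∀ (r : R) (s : S), Localization.mk r s ∈ Q ↔ r ∈ q) :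
    IsGenericallyCyclic Q (LocalizedModule S N) where
  exists_generator := by
    have hS : ∀ s ∈ S, s ∉ q := by
      intro s hs hsq
      have h1 := (hQ s ⟨s, hs⟩).2 hsq
      rw [Localization.mk_self_mk, ← Localization.mk_one, hQ] at h1
      exact hp.ne_top ((Ideal.eq_top_iff_one q).2 h1)
    obtain ⟨x, f, hx, hf, hz⟩ := h.exists_generator
    refine ⟨LocalizedModule.mk x 1, Localization.mk f 1, fun r => ?_, fun hc => hf ((hQ f 1).1 hc),
      fun z => ?_⟩
    · induction r using Localization.induction_on with
      | H y =>
        obtain ⟨r, s⟩ := y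
        rw [Localization.mk_smul_localizedModule_mk, hQ, ← LocalizedModule.zero_mk (s * 1),
          LocalizedModule.mk_eq]
        constructor
        · rintro ⟨u, hu⟩
          rw [smul_zero, smul_zero, Submonoid.smul_def, Submonoid.smul_def, ← mul_smul,
            ← mul_smul, hx] at hu
          exact (hp.mem_or_mem hu).resolve_left (hS _ (mul_mem u.2 (s * 1).2))
        · intro hr
          exact ⟨1, by rw [(hx r).2 hr]⟩
    · induction z using LocalizedModule.induction_on with
      | h z t =>
        obtain ⟨r, hr⟩ := hz z
        refine ⟨Localization.mk r t, ?_⟩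
        rw [Localization.mk_smul_localizedModule_mk, Localization.mk_smul_localizedModule_mk, hr,
          one_mul, mul_one]
  exists_pow := by
    obtain ⟨k, hk⟩ := h.exists_pow
    have h1 : Q ≤ q.map (algebraMap R (Localization S)) := by
      intro r hr
      induction r using Localization.induction_on with
      | H y =>
        obtain ⟨r, s⟩ := y
        rw [hQ] at hr
        rw [Localization.mk_eq_mk', IsLocalization.mk'_eq_mul_mk'_one]
        exact Ideal.mul_mem_right _ _ (Ideal.mem_map_of_mem _ hr)
    have h2 : (q ^ k).map (algebraMap R (Localization S)) ≤
        Module.annihilator (Localization S) (LocalizedModule S N) := by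
      rw [Ideal.map_le_iff_le_comap]
      intro r hr
      rw [Ideal.mem_comap, Module.mem_annihilator]
      intro z
      induction z using LocalizedModule.induction_on with
      | h z t =>
        rw [← Localization.mk_one_eq_algebraMap, Localization.mk_smul_localizedModule_mk, hk r hr,
          LocalizedModule.zero_mk]
    refine ⟨k, fun r hr z => Module.mem_annihilator.1 (h2 ?_) z⟩
    rw [Ideal.map_pow]
    exact Ideal.pow_right_mono h1 k hr

end Localization

namespace PowSer

open MvPowerSeries IsLocalRing

variable {K : Type u} [Field K] {n g : ℕ} {M : Type u} [AddCommGroup M]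
  [Module (DOps K (PowSer K n)) M] {η : M}

lemma grDAug_ofRing (a : PowSer K n) :
    grDAug K (PowSer K n) (ofRing K (PowSer K n) a) = residue (PowSer K n) a := by
  refine (DirectSum.toSemiring_of _ _ _ _ _).trans ?_
  change residue (PowSer K n) (a * 1) = _
  rw [mul_one]

lemma grDAug_xi (i : Fin n) : grDAug K (PowSer K n) (xi i) = 0 :=
  DirectSum.toSemiring_of _ _ _ _ _

instance [CharZero K] : IsNoetherianRing (GrD K (PowSer K n)) :=
  isNoetherianRing_of_surjective _ _ (polyToGr K n) polyToGr_surjective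

lemma varIdeal_le_maximalIdeal (hg : g ≤ n) :
    varIdeal K n g ≤ maximalIdeal (PowSer K n) := by
  rw [maximalIdeal_eq]
  exact varIdeal_mono hg

section GrMap

variable [CharZero K] {θ : GrD K (PowSer K n) →+* PowSer K n}
  (hθ : ∀ p, θ (polyToGr K n p) = symMap K n g p)
include hθ

omit [CharZero K] in
lemma grMap_ofRing (a : PowSer K n) : θ (ofRing K _ a) = kill g a := by
  rw [← polyToGr_C, hθ, symMap_C]

omit [CharZero K] in
lemma grMap_xi (i : Fin n) : θ (xi i) = if i.val < g then X i else 0 := by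
  rw [← polyToGr_X, hθ, symMap_X]

/-- The augmentation of gr D and the residue of θ agree on O and on the ξ_i, hence everywhere; g ≤ n
ensures that setting X_1, …, X_g to zero preserves residues. -/
lemma mem_grDMax_iff (hg : g ≤ n) {r : GrD K (PowSer K n)} :
    r ∈ grDMax K (PowSer K n) ↔ θ r ∈ maximalIdeal (PowSer K n) := by
  have h1 : (grDAug K (PowSer K n)).comp (polyToGr K n) =
      (residue (PowSer K n)).comp (symMap K n g) := by
    refine MvPolynomial.ringHom_ext (fun a => ?_) fun i => ?_
    · rw [RingHom.comp_apply, RingHom.comp_apply, polyToGr_C, grDAug_ofRing, symMap_C,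
        ← sub_eq_zero, ← map_sub, residue_eq_zero_iff]
      exact varIdeal_le_maximalIdeal hg (sub_kill_mem g a)
    · rw [RingHom.comp_apply, RingHom.comp_apply, polyToGr_X, grDAug_xi, symMap_X, eq_comm,
        residue_eq_zero_iff]
      split_ifs
      · rw [maximalIdeal_eq]
        exact X_mem_varIdeal i.2
      · exact zero_mem _
  obtain ⟨p, rfl⟩ := polyToGr_surjective r
  rw [hθ, ← residue_eq_zero_iff]
  exact ((RingHom.congr_fun h1 p).congr_left).trans Iff.rfl

omit hθ in
/-- The elements `ξ_1, …, ξ_g, X_(g+1), …, X_n` of `gr D`. -/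
def grCoord (K : Type u) [Field K] (n g : ℕ) (i : Fin n) : GrD K (PowSer K n) :=
  if i.val < g then xi i else ofRing K (PowSer K n) (X i)

omit [CharZero K] in
lemma grMap_grCoord (i : Fin n) : θ (grCoord K n g i) = X i := by
  rw [grCoord]
  split_ifs with hi
  · rw [grMap_xi hθ, if_pos hi]
  · rw [grMap_ofRing hθ, kill_X_of_le (not_lt.1 hi)]

/-- Modulo J every element of gr D is congruent to a scalar, and for an element of the graded
maximal ideal this scalar is zero. -/
lemma grDMax_le (hg : g ≤ n) :
    grDMax K (PowSer K n) ≤ RingHom.ker θ ⊔ Ideal.span (Set.range (grCoord K n g)) := by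
  set J := RingHom.ker θ ⊔ Ideal.span (Set.range (grCoord K n g))
  have hJ : J ≤ (maximalIdeal (PowSer K n)).comap θ := by
    refine sup_le (fun r hr => ?_) (Ideal.span_le.2 ?_)
    · rw [Ideal.mem_comap, (RingHom.mem_ker).1 hr]
      exact zero_mem _
    · rintro _ ⟨i, rfl⟩
      change θ _ ∈ maximalIdeal (PowSer K n)
      rw [grMap_grCoord hθ, maximalIdeal_eq]
      exact X_mem_varIdeal i.2
  have hxi : ∀ i, xi i ∈ J := by
    intro i
    by_cases hi : i.val < g
    · exact Ideal.mem_sup_right (Ideal.subset_span ⟨i, by rw [grCoord, if_pos hi]⟩)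
    · exact Ideal.mem_sup_left (by rw [RingHom.mem_ker, grMap_xi hθ, if_neg hi])
  have hO : varIdeal K n n ≤ J.comap (ofRing K (PowSer K n)) := by
    refine Ideal.span_le.2 ?_
    rintro _ ⟨i, _, rfl⟩
    change ofRing K _ (X i) ∈ J
    by_cases hi : i.val < g
    · exact Ideal.mem_sup_left (by rw [RingHom.mem_ker, grMap_ofRing hθ, kill_X_of_lt hi])
    · exact Ideal.mem_sup_right (Ideal.subset_span ⟨i, by rw [grCoord, if_neg hi]⟩)
  have key : ∀ p, ∃ c : K, polyToGr K n p - ofRing K _ (C c) ∈ J := by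
    intro p
    induction p using MvPolynomial.induction_on with
    | C a =>
      refine ⟨constantCoeff a, ?_⟩
      rw [polyToGr_C, ← map_sub]
      exact hO (sub_C_mem a)
    | add p q hp hq =>
      obtain ⟨c, hc⟩ := hp
      obtain ⟨d, hd⟩ := hq
      refine ⟨c + d, ?_⟩
      rw [map_add, map_add, map_add, add_sub_add_comm]
      exact add_mem hc hd
    | mul_X p i _ =>
      refine ⟨0, ?_⟩
      rw [map_zero, map_zero, sub_zero, map_mul, polyToGr_X]
      exact Ideal.mul_mem_left _ _ (hxi i)
  intro r hr
  obtain ⟨p, rfl⟩ := polyToGr_surjective r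
  obtain ⟨c, hc⟩ := key p
  rw [mem_grDMax_iff hθ hg] at hr
  have h1 := sub_mem hr (hJ hc)
  rw [map_sub, sub_sub_cancel, grMap_ofRing hθ, maximalIdeal_eq, mem_varIdeal_self] at h1
  have h2 : constantCoeff (kill g (C c : PowSer K n)) = c := by
    rw [← coeff_zero_eq_constantCoeff_apply, coeff_kill, if_pos (wt_eq_zero.2 fun _ _ => rfl),
      coeff_zero_eq_constantCoeff_apply, constantCoeff_C]
  rw [h2] at h1
  rwa [h1, map_zero, map_zero, sub_zero] at hc

lemma isUnit_grMap (hg : g ≤ n) (s : (grDMax K (PowSer K n)).primeCompl) :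
    IsUnit (θ s) := by
  by_contra hs
  exact s.2 ((mem_grDMax_iff hθ hg).2 hs)

/-- A finitely generated `gr D`-module that is generically cyclic along the kernel of `θ` has
multiplicity one at the graded maximal ideal. -/
lemma hasMultiplicity_one_localizedModule (hg : g ≤ n) {N : Type u} [AddCommGroup N]
    [Module (GrD K (PowSer K n)) N] [Module.Finite (GrD K (PowSer K n)) N]
    (hN : IsGenericallyCyclic (RingHom.ker θ) N) :
    HasMultiplicity (Localization.AtPrime (grDMax K (PowSer K n)))
      (LocalizedModule (grDMax K (PowSer K n)).primeCompl N) 1 := by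
  let L := Localization.AtPrime (grDMax K (PowSer K n))
  let ι : GrD K (PowSer K n) →+* L := algebraMap _ _
  -- The scalars are taken through O, so that the extension of θ to the localization is K-linear.
  let : Algebra K L :=
    (ι.comp ((ofRing K (PowSer K n)).comp (algebraMap K (PowSer K n)))).toAlgebra
  let Θ : L →+* PowSer K n := IsLocalization.lift (isUnit_grMap hθ hg)
  have hΘι : ∀ r, Θ (ι r) = θ r := fun r => IsLocalization.lift_eq _ r
  let Θ' : L →ₐ[K] PowSer K n :=
    { Θ with
      commutes' := fun c => (hΘι _).trans ((grMap_ofRing hθ _).trans ((kill g).commutes c)) }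
  have hcoord : IsCoordinateMap Θ' fun i => ι (grCoord K n g i) :=
    { map_eq := fun i => (hΘι _).trans (grMap_grCoord hθ i)
      maximalIdeal_le := by
        rw [← Localization.AtPrime.map_eq_maximalIdeal]
        refine (Ideal.map_mono (grDMax_le hθ hg)).trans ?_
        rw [Ideal.map_sup, Ideal.map_span, ← Set.range_comp]
        refine sup_le_sup_right (Ideal.map_le_iff_le_comap.2 fun r hr => ?_) _
        exact (hΘι r).trans hr }
  have : IsNoetherianRing L := IsLocalization.isNoetherianRing (grDMax K (PowSer K n)).primeCompl _
    inferInstance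
  have : Module.Finite L (LocalizedModule (grDMax K (PowSer K n)).primeCompl N) :=
    Module.Finite.of_isLocalizedModule (grDMax K (PowSer K n)).primeCompl
      (LocalizedModule.mkLinearMap (grDMax K (PowSer K n)).primeCompl N)
  have := RingHom.ker_isPrime θ
  refine hcoord.hasMultiplicity_one (hN.localizedModule fun r s => ?_)
  -- The kernel of the extended map is the localization of ker θ, because denominators go to units.
  change Θ _ = 0 ↔ θ r = 0
  rw [Localization.mk_eq_mk', IsLocalization.lift_mk', mul_eq_zero]
  refine or_iff_left ?_
  exact Units.ne_zero _

end GrMap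

/-- The multiplicity of a `D`-module generated by an element annihilated by `X_1, …, X_g` and
`∂_(g+1), …, ∂_n`. -/
lemma IsDeltaGen.hasDMultiplicity_one [CharZero K] (hg : g ≤ n) (h : IsDeltaGen K n g η) :
    HasDMultiplicity K (PowSer K n) M 1 := by
  obtain ⟨θ, hθ, hker⟩ := exists_grMap h
  refine ⟨h.finite, ⟨_, isGood_ordDFiltration h⟩, fun F hF => ?_⟩
  have := RingHom.ker_isPrime θ
  have : Module.Finite (GrD K (PowSer K n)) F.Gr := hF
  exact hasMultiplicity_one_localizedModule hθ hg (DFiltration.isGenericallyCyclic_of_isGood hF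
    (isGood_ordDFiltration h) _ (isGenericallyCyclic_ordDFiltration h hker))

end PowSer

end

theorem lemma7 {K : Type u} [Field K] [CharZero K] {n g : ℕ} (hg : g ≤ n) :
    (1 ≤ g →
      Nonempty
        ((ModuleCat.restrictScalars (mulOp K (PowSer K n)).toRingHom).obj
            ((localCohD K (varIdeal K n g) g).obj (ModuleCat.of (DOps K (PowSer K n)) (PowSer K n)))
          ≅ (localCoh (varIdeal K n g) g).obj (ModuleCat.of (PowSer K n) (PowSer K n))) ∧
      HasDMultiplicity K (PowSer K n)
        ((localCohD K (varIdeal K n g) g).obj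
          (ModuleCat.of (DOps K (PowSer K n)) (PowSer K n))) 1 ∧
      IsSimpleModule (DOps K (PowSer K n))
        ((localCohD K (varIdeal K n g) g).obj
          (ModuleCat.of (DOps K (PowSer K n)) (PowSer K n)))) ∧
    (g < n → ∀ (J : Ideal (PowSer K n)) (hJ : J ≤ varIdeal K n g),
      (associatedPrimes (PowSer K n)
          (LinearMap.range
            (thetaMap hJ g (ModuleCat.of (PowSer K n) (PowSer K n))).hom) = ∅ ∨
        associatedPrimes (PowSer K n)
          (LinearMap.range
            (thetaMap hJ g (ModuleCat.of (PowSer K n) (PowSer K n))).hom) = {varIdeal K n g}) ∧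
      varIdeal K n n ∉ associatedPrimes (PowSer K n)
          (LinearMap.range
            (thetaMap hJ g (ModuleCat.of (PowSer K n) (PowSer K n))).hom)) := by
  refine ⟨fun _ => ?_, fun hgn J hJ => ?_⟩
  · obtain ⟨η, hη⟩ := PowSer.exists_isDeltaGen_localCohD (K := K) hg
    exact ⟨PowSer.nonempty_resD_localCohD_iso _ _, hη.hasDMultiplicity_one hg, hη.isSimpleModule⟩
  · have h := PowSer.associatedPrimes_range_thetaMap hg hJ
    refine ⟨h, fun hmem => ?_⟩
    rcases h with h | h <;> rw [h] at hmem
    · exact hmem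
    · exact PowSer.varIdeal_self_ne hgn hmem
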